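/- Let $n\ge 2$, let $(M,\overline g)$ be a smooth $(n+1)$-dimensional Riemannian manifold, let $\Sigma$ be a smooth $n$-dimensional manifold (compact or not, without boundary), and let $i:\Sigma\to M$ be a smooth immersion with a smooth unit normal field $\nu$ along $i$. Let $g:=i^*\overline g$ be the induced metric and let $A$ be the shape operator, $di(AX)=\overline\nabla_X\nu$. Suppose that $i$ is locally strictly convex, i.e. that $A$ is positive definite at every point, and that $\det A=e^{h\circ i}$ for a smooth function $h:M\to\mathbb R$. Let $g^A:=g(A\cdot,\cdot)$, which is a Riemannian metric on $\Sigma$, let $\nabla^A$ be its Levi-Civita covariant derivative, and let $B^{ij}$ be the inverse matrix of $A_{ij}:=g(Ae_i,e_j)$ in any local frame $(e_i)$ of $T\Sigma$. For a metric on a $d$-dimensional manifold, write $R_{ijk}{}^l e_l=R(e_i,e_j)e_k$ with $R(X,Y)=\nabla_X\nabla_Y-\nabla_Y\nabla_X-\nabla_{[X,Y]}$, and normalise the Ricci and scalar curvatures by $$\mathrm{Ric}_{ik}=-\frac1{d-1}R_{ijk}{}^j,\qquad \mathrm{Scal}=\frac1d\,\mathrm{Ric}_i{}^i,$$ so that the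 unit sphere has $\mathrm{Ric}_{ij}=\delta_{ij}$ in an orthonormal frame and $\mathrm{Scal}=1$. Let $\mathrm{Ric}$ be the Ricci curvature of $g$, let $\mathrm{Scal}^A$ be the scalar curvature of $g^A$, and let $\overline R$ be the curvature tensor of $\overline g$. Then there is a smooth $1$-form $\alpha$ on $\Sigma$ such that, for every $\lambda>0$ and at every point of $\Sigma$, $$\mathrm{Scal}^A\ \ge\ \frac1n B^{ik}\mathrm{Ric}_{ik}+\nabla^A\!\cdot\alpha-\frac{1+\lambda}{4n(n-1)}\|dh\|_A^2-\frac{1+n\lambda^{-1}}{4n(n-1)}\|\overline R_{\cdot\cdot\nu\cdot}\|_A^2 .$$ Here $\nabla^A\!\cdot\alpha$ is the divergence of $\alpha$ with respect to $\nabla^A$, $\|dh\|_A^2=B^{ij}h_ih_j$ with $h_i=d(h\circ i)(e_i)$, and $\|\overline R_{\cdot\cdot\nu\cdot}\|_A^2=B^{ip}B^{jq}B^{kr}\,\overline R_{ij\nu k}\,\overline R_{pq\nu r}$ with $\overline R_{ij\nu k}=\overline g\big(\overline R(di\,e_i,di\,e_j)\nu,\,di\,e_k\big)$. -/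

import Mathlib

open Bundle Manifold
open scoped ContDiff Matrix

noncomputable section

namespace RiemannianHypersurface

/-- The Euclidean model space `ℝ^d`. -/
abbrev E (d : ℕ) : Type := EuclideanSpace ℝ (Fin d)

/-- A field of bilinear forms on the tangent spaces of a `d`-dimensional manifold. -/
abbrev FormField (d : ℕ) (X : Type*) [TopologicalSpace X] [ChartedSpace (E d) X] : Type _ :=
  ∀ x : X, LinearMap.BilinForm ℝ (TangentSpace (𝓡 d) x)

section Charts

variable {d : ℕ} {X : Type*} [TopologicalSpace X] [ChartedSpace (E d) X]

/-- The components at `q` of a tangent vector in the chart `φ` centred at `c`, i.e. `dφ_q v`. -/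
def coords (c q : X) : TangentSpace (𝓡 d) q →L[ℝ] E d :=
  mvfderiv (𝓡 d) (extChartAt (𝓡 d) c) q

/-- The coordinate vector `∂_i` at `q` of the chart centred at `c`
(for `q` in the domain of that chart). -/
def coordVec (c q : X) (i : Fin d) : TangentSpace (𝓡 d) q :=
  (coords c q).inverse (EuclideanSpace.single i 1)

/-- The components `g_{ij} = g(∂_i, ∂_j)` at `q` in the chart centred at `c`. -/
def gram (g : FormField d X) (c q : X) : Matrix (Fin d) (Fin d) ℝ :=
  Matrix.of fun i j => g q (coordVec c q i) (coordVec c q j)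

/-- The components `g_{ij}` as functions of the coordinates of the chart centred at `c`. -/
def metricComp (g : FormField d X) (c : X) (y : E d) : Matrix (Fin d) (Fin d) ℝ :=
  gram g c ((extChartAt (𝓡 d) c).symm y)

/-- The partial derivative `∂f/∂y^i`. -/
def pd (i : Fin d) (f : E d → ℝ) (y : E d) : ℝ :=
  fderiv ℝ f y (EuclideanSpace.single i 1)

/-- The Christoffel symbol `Γ^k_{ij}` of the Levi-Civita covariant derivative of `g`, as a function
of the coordinates of the chart centred at `c`. -/
def christoffel (g : FormField d X) (c : X) (k i j : Fin d) (y : E d) : ℝ :=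
  (1 / 2) * ∑ p, (metricComp g c y)⁻¹ k p *
    (pd j (fun z => metricComp g c z p i) y + pd i (fun z => metricComp g c z p j) y
      - pd p (fun z => metricComp g c z i j) y)

/-- The component `R_{ijk}^l` of the curvature tensor, `R(∂_i, ∂_j) ∂_k = R_{ijk}^l ∂_l` with
`R(X, Y) = ∇_X ∇_Y - ∇_Y ∇_X - ∇_{[X, Y]}`, at the point with coordinates `y`. -/
def riemannComp (g : FormField d X) (c : X) (i j k l : Fin d) (y : E d) : ℝ :=
  pd i (christoffel g c l j k) y - pd j (christoffel g c l i k) y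
    + ∑ m, (christoffel g c l i m y * christoffel g c m j k y
      - christoffel g c l j m y * christoffel g c m i k y)

/-- The curvature tensor of `g` as a `4`-linear function: `g(R(u, v) w, z)`. -/
def riemann (g : FormField d X) (x : X) (u v w z : TangentSpace (𝓡 d) x) : ℝ :=
  ∑ i, ∑ j, ∑ k, ∑ l, coords x x u i * coords x x v j * coords x x w k *
    riemannComp g x i j k l (extChartAt (𝓡 d) x x) * g x (coordVec x x l) z

/-- The components `Ric_{ik} = -(1/(d-1)) R_{ijk}^j` of the (normalised) Ricci curvature of `g`
at `x`, in the chart centred at `x`. The unit sphere has `Ric = g`. -/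
def ricci (g : FormField d X) (x : X) : Matrix (Fin d) (Fin d) ℝ :=
  Matrix.of fun i k =>
    -(1 / ((d : ℝ) - 1)) * ∑ j, riemannComp g x i j k j (extChartAt (𝓡 d) x x)

/-- The trace `γ^{ik} Ric_{ik}` of the Ricci curvature of `g` with respect to a second metric `γ`
(`γ^{ik}` denotes the inverse matrix of `γ_{ik}`). -/
def traceRicci (γ g : FormField d X) (x : X) : ℝ :=
  ∑ i, ∑ k, (gram γ x x)⁻¹ i k * ricci g x i k

/-- The (normalised) scalar curvature `(1/d) g^{ik} Ric_{ik}`. The unit sphere has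
scalar curvature `1`. -/
def scal (g : FormField d X) (x : X) : ℝ :=
  (1 / (d : ℝ)) * traceRicci g g x

/-- The divergence `g^{ij} (∂_j α_i - Γ^k_{ij} α_k)` of a `1`-form `α` with respect to the
Levi-Civita covariant derivative of `g`. -/
def divergence (g : FormField d X) (α : ∀ x : X, TangentSpace (𝓡 d) x →L[ℝ] ℝ) (x : X) : ℝ :=
  ∑ i, ∑ j, (gram g x x)⁻¹ i j *
    (pd j (fun y => α ((extChartAt (𝓡 d) x).symm y)
        (coordVec x ((extChartAt (𝓡 d) x).symm y) i)) (extChartAt (𝓡 d) x x)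
      - ∑ k, christoffel g x k i j (extChartAt (𝓡 d) x x) * α x (coordVec x x k))

/-- The squared norm `g^{ij} θ_i θ_j` of a covector. -/
def normSq₁ (g : FormField d X) (x : X) (θ : TangentSpace (𝓡 d) x → ℝ) : ℝ :=
  ∑ i, ∑ j, (gram g x x)⁻¹ i j * θ (coordVec x x i) * θ (coordVec x x j)

/-- The squared norm `g^{ip} g^{jq} g^{kr} T_{ijk} T_{pqr}` of a trilinear form. -/
def normSq₃ (g : FormField d X) (x : X)
    (T : TangentSpace (𝓡 d) x → TangentSpace (𝓡 d) x → TangentSpace (𝓡 d) x → ℝ) : ℝ :=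
  ∑ i, ∑ j, ∑ k, ∑ p, ∑ q, ∑ r,
    (gram g x x)⁻¹ i p * (gram g x x)⁻¹ j q * (gram g x x)⁻¹ k r *
      T (coordVec x x i) (coordVec x x j) (coordVec x x k) *
      T (coordVec x x p) (coordVec x x q) (coordVec x x r)

/-- A smooth `1`-form, as a smooth section of the cotangent bundle. -/
def IsSmoothOneForm [IsManifold (𝓡 d) ∞ X]
    (α : ∀ x : X, TangentSpace (𝓡 d) x →L[ℝ] ℝ) : Prop :=
  ContMDiff (𝓡 d) ((𝓡 d).prod 𝓘(ℝ, E d →L[ℝ] ℝ)) ∞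
    (fun x => TotalSpace.mk' (E d →L[ℝ] ℝ) (E := fun x : X => TangentSpace (𝓡 d) x →L[ℝ] ℝ)
      x (α x))

end Charts

section Hypersurface

variable {n m : ℕ} {S M : Type*} [TopologicalSpace S] [ChartedSpace (E n) S]
  [TopologicalSpace M] [ChartedSpace (E m) M]

/-- The differential `df_x : T_x S → T_{f(x)} M`. -/
def diff (f : S → M) (x : S) : TangentSpace (𝓡 n) x →ₗ[ℝ] TangentSpace (𝓡 m) (f x) :=
  (mfderiv (𝓡 n) (𝓡 m) f x).toLinearMap

/-- The pull-back `f^* g`. -/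
def pullback (g : FormField m M) (f : S → M) : FormField n S :=
  fun x => (g (f x)).comp (diff f x) (diff f x)

/-- The covariant derivative `v ↦ ∇_v N` at `x` of a vector field `N` along a map `f`, for the
Levi-Civita covariant derivative of `g`. In coordinates of the target centred at `f x`, it is
`(∇_v N)^k = v(N^k) + Γ^k_{ij} (df v)^i N^j`. -/
def covDerivAlong (g : FormField m M) (f : S → M) (N : ∀ x, TangentSpace (𝓡 m) (f x)) (x : S) :
    TangentSpace (𝓡 n) x →ₗ[ℝ] TangentSpace (𝓡 m) (f x) where
  toFun v := (coords (f x) (f x)).inverse (WithLp.toLp 2 fun k =>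
    mvfderiv (𝓡 n) (fun z => coords (f x) (f z) (N z) k) x v
      + ∑ i, ∑ j, christoffel g (f x) k i j (extChartAt (𝓡 m) (f x) (f x))
          * coords (f x) (f x) (diff f x v) i * coords (f x) (f x) (N x) j)
  map_add' v w := by
    rw [← map_add]
    congr 1
    ext k
    simp only [map_add, PiLp.add_apply, mul_add, add_mul, Finset.sum_add_distrib]
    ring
  map_smul' a v := by
    rw [RingHom.id_apply, ← map_smul]
    congr 1
    ext k
    simp only [map_smul, PiLp.smul_apply, smul_eq_mul, mul_add, Finset.mul_sum]
    congr 1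
    refine Finset.sum_congr rfl fun i _ => Finset.sum_congr rfl fun j _ => ?_
    ring

/-- The shape operator `A` of an immersion `f` with unit normal field `N`: the endomorphism of
`T_x S` determined by `df (A v) = ∇_v N`. (As `∇_v N` is tangent to the immersion, the choice of a
left inverse of `df` is immaterial.) -/
def shapeOperator (g : FormField m M) (f : S → M) (N : ∀ x, TangentSpace (𝓡 m) (f x)) (x : S) :
    TangentSpace (𝓡 n) x →ₗ[ℝ] TangentSpace (𝓡 n) x :=
  (diff f x).leftInverse ∘ₗ covDerivAlong g f N x

/-- The metric `g^A = g(A ·, ·)` on the source, where `g = f^* ḡ` is the induced metric and `A` is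
the shape operator. -/
def shapeMetric (g : FormField m M) (f : S → M) (N : ∀ x, TangentSpace (𝓡 m) (f x)) :
    FormField n S :=
  fun x => (pullback g f x).comp (shapeOperator g f N x) LinearMap.id

/-- A smooth immersion. -/
structure IsSmoothImmersion (n m : ℕ) {S M : Type*} [TopologicalSpace S] [ChartedSpace (E n) S]
    [TopologicalSpace M] [ChartedSpace (E m) M] (f : S → M) : Prop where
  contMDiff : ContMDiff (𝓡 n) (𝓡 m) ∞ f
  injective_diff (x : S) : Function.Injective (diff (n := n) (m := m) f x)

/-- A smooth unit normal vector field along `f`. -/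
structure IsUnitNormal [IsManifold (𝓡 m) ∞ M] (g : FormField m M) (f : S → M)
    (N : ∀ x, TangentSpace (𝓡 m) (f x)) : Prop where
  contMDiff : ContMDiff (𝓡 n) (𝓡 m).tangent ∞ (fun x => (⟨f x, N x⟩ : TangentBundle (𝓡 m) M))
  norm_eq_one (x : S) : g (f x) (N x) (N x) = 1
  orthogonal (x : S) (v : TangentSpace (𝓡 n) x) : g (f x) (N x) (diff f x v) = 0

/-- `f` is locally strictly convex with outward unit normal `N`: the shape operator `v ↦ ∇_v N`
is positive definite at every point. -/
def IsLocallyStrictlyConvex (g : FormField m M) (f : S → M) (N : ∀ x, TangentSpace (𝓡 m) (f x)) :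
    Prop :=
  ∀ (x : S) (v : TangentSpace (𝓡 n) x), v ≠ 0 →
    0 < shapeMetric g f N x v v

/-- The trilinear form `R̄_{··ν·}` on `T_x S`: `(u, v, w) ↦ ḡ(R̄(df u, df v) N, df w)`. -/
def curvNormal (g : FormField m M) (f : S → M) (N : ∀ x, TangentSpace (𝓡 m) (f x)) (x : S)
    (u v w : TangentSpace (𝓡 n) x) : ℝ :=
  riemann g (f x) (diff f x u) (diff f x v) (N x) (diff f x w)

end Hypersurface

/-- The field of bilinear forms underlying a smooth Riemannian metric. -/
def formOf {d : ℕ} {X : Type*} [TopologicalSpace X] [ChartedSpace (E d) X]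
    [IsManifold (𝓡 d) ∞ X]
    (g : ContMDiffRiemannianMetric (𝓡 d) ∞ (E d) (fun x : X => TangentSpace (𝓡 d) x)) :
    FormField d X :=
  fun x => (g.inner x).toBilinForm

end RiemannianHypersurface

end

open RiemannianHypersurface

open Bundle Manifold
open scoped ContDiff Matrix

noncomputable section

namespace RiemannianHypersurface

-- Write g for the induced metric, b for g^A, B for the inverse of b, T = ∇^g b, and D for the
-- Levi-Civita connection of b minus that of g. Three facts tie these tensors to the geometry. The
-- Codazzi equation says T_{ijk} − T_{jik} = R̄_{ijνk} (`codazzi_metricComp`). The Koszul formula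
-- gives b_{pl} D^l_{ik} = ½(T_{ikp} + T_{kip} − T_{pik}) (`sum_mul_christoffelDiff`). Since det b =
-- e^h det g, Jacobi's formula gives D^j_{jk} = ½ h_k (`sum_christoffelOf_sub`).
--
-- Substituting Γ^g = Γ^b − D into the curvature and tracing with B yields, with V^l = B^{ik}
-- D^l_{ik} and all covariant derivatives taken for b, B^{ik} R_{ijk}^j(g) = B^{ik} R_{ijk}^j(b) +
-- div(V♭ − ½ dh) + B^{ik} D^j_{il} D^l_{jk} − ½ V^l h_l (`sum_inv_mul_ricciOf`). By Koszul and
-- Codazzi the form V♭ − ½ dh equals B^{ik} R̄_{i·νk} (`traceForm_eq`). Divided by n(n−1), this is α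
-- (`curvForm`); it does not involve λ.
--
-- What remains is algebra at one point (`sum_connection_orthonormal_ge`). In a b-orthonormal frame
-- the quadratic term in D equals ¼|T|² − ¼|R̄|², and V♭ = ½ dh + q with q a trace of R̄. Young's
-- inequality with parameter λ bounds ½⟨q, dh⟩, Cauchy–Schwarz gives |q|² ≤ n|R̄|², and ¼|T|² ≥ 0 is
-- discarded.
--
-- The analytic work is to bring the intrinsic objects to this form. They are defined at each point
-- in the chart centred there, so they must be expressed in one fixed chart before being
-- differentiated. A calculus of vector fields along maps between normed spaces serves both
-- purposes: applied to the immersion, its Gauss formula relates the ambient and induced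
-- connections; applied to the identity map, it gives independence of the chart
-- (`IsSmoothMetric.covAlong_locMap_id`).

local instance {d : ℕ} : NormedAddCommGroup (E d →L[ℝ] ℝ) :=
  ContinuousLinearMap.toNormedAddCommGroup
local instance {d : ℕ} : NormedSpace ℝ (E d →L[ℝ] ℝ) := ContinuousLinearMap.toNormedSpace
local instance {d : ℕ} : NormedAddCommGroup (E d →L[ℝ] E d) :=
  ContinuousLinearMap.toNormedAddCommGroup
local instance {d : ℕ} : NormedSpace ℝ (E d →L[ℝ] E d) := ContinuousLinearMap.toNormedSpace
local instance {d : ℕ} : NormedAddCommGroup (E d →L[ℝ] E d →L[ℝ] ℝ) :=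
  ContinuousLinearMap.toNormedAddCommGroup
local instance {d : ℕ} : NormedSpace ℝ (E d →L[ℝ] E d →L[ℝ] ℝ) := ContinuousLinearMap.toNormedSpace
local instance {d : ℕ} : NormedAddCommGroup (E d →L[ℝ] E d →L[ℝ] E d) :=
  ContinuousLinearMap.toNormedAddCommGroup
local instance {d : ℕ} : NormedSpace ℝ (E d →L[ℝ] E d →L[ℝ] E d) :=
  ContinuousLinearMap.toNormedSpace

local instance isManifold_one_of_infty {d : ℕ} {X : Type*} [TopologicalSpace X]
    [ChartedSpace (E d) X] [IsManifold (𝓡 d) ∞ X] : IsManifold (𝓡 d) 1 X :=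
  IsManifold.of_le (m := 1) (n := ∞) (by exact_mod_cast le_top)

/-! ### Fields along maps between normed spaces: Gauss, Codazzi and the second fundamental form. -/

section CoordinateFree

set_option synthInstance.maxHeartbeats 400000

variable {V W : Type*} [NormedAddCommGroup V] [NormedSpace ℝ V] [NormedAddCommGroup W]
  [NormedSpace ℝ W]

/-- The covariant derivative of a vector field `X` along `F`, for the connection form `Γ`. -/
def covAlong (Γ : W → W →L[ℝ] W →L[ℝ] W) (F X : V → W) (y u : V) : W :=
  fderiv ℝ X y u + Γ (F y) (fderiv ℝ F y u) (X y)

/-- The curvature of the connection form `Γ`. -/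
def curvatureOf (Γ : W → W →L[ℝ] W →L[ℝ] W) (p a b c : W) : W :=
  fderiv ℝ Γ p a b c - fderiv ℝ Γ p b a c + Γ p a (Γ p b c) - Γ p b (Γ p a c)

/-- The connection form `Γ` is compatible with `G` at `p`. -/
def IsCompatibleAt (G : W → W →L[ℝ] W →L[ℝ] ℝ) (Γ : W → W →L[ℝ] W →L[ℝ] W) (p : W) : Prop :=
  ∀ a v w, fderiv ℝ G p a v w = G p (Γ p a v) w + G p v (Γ p a w)

/-- Compatibility turns the derivative of G ∘ F into the two Γ-terms that complete the ordinary
derivatives of X and Y to covariant ones. -/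
theorem fderiv_inner_along {G : W → W →L[ℝ] W →L[ℝ] ℝ} {Γ : W → W →L[ℝ] W →L[ℝ] W}
    {F X Y : V → W} {y : V} (hG : DifferentiableAt ℝ G (F y)) (hF : DifferentiableAt ℝ F y)
    (hX : DifferentiableAt ℝ X y) (hY : DifferentiableAt ℝ Y y) (hc : IsCompatibleAt G Γ (F y))
    (u : V) :
    fderiv ℝ (fun z => G (F z) (X z) (Y z)) y u
      = G (F y) (covAlong Γ F X y u) (Y y) + G (F y) (X y) (covAlong Γ F Y y u) := by
  have h0 : HasFDerivAt (fun z => G (F z)) ((fderiv ℝ G (F y)).comp (fderiv ℝ F y)) y :=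
    HasFDerivAt.comp (g := G) (g' := fderiv ℝ G (F y)) y hG.hasFDerivAt hF.hasFDerivAt
  have h := (h0.clm_apply hX.hasFDerivAt).clm_apply hY.hasFDerivAt
  have h2 : fderiv ℝ (fun z => G (F z) (X z) (Y z)) y = _ := h.fderiv
  rw [h2]
  simp only [covAlong, add_apply, ContinuousLinearMap.comp_apply,
    ContinuousLinearMap.flip_apply, map_add, hc (fderiv ℝ F y u) (X y) (Y y)]
  ring

/-- Vanishing torsion along F: the second derivative of F and Γ are both symmetric. -/
theorem covAlong_fderiv_comm {Γ : W → W →L[ℝ] W →L[ℝ] W} {F : V → W} {y : V}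
    (hF : ContDiffAt ℝ 2 F y) (hΓ : ∀ a b, Γ (F y) a b = Γ (F y) b a) (u v : V) :
    covAlong Γ F (fun z => fderiv ℝ F z v) y u = covAlong Γ F (fun z => fderiv ℝ F z u) y v := by
  have hd : DifferentiableAt ℝ (fderiv ℝ F) y :=
    (hF.fderiv_right (m := 1) (by norm_num)).differentiableAt one_ne_zero
  have h2 : ∀ a b, fderiv ℝ (fun z => fderiv ℝ F z a) y b = fderiv ℝ (fderiv ℝ F) y b a := by
    intro a b
    rw [fderiv_clm_apply hd (differentiableAt_const a)]
    simp
  have hs := hF.isSymmSndFDerivAt (by simp)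
  simp only [covAlong, h2, hs.eq u v, hΓ (fderiv ℝ F y u)]

theorem differentiableAt_fderiv_apply {F : V → W} {y : V} (hF : ContDiffAt ℝ 2 F y) (v : V) :
    DifferentiableAt ℝ (fun z => fderiv ℝ F z v) y :=
  ((hF.fderiv_right (m := 1) (by norm_num)).differentiableAt one_ne_zero).clm_apply
    (differentiableAt_const v)

/-- The tangential part of the Gauss formula: the Levi-Civita connection of a pulled back metric
is the tangential part of the connection of the target. -/
theorem inner_covAlong_fderiv {G : W → W →L[ℝ] W →L[ℝ] ℝ} {Γ : W → W →L[ℝ] W →L[ℝ] W}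
    {G' : V → V →L[ℝ] V →L[ℝ] ℝ} {Γ' : V → V →L[ℝ] V →L[ℝ] V} {F : V → W} {y : V}
    (hG : DifferentiableAt ℝ G (F y)) (hG' : DifferentiableAt ℝ G' y) (hF : ContDiffAt ℝ 2 F y)
    (hc : IsCompatibleAt G Γ (F y)) (hc' : IsCompatibleAt G' Γ' y)
    (hs : ∀ a b, G (F y) a b = G (F y) b a) (hs' : ∀ a b, G' y a b = G' y b a)
    (hΓ : ∀ a b, Γ (F y) a b = Γ (F y) b a) (hΓ' : ∀ a b, Γ' y a b = Γ' y b a)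
    (hpull : ∀ᶠ z in nhds y, ∀ u v, G' z u v = G (F z) (fderiv ℝ F z u) (fderiv ℝ F z v))
    (u v w : V) :
    G (F y) (covAlong Γ F (fun z => fderiv ℝ F z v) y u) (fderiv ℝ F y w)
      = G' y (Γ' y u v) w := by
  have key : ∀ a v w, fderiv ℝ G' y a v w
      = G (F y) (covAlong Γ F (fun z => fderiv ℝ F z v) y a) (fderiv ℝ F y w)
        + G (F y) (covAlong Γ F (fun z => fderiv ℝ F z w) y a) (fderiv ℝ F y v) := by
    intro a v w
    have h1 : fderiv ℝ (fun z => G' z v w) y a = fderiv ℝ G' y a v w := by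
      rw [fderiv_clm_apply (hG'.clm_apply (differentiableAt_const v)) (differentiableAt_const w),
        fderiv_clm_apply hG' (differentiableAt_const v)]
      simp
    have h2 : (fun z => G' z v w) =ᶠ[nhds y]
        fun z => G (F z) (fderiv ℝ F z v) (fderiv ℝ F z w) := hpull.mono fun z hz => hz v w
    rw [← h1, h2.fderiv_eq, fderiv_inner_along hG (hF.differentiableAt (by norm_num))
      (differentiableAt_fderiv_apply hF v) (differentiableAt_fderiv_apply hF w) hc,
      hs (fderiv ℝ F y v)]
  -- As in the Koszul formula, three cyclic permutations determine the tangential part. Both sides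
  -- solve the same linear system, once the torsion-free symmetries have identified the mixed terms.
  have k1 := key u v w
  have k2 := key v w u
  have k3 := key w u v
  have c1 := hc' u v w
  have c2 := hc' v w u
  have c3 := hc' w u v
  rw [covAlong_fderiv_comm hF hΓ v u, covAlong_fderiv_comm hF hΓ w u] at *
  rw [covAlong_fderiv_comm hF hΓ w v] at k3
  rw [hs' _ (Γ' y _ _), hΓ' v u] at *
  rw [hΓ' w v, hΓ' w u] at *
  linarith

/-- The directions u and v are constant, so there is no bracket term. The second derivatives of X
and of F cancel by symmetry, and only the curvature along F survives. -/
theorem covAlong_covAlong_sub {Γ : W → W →L[ℝ] W →L[ℝ] W} {F X : V → W} {y : V}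
    (hΓ : DifferentiableAt ℝ Γ (F y)) (hF : ContDiffAt ℝ 2 F y) (hX : ContDiffAt ℝ 2 X y)
    (u v : V) :
    covAlong Γ F (fun z => covAlong Γ F X z v) y u - covAlong Γ F (fun z => covAlong Γ F X z u) y v
      = curvatureOf Γ (F y) (fderiv ℝ F y u) (fderiv ℝ F y v) (X y) := by
  have hF1 := hF.differentiableAt (by norm_num)
  have hX1 := hX.differentiableAt (by norm_num)
  have hd : ∀ {X : V → W}, ContDiffAt ℝ 2 X y → DifferentiableAt ℝ (fderiv ℝ X) y := fun h =>
    (h.fderiv_right (m := 1) (by norm_num)).differentiableAt one_ne_zero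
  have key : ∀ a b, fderiv ℝ (fun z => covAlong Γ F X z a) y b =
      fderiv ℝ (fderiv ℝ X) y b a + (fderiv ℝ Γ (F y) (fderiv ℝ F y b) (fderiv ℝ F y a) (X y)
        + Γ (F y) (fderiv ℝ (fderiv ℝ F) y b a) (X y)
        + Γ (F y) (fderiv ℝ F y a) (fderiv ℝ X y b)) := by
    intro a b
    have h := ((hd hX).hasFDerivAt.clm_apply (hasFDerivAt_const a y)).add
      (((hΓ.hasFDerivAt.comp y hF1.hasFDerivAt).clm_apply
        ((hd hF).hasFDerivAt.clm_apply (hasFDerivAt_const a y))).clm_apply hX1.hasFDerivAt)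
    have h2 : fderiv ℝ (fun z => covAlong Γ F X z a) y = _ := h.fderiv
    rw [h2]
    simp only [Function.comp, add_apply, ContinuousLinearMap.comp_apply,
      ContinuousLinearMap.flip_apply, zero_apply, map_zero, zero_add]
    abel
  have hsX := hX.isSymmSndFDerivAt (by simp)
  have hsF := hF.isSymmSndFDerivAt (by simp)
  have e : ∀ a b, covAlong Γ F (fun z => covAlong Γ F X z a) y b
      = fderiv ℝ (fun z => covAlong Γ F X z a) y b
        + Γ (F y) (fderiv ℝ F y b) (covAlong Γ F X y a) := fun _ _ => rfl
  rw [e, e, key, key, hsX.eq u v, hsF.eq u v, curvatureOf]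
  simp only [covAlong, map_add]
  abel

theorem differentiableAt_covAlong {Γ : W → W →L[ℝ] W →L[ℝ] W} {F X : V → W} {y : V}
    (hΓ : DifferentiableAt ℝ Γ (F y)) (hF : ContDiffAt ℝ 2 F y) (hX : ContDiffAt ℝ 2 X y) (v : V) :
    DifferentiableAt ℝ (fun z => covAlong Γ F X z v) y :=
  (differentiableAt_fderiv_apply hX v).add
    (((hΓ.comp y (hF.differentiableAt (by norm_num))).clm_apply
      (differentiableAt_fderiv_apply hF v)).clm_apply (hX.differentiableAt (by norm_num)))

/-- The Codazzi equation, with the tangential parts of the derivatives of `dF` left unevaluated. -/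
theorem codazzi {G : W → W →L[ℝ] W →L[ℝ] ℝ} {Γ : W → W →L[ℝ] W →L[ℝ] W} {F N : V → W} {y : V}
    (hG : DifferentiableAt ℝ G (F y)) (hΓ : DifferentiableAt ℝ Γ (F y)) (hF : ContDiffAt ℝ 2 F y)
    (hN : ContDiffAt ℝ 2 N y) (hc : IsCompatibleAt G Γ (F y)) (u v w : V) :
    fderiv ℝ (fun z => G (F z) (covAlong Γ F N z v) (fderiv ℝ F z w)) y u
      - fderiv ℝ (fun z => G (F z) (covAlong Γ F N z u) (fderiv ℝ F z w)) y v
      = G (F y) (curvatureOf Γ (F y) (fderiv ℝ F y u) (fderiv ℝ F y v) (N y)) (fderiv ℝ F y w)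
        + G (F y) (covAlong Γ F N y v) (covAlong Γ F (fun z => fderiv ℝ F z w) y u)
        - G (F y) (covAlong Γ F N y u) (covAlong Γ F (fun z => fderiv ℝ F z w) y v) := by
  have hF1 := hF.differentiableAt (by norm_num)
  -- After the product rule, the terms in which ∇N is differentiated again combine into the
  -- commutator of covariant derivatives, hence into the curvature.
  rw [fderiv_inner_along hG hF1 (differentiableAt_covAlong hΓ hF hN v)
    (differentiableAt_fderiv_apply hF w) hc, fderiv_inner_along hG hF1
    (differentiableAt_covAlong hΓ hF hN u) (differentiableAt_fderiv_apply hF w) hc,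
    ← covAlong_covAlong_sub hΓ hF hN]
  simp only [map_sub, sub_apply]
  ring

/-- The second fundamental form is symmetric. -/
theorem inner_covAlong_normal_comm {G : W → W →L[ℝ] W →L[ℝ] ℝ} {Γ : W → W →L[ℝ] W →L[ℝ] W}
    {F N : V → W} {y : V} (hG : DifferentiableAt ℝ G (F y)) (hF : ContDiffAt ℝ 2 F y)
    (hN : DifferentiableAt ℝ N y) (hc : IsCompatibleAt G Γ (F y))
    (hΓ : ∀ a b, Γ (F y) a b = Γ (F y) b a)
    (h0 : ∀ᶠ z in nhds y, ∀ v, G (F z) (N z) (fderiv ℝ F z v) = 0) (u v : V) :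
    G (F y) (covAlong Γ F N y u) (fderiv ℝ F y v)
      = G (F y) (covAlong Γ F N y v) (fderiv ℝ F y u) := by
  -- Differentiating ⟨N, dF v⟩ = 0 moves the derivative from N to dF v, where the torsion-free
  -- symmetry applies.
  have key : ∀ u v, G (F y) (covAlong Γ F N y u) (fderiv ℝ F y v)
      = - G (F y) (N y) (covAlong Γ F (fun z => fderiv ℝ F z v) y u) := by
    intro u v
    have h := fderiv_inner_along hG (hF.differentiableAt (by norm_num)) hN
      (differentiableAt_fderiv_apply hF v) hc u
    have h2 : (fun z => G (F z) (N z) (fderiv ℝ F z v)) =ᶠ[nhds y] fun _ => 0 :=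
      h0.mono fun z hz => hz v
    rw [h2.fderiv_eq] at h
    simp at h
    linarith
  rw [key, key, covAlong_fderiv_comm hF hΓ]

/-- The derivative of a unit normal field is tangential. -/
theorem inner_covAlong_unit {G : W → W →L[ℝ] W →L[ℝ] ℝ} {Γ : W → W →L[ℝ] W →L[ℝ] W}
    {F N : V → W} {y : V} (hG : DifferentiableAt ℝ G (F y)) (hF : DifferentiableAt ℝ F y)
    (hN : DifferentiableAt ℝ N y) (hc : IsCompatibleAt G Γ (F y))
    (hs : ∀ a b, G (F y) a b = G (F y) b a)
    (h1 : ∀ᶠ z in nhds y, G (F z) (N z) (N z) = 1) (u : V) :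
    G (F y) (N y) (covAlong Γ F N y u) = 0 := by
  have h := fderiv_inner_along hG hF hN hN hc u
  have h2 : (fun z => G (F z) (N z) (N z)) =ᶠ[nhds y] fun _ => 1 := h1
  rw [h2.fderiv_eq, hs _ (N y)] at h
  simp at h
  linarith

end CoordinateFree

/-! ### Bilinear forms and Christoffel symbols on ℝ^d. -/

section Euclidean

variable {d : ℕ}

/-- The bilinear form on `ℝ^d` with matrix `A`. -/
def bil (A : Matrix (Fin d) (Fin d) ℝ) : E d →L[ℝ] E d →L[ℝ] ℝ :=
  ∑ i, ∑ j, A i j • (EuclideanSpace.proj (𝕜 := ℝ) i : E d →L[ℝ] ℝ).smulRight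
    (EuclideanSpace.proj (𝕜 := ℝ) j : E d →L[ℝ] ℝ)

theorem bil_apply (A : Matrix (Fin d) (Fin d) ℝ) (u v : E d) :
    bil A u v = ∑ i, ∑ j, A i j * u i * v j := by
  simp [bil, mul_assoc]

theorem bil_single (A : Matrix (Fin d) (Fin d) ℝ) (i j : Fin d) :
    bil A (EuclideanSpace.single i 1) (EuclideanSpace.single j 1) = A i j := by
  simp [bil_apply]

theorem bil_comm {A : Matrix (Fin d) (Fin d) ℝ} (hA : A.IsSymm) (u v : E d) :
    bil A u v = bil A v u := by
  rw [bil_apply, bil_apply, Finset.sum_comm]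
  refine Finset.sum_congr rfl fun i _ => Finset.sum_congr rfl fun j _ => ?_
  rw [hA.apply]; ring

theorem bil_left_eq_zero {A : Matrix (Fin d) (Fin d) ℝ} (hA : A.det ≠ 0) {u : E d}
    (h : ∀ v, bil A u v = 0) : u = 0 := by
  have h1 : (fun i => u i) ᵥ* A = 0 := by
    ext j
    have := h (EuclideanSpace.single j 1)
    rw [bil_apply] at this
    simpa [Matrix.vecMul, dotProduct, mul_comm] using this
  have h2 := Matrix.eq_zero_of_vecMul_eq_zero hA h1
  ext i
  exact congrFun h2 i

/-- The vector field along `ℝ^d × ℝ^d` with components `∑ C k i j u_i v_j`. -/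
def bilVec (C : Fin d → Fin d → Fin d → ℝ) : E d →L[ℝ] E d →L[ℝ] E d :=
  ∑ k, ∑ i, ∑ j, C k i j • (EuclideanSpace.proj (𝕜 := ℝ) i : E d →L[ℝ] ℝ).smulRight
    ((EuclideanSpace.proj (𝕜 := ℝ) j : E d →L[ℝ] ℝ).smulRight (EuclideanSpace.single k (1 : ℝ)))

theorem bilVec_apply (C : Fin d → Fin d → Fin d → ℝ) (u v : E d) (k : Fin d) :
    bilVec C u v k = ∑ i, ∑ j, C k i j * u i * v j := by
  simp [bilVec, Finset.sum_apply, mul_assoc]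
  rw [Finset.sum_eq_single k]
  · simp
  · intro b _ hb
    simp [hb.symm]
  · simp

theorem bilVec_single (C : Fin d → Fin d → Fin d → ℝ) (i j k : Fin d) :
    bilVec C (EuclideanSpace.single i 1) (EuclideanSpace.single j 1) k = C k i j := by
  simp [bilVec_apply]

theorem sum_smul_single (u : E d) : ∑ i, u i • EuclideanSpace.single i (1 : ℝ) = u := by
  ext k
  simp [Finset.sum_apply, Pi.single_apply]

theorem fderiv_apply_eq_sum_pd (f : E d → ℝ) (y u : E d) :
    fderiv ℝ f y u = ∑ i, u i * pd i f y := by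
  conv_lhs => rw [← sum_smul_single u]
  simp [pd]

/-- The Christoffel symbols of a matrix-valued function on `ℝ^d`. -/
def christoffelOf (m : E d → Matrix (Fin d) (Fin d) ℝ) (k i j : Fin d) (y : E d) : ℝ :=
  (1 / 2) * ∑ p, (m y)⁻¹ k p *
    (pd j (fun z => m z p i) y + pd i (fun z => m z p j) y - pd p (fun z => m z i j) y)

/-- The Christoffel symbols as a vector-valued bilinear map. -/
def christoffelBil (m : E d → Matrix (Fin d) (Fin d) ℝ) (y : E d) : E d →L[ℝ] E d →L[ℝ] E d :=
  bilVec fun k i j => christoffelOf m k i j y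

theorem fderiv_bil {m : E d → Matrix (Fin d) (Fin d) ℝ} {y : E d}
    (hm : ∀ i j, DifferentiableAt ℝ (fun z => m z i j) y) (u : E d) :
    fderiv ℝ (fun z => bil (m z)) y u
      = bil (Matrix.of fun i j => fderiv ℝ (fun z => m z i j) y u) := by
  have h : HasFDerivAt (fun z => bil (m z)) (∑ i, ∑ j,
      (fderiv ℝ (fun z => m z i j) y).smulRight
        ((EuclideanSpace.proj (𝕜 := ℝ) i : E d →L[ℝ] ℝ).smulRight
          (EuclideanSpace.proj (𝕜 := ℝ) j : E d →L[ℝ] ℝ))) y := by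
    unfold bil
    exact HasFDerivAt.fun_sum fun i _ => HasFDerivAt.fun_sum fun j _ =>
      (hm i j).hasFDerivAt.smul_const _
  rw [h.fderiv]
  simp [bil]

theorem fderiv_bilVec {C : E d → Fin d → Fin d → Fin d → ℝ} {y : E d}
    (hC : ∀ k i j, DifferentiableAt ℝ (fun z => C z k i j) y) (u : E d) :
    fderiv ℝ (fun z => bilVec (C z)) y u
      = bilVec fun k i j => fderiv ℝ (fun z => C z k i j) y u := by
  have h : HasFDerivAt (fun z => bilVec (C z)) (∑ k, ∑ i, ∑ j,
      (fderiv ℝ (fun z => C z k i j) y).smulRight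
        ((EuclideanSpace.proj (𝕜 := ℝ) i : E d →L[ℝ] ℝ).smulRight
          ((EuclideanSpace.proj (𝕜 := ℝ) j : E d →L[ℝ] ℝ).smulRight
            (EuclideanSpace.single k (1 : ℝ))))) y := by
    unfold bilVec
    exact HasFDerivAt.fun_sum fun k _ => HasFDerivAt.fun_sum fun i _ =>
      HasFDerivAt.fun_sum fun j _ => (hC k i j).hasFDerivAt.smul_const _
  rw [h.fderiv]
  simp [bilVec]

theorem contDiffAt_bil {r : WithTop ℕ∞} {m : E d → Matrix (Fin d) (Fin d) ℝ} {y : E d}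
    (hm : ∀ i j, ContDiffAt ℝ r (fun z => m z i j) y) :
    ContDiffAt ℝ r (fun z => bil (m z)) y := by
  unfold bil
  exact ContDiffAt.sum fun i _ => ContDiffAt.sum fun j _ => (hm i j).smul contDiffAt_const

theorem contDiffAt_bilVec {r : WithTop ℕ∞} {C : E d → Fin d → Fin d → Fin d → ℝ} {y : E d}
    (hC : ∀ k i j, ContDiffAt ℝ r (fun z => C z k i j) y) :
    ContDiffAt ℝ r (fun z => bilVec (C z)) y := by
  unfold bilVec
  exact ContDiffAt.sum fun k _ => ContDiffAt.sum fun i _ => ContDiffAt.sum fun j _ =>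
    (hC k i j).smul contDiffAt_const

theorem contDiffAt_det {ι : Type*} [Fintype ι] [DecidableEq ι] {V : Type*} [NormedAddCommGroup V]
    [NormedSpace ℝ V] {r : WithTop ℕ∞} {m : V → Matrix ι ι ℝ} {y : V}
    (hm : ∀ i j, ContDiffAt ℝ r (fun z => m z i j) y) :
    ContDiffAt ℝ r (fun z => (m z).det) y := by
  simp only [Matrix.det_apply']
  exact ContDiffAt.sum fun σ _ => contDiffAt_const.mul (contDiffAt_prod fun i _ => hm _ _)

theorem contDiffAt_inv_apply {ι : Type*} [Fintype ι] [DecidableEq ι] {V : Type*}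
    [NormedAddCommGroup V] [NormedSpace ℝ V] {r : WithTop ℕ∞} {m : V → Matrix ι ι ℝ} {y : V}
    (hm : ∀ i j, ContDiffAt ℝ r (fun z => m z i j) y) (h0 : (m y).det ≠ 0) (i j : ι) :
    ContDiffAt ℝ r (fun z => (m z)⁻¹ i j) y := by
  simp only [Matrix.inv_def, Matrix.smul_apply, Ring.inverse_eq_inv', smul_eq_mul,
    Matrix.adjugate_apply]
  refine ((contDiffAt_det hm).inv h0).mul (contDiffAt_det fun a b => ?_)
  simp only [Matrix.updateRow_apply]
  split_ifs
  · exact contDiffAt_const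
  · exact hm _ _

theorem contDiffAt_pd {r s : WithTop ℕ∞} {f : E d → ℝ} {y : E d} (hf : ContDiffAt ℝ r f y)
    (h : s + 1 ≤ r) (i : Fin d) : ContDiffAt ℝ s (pd i f) y :=
  (hf.fderiv_right h).clm_apply contDiffAt_const

theorem contDiffAt_christoffelOf {r s : WithTop ℕ∞} {m : E d → Matrix (Fin d) (Fin d) ℝ} {y : E d}
    (hm : ∀ i j, ContDiffAt ℝ r (fun z => m z i j) y) (h0 : (m y).det ≠ 0) (h : s + 1 ≤ r)
    (k i j : Fin d) : ContDiffAt ℝ s (christoffelOf m k i j) y := by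
  have hs : s ≤ r := le_self_add.trans h
  unfold christoffelOf
  refine contDiffAt_const.mul (ContDiffAt.sum fun p _ => ?_)
  refine (contDiffAt_inv_apply (fun i j => (hm i j).of_le hs) h0 k p).mul ?_
  exact ((contDiffAt_pd (hm _ _) h _).add (contDiffAt_pd (hm _ _) h _)).sub
    (contDiffAt_pd (hm _ _) h _)

theorem contDiffAt_christoffelBil {r s : WithTop ℕ∞} {m : E d → Matrix (Fin d) (Fin d) ℝ} {y : E d}
    (hm : ∀ i j, ContDiffAt ℝ r (fun z => m z i j) y) (h0 : (m y).det ≠ 0) (h : s + 1 ≤ r) :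
    ContDiffAt ℝ s (christoffelBil m) y :=
  contDiffAt_bilVec fun k i j => contDiffAt_christoffelOf hm h0 h k i j

/-- Lowering the index cancels the inverse matrix in the definition and leaves the Christoffel
symbols of the first kind. -/
theorem sum_mul_christoffelOf {m : E d → Matrix (Fin d) (Fin d) ℝ} {y : E d}
    (h0 : (m y).det ≠ 0) (i j q : Fin d) :
    ∑ k, m y q k * christoffelOf m k i j y = (1 / 2) *
      (pd j (fun z => m z q i) y + pd i (fun z => m z q j) y - pd q (fun z => m z i j) y) := by
  have hi : m y * (m y)⁻¹ = 1 := Matrix.mul_nonsing_inv _ (isUnit_iff_ne_zero.2 h0)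
  set c : Fin d → ℝ := fun p =>
    pd j (fun z => m z p i) y + pd i (fun z => m z p j) y - pd p (fun z => m z i j) y with hc
  have : (fun k => christoffelOf m k i j y) = (1 / 2 : ℝ) • ((m y)⁻¹ *ᵥ c) := by
    ext k
    simp [christoffelOf, Matrix.mulVec, dotProduct, hc]
  calc ∑ k, m y q k * christoffelOf m k i j y
      = (m y *ᵥ fun k => christoffelOf m k i j y) q := rfl
    _ = (1 / 2) * c q := by
      rw [this, Matrix.mulVec_smul, Matrix.mulVec_mulVec, hi, Matrix.one_mulVec]; rfl

theorem christoffelOf_comm {m : E d → Matrix (Fin d) (Fin d) ℝ} {y : E d}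
    (hs : ∀ᶠ z in nhds y, (m z).IsSymm) (k i j : Fin d) :
    christoffelOf m k i j y = christoffelOf m k j i y := by
  have hpd : ∀ p, pd p (fun z => m z i j) y = pd p (fun z => m z j i) y := by
    intro p
    have : (fun z => m z i j) =ᶠ[nhds y] fun z => m z j i := hs.mono fun z hz => hz.apply _ _
    simp only [pd, this.fderiv_eq]
  unfold christoffelOf
  congr 1
  refine Finset.sum_congr rfl fun p _ => ?_
  rw [hpd p]; ring

theorem christoffelBil_comm {m : E d → Matrix (Fin d) (Fin d) ℝ} {y : E d}
    (hs : ∀ᶠ z in nhds y, (m z).IsSymm) (u v : E d) :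
    christoffelBil m y u v = christoffelBil m y v u := by
  ext k
  rw [christoffelBil, bilVec_apply, bilVec_apply, Finset.sum_comm]
  refine Finset.sum_congr rfl fun i _ => Finset.sum_congr rfl fun j _ => ?_
  rw [christoffelOf_comm hs]; ring

/-- The Koszul formula. -/
theorem bil_christoffelBil {m : E d → Matrix (Fin d) (Fin d) ℝ} {y : E d}
    (hm : ∀ i j, DifferentiableAt ℝ (fun z => m z i j) y) (hs : ∀ᶠ z in nhds y, (m z).IsSymm)
    (h0 : (m y).det ≠ 0) (u v w : E d) :
    bil (m y) (christoffelBil m y u v) w = (1 / 2) *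
      (fderiv ℝ (fun z => bil (m z)) y u v w + fderiv ℝ (fun z => bil (m z)) y v u w
        - fderiv ℝ (fun z => bil (m z)) y w u v) := by
  have hsy := hs.self_of_nhds
  have key : ∀ q, bil (m y) (christoffelBil m y u v) (EuclideanSpace.single q 1) = (1 / 2) *
      ∑ i, ∑ j, u i * v j *
      (pd j (fun z => m z q i) y + pd i (fun z => m z q j) y - pd q (fun z => m z i j) y) := by
    intro q
    rw [bil_comm hsy, bil_apply, Finset.sum_eq_single q (by simp_all) (by simp)]
    simp only [christoffelBil, bilVec_apply, Finset.mul_sum, PiLp.single_apply]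
    rw [Finset.sum_comm]
    refine Finset.sum_congr rfl fun i _ => ?_
    rw [Finset.sum_comm]
    refine Finset.sum_congr rfl fun j _ => ?_
    rw [mul_left_comm, ← sum_mul_christoffelOf h0, Finset.mul_sum]
    refine Finset.sum_congr rfl fun k _ => ?_
    simp; ring
  have hpd : ∀ p i j, pd p (fun z => m z i j) y = pd p (fun z => m z j i) y := by
    intro p i j
    have : (fun z => m z i j) =ᶠ[nhds y] fun z => m z j i := hs.mono fun z hz => hz.apply _ _
    simp only [pd, this.fderiv_eq]
  have key2 : ∀ a b c : E d, fderiv ℝ (fun z => bil (m z)) y a b c =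
      ∑ p, ∑ i, ∑ j, a p * b i * c j * pd p (fun z => m z i j) y := by
    intro a b c
    rw [fderiv_bil hm, bil_apply, ← Finset.sum_comm_cycle]
    refine Finset.sum_congr rfl fun j _ => Finset.sum_congr rfl fun i _ => ?_
    rw [Matrix.of_apply, fderiv_apply_eq_sum_pd, Finset.sum_mul, Finset.sum_mul]
    refine Finset.sum_congr rfl fun k _ => ?_
    ring
  have e1 : fderiv ℝ (fun z => bil (m z)) y u v w =
      ∑ q, ∑ i, ∑ j, u i * v j * w q * pd i (fun z => m z q j) y := by
    rw [key2, Finset.sum_comm_cycle]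
    exact Finset.sum_congr rfl fun q _ => Finset.sum_congr rfl fun i _ =>
      Finset.sum_congr rfl fun j _ => by rw [hpd]
  have e2 : fderiv ℝ (fun z => bil (m z)) y v u w =
      ∑ q, ∑ i, ∑ j, u i * v j * w q * pd j (fun z => m z q i) y := by
    rw [key2, Finset.sum_comm_cycle]
    refine Finset.sum_congr rfl fun q _ => ?_
    rw [Finset.sum_comm]
    exact Finset.sum_congr rfl fun i _ => Finset.sum_congr rfl fun j _ => by rw [hpd]; ring
  have e3 : fderiv ℝ (fun z => bil (m z)) y w u v =
      ∑ q, ∑ i, ∑ j, u i * v j * w q * pd q (fun z => m z i j) y := by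
    rw [key2]
    exact Finset.sum_congr rfl fun q _ => Finset.sum_congr rfl fun i _ =>
      Finset.sum_congr rfl fun j _ => by ring
  rw [e1, e2, e3]
  conv_lhs => rw [← sum_smul_single w]
  simp only [map_sum, map_smul, key, smul_eq_mul, Finset.mul_sum, ← Finset.sum_add_distrib,
    ← Finset.sum_sub_distrib]
  exact Finset.sum_congr rfl fun q _ => Finset.sum_congr rfl fun i _ =>
      Finset.sum_congr rfl fun j _ => by ring

/-- In the sum of the Koszul formulas for (u, v, w) and (u, w, v), the derivatives along v and w
cancel. -/
theorem fderiv_bil_eq_christoffelBil {m : E d → Matrix (Fin d) (Fin d) ℝ} {y : E d}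
    (hm : ∀ i j, DifferentiableAt ℝ (fun z => m z i j) y) (hs : ∀ᶠ z in nhds y, (m z).IsSymm)
    (h0 : (m y).det ≠ 0) (u v w : E d) :
    fderiv ℝ (fun z => bil (m z)) y u v w
      = bil (m y) (christoffelBil m y u v) w + bil (m y) v (christoffelBil m y u w) := by
  have hsymm : ∀ a b c : E d, fderiv ℝ (fun z => bil (m z)) y a b c
      = fderiv ℝ (fun z => bil (m z)) y a c b := by
    intro a b c
    rw [fderiv_bil hm]
    refine bil_comm (Matrix.IsSymm.ext fun i j => ?_) b c
    have : (fun z => m z i j) =ᶠ[nhds y] fun z => m z j i := hs.mono fun z hz => hz.apply _ _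
    simp only [Matrix.of_apply, this.fderiv_eq]
  rw [bil_comm hs.self_of_nhds v, bil_christoffelBil hm hs h0, bil_christoffelBil hm hs h0,
    hsymm u w v]
  ring

end Euclidean

/-! ### Index identities for the contracted curvature of a perturbed connection. -/

section TensorAlgebra

variable {ι : Type*} [Fintype ι]

theorem sum_swap₂₃ {M : Type*} [AddCommMonoid M] (f : ι → ι → ι → M) :
    ∑ i, ∑ j, ∑ k, f i j k = ∑ i, ∑ k, ∑ j, f i j k :=
  Finset.sum_congr rfl fun _ _ => Finset.sum_comm

theorem sum_swap₃₄ {M : Type*} [AddCommMonoid M] (f : ι → ι → ι → ι → M) :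
    ∑ i, ∑ j, ∑ k, ∑ l, f i j k l = ∑ i, ∑ j, ∑ l, ∑ k, f i j k l :=
  Finset.sum_congr rfl fun _ _ => sum_swap₂₃ _

/-- The contraction over `j` of `∂_i C^j_{jk} - ∂_j C^j_{ik} + C^j_{im} C^m_{jk} - C^j_{jm} C^m_{ik}`,
where `dC p l i k` stands for `∂_p C^l_{ik}`. -/
def contractedCurvature (C : ι → ι → ι → ℝ) (dC : ι → ι → ι → ι → ℝ) (i k : ι) : ℝ :=
  ∑ j, (dC i j j k - dC j j i k + ∑ m, (C j i m * C m j k - C j j m * C m i k))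

/-- The grouping is chosen for symmetric a: the bracket is then ∇_j D^j_{ik}, and the terms in dD i
j j k and (∑ j, D j j m) * a m i k together form −∇_i of the trace D^j_{jk}. Two quadratic terms
remain. -/
theorem contractedCurvature_sub (a D : ι → ι → ι → ℝ) (da dD : ι → ι → ι → ι → ℝ) (i k : ι) :
    contractedCurvature (fun l i k => a l i k - D l i k) (fun p l i k => da p l i k - dD p l i k) i k
      = contractedCurvature a da i k - ∑ j, dD i j j k
        + (∑ j, dD j j i k + ∑ j, ∑ m, (a j j m * D m i k - a j i m * D m j k - D j i m * a m j k))
        + ∑ j, ∑ m, D j i m * D m j k + ∑ m, (∑ j, D j j m) * a m i k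
        - ∑ m, (∑ j, D j j m) * D m i k := by
  have e : ∀ x : ι → ℝ, ∑ m, (∑ j, D j j m) * x m = ∑ j, ∑ m, D j j m * x m := by
    intro x
    rw [Finset.sum_comm]
    exact Finset.sum_congr rfl fun m _ => Finset.sum_mul _ _ _
  rw [e, e]
  simp only [contractedCurvature, Finset.sum_add_distrib, Finset.sum_sub_distrib, sub_mul, mul_sub]
  ring

/-- The divergence of the contraction `V^j = B^{ik} D^j_{ik}`, where `B` is parallel for the
connection `a`. -/
theorem contraction_divergence (a D : ι → ι → ι → ℝ) (dD : ι → ι → ι → ι → ℝ) (B : ι → ι → ℝ)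
    (dB : ι → ι → ι → ℝ) (ha : ∀ l i k, a l i k = a l k i)
    (hdB : ∀ j i k, dB j i k = - ∑ m, (a i j m * B m k + a k j m * B i m)) :
    ∑ i, ∑ k, B i k * (∑ j, dD j j i k
        + ∑ j, ∑ m, (a j j m * D m i k - a j i m * D m j k - D j i m * a m j k))
      = ∑ j, ∑ i, ∑ k, (dB j i k * D j i k + B i k * dD j j i k)
        + ∑ j, ∑ m, a j j m * ∑ i, ∑ k, B i k * D m i k := by
  simp only [hdB, mul_add, mul_sub, Finset.mul_sum, neg_mul, Finset.sum_mul, add_mul,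
    Finset.sum_add_distrib, Finset.sum_sub_distrib, Finset.sum_neg_distrib]
  have h1 : ∑ i, ∑ k, ∑ j, B i k * dD j j i k = ∑ j, ∑ i, ∑ k, B i k * dD j j i k :=
    Finset.sum_comm_cycle
  have h2 : ∑ i, ∑ k, ∑ j, ∑ m, B i k * (a j j m * D m i k)
      = ∑ j, ∑ m, ∑ i, ∑ k, a j j m * (B i k * D m i k) := by
    rw [Finset.sum_comm_cycle]
    refine Finset.sum_congr rfl fun j _ => ?_
    rw [Finset.sum_comm_cycle]
    exact Finset.sum_congr rfl fun m _ => Finset.sum_congr rfl fun i _ =>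
      Finset.sum_congr rfl fun k _ => by ring
  have h3 : ∑ i, ∑ k, ∑ j, ∑ m, B i k * (a j i m * D m j k)
      = ∑ j, ∑ i, ∑ k, ∑ m, a i j m * B m k * D j i k := by
    calc ∑ i, ∑ k, ∑ j, ∑ m, B i k * (a j i m * D m j k)
        = ∑ m, ∑ i, ∑ k, ∑ j, B i k * (a j i m * D m j k) := by
          rw [sum_swap₃₄, sum_swap₂₃, Finset.sum_comm]
      _ = ∑ m, ∑ j, ∑ k, ∑ i, B i k * (a j i m * D m j k) := by
          refine Finset.sum_congr rfl fun m _ => ?_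
          rw [Finset.sum_comm, sum_swap₂₃, Finset.sum_comm]
      _ = _ := by
          refine Finset.sum_congr rfl fun m _ => Finset.sum_congr rfl fun i _ =>
            Finset.sum_congr rfl fun k _ => Finset.sum_congr rfl fun j _ => ?_
          rw [ha i j m]; ring
  have h4 : ∑ i, ∑ k, ∑ j, ∑ m, B i k * (D j i m * a m j k)
      = ∑ j, ∑ i, ∑ k, ∑ m, a k j m * B i m * D j i k := by
    calc ∑ i, ∑ k, ∑ j, ∑ m, B i k * (D j i m * a m j k)
        = ∑ j, ∑ i, ∑ k, ∑ m, B i k * (D j i m * a m j k) := Finset.sum_comm_cycle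
      _ = ∑ j, ∑ i, ∑ m, ∑ k, B i k * (D j i m * a m j k) := sum_swap₃₄ _
      _ = _ := by
          refine Finset.sum_congr rfl fun j _ => Finset.sum_congr rfl fun i _ =>
            Finset.sum_congr rfl fun k _ => Finset.sum_congr rfl fun m _ => ?_
          ring
  rw [h1, h2, h3, h4]
  ring

/-- Lowering an index commutes with the divergence when b is parallel: B^{ij} ∇_j(b_{il} V^l) = ∇_j
V^j. The inner sum over m is ∂_j b_{il} as dictated by parallelism, and `dV j l` stands for ∂_j V^l.
-/
theorem contracted_covariant_derivative [DecidableEq ι] (B b : Matrix ι ι ℝ) (hBb : B * b = 1)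
    (hB : B.IsSymm) (a : ι → ι → ι → ℝ) (ha : ∀ l i k, a l i k = a l k i) (V : ι → ℝ)
    (dV : ι → ι → ℝ) :
    ∑ i, ∑ j, B i j * (∑ l, ((∑ m, (a m j i * b m l + a m j l * b i m)) * V l + b i l * dV j l)
        - ∑ k, a k i j * ∑ l, b k l * V l)
      = ∑ j, dV j j + ∑ j, ∑ m, a j j m * V m := by
  have hδ : ∀ j m, ∑ i, B i j * b i m = if j = m then 1 else 0 := by
    intro j m
    rw [← Matrix.one_apply, ← hBb, Matrix.mul_apply]
    exact Finset.sum_congr rfl fun i _ => by rw [hB.apply]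
  have e1 : ∀ i j, ∑ l, ((∑ m, (a m j i * b m l + a m j l * b i m)) * V l + b i l * dV j l)
        - ∑ k, a k i j * ∑ l, b k l * V l
      = ∑ m, b i m * (∑ l, a m j l * V l + dV j m) := by
    intro i j
    have e2 : ∑ k, a k i j * ∑ l, b k l * V l = ∑ l, ∑ m, a m j i * b m l * V l := by
      rw [Finset.sum_comm]
      refine Finset.sum_congr rfl fun k _ => ?_
      rw [Finset.mul_sum, ha k i j]
      exact Finset.sum_congr rfl fun l _ => by ring
    have e3 : ∑ m, ∑ l, b i m * (a m j l * V l) = ∑ l, ∑ m, a m j l * b i m * V l := by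
      rw [Finset.sum_comm]
      exact Finset.sum_congr rfl fun l _ => Finset.sum_congr rfl fun m _ => by ring
    simp only [mul_add, Finset.mul_sum, e3, Finset.sum_mul, Finset.sum_add_distrib, add_mul]
    rw [← sub_eq_zero]
    simp only [Finset.mul_sum] at e2
    rw [e2]
    ring
  simp only [e1]
  calc ∑ i, ∑ j, B i j * ∑ m, b i m * (∑ l, a m j l * V l + dV j m)
      = ∑ j, ∑ m, (∑ i, B i j * b i m) * (∑ l, a m j l * V l + dV j m) := by
        rw [Finset.sum_comm]
        refine Finset.sum_congr rfl fun j _ => ?_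
        simp only [Finset.mul_sum, Finset.sum_mul]
        rw [Finset.sum_comm]
        exact Finset.sum_congr rfl fun j _ => Finset.sum_congr rfl fun m _ => by ring
    _ = _ := by
        simp only [hδ, ite_mul, one_mul, zero_mul, Finset.sum_ite_eq, Finset.mem_univ, if_true,
          Finset.sum_add_distrib]
        ring

end TensorAlgebra

/-! ### Comparing the Levi-Civita connections of two metrics in coordinates. -/

section LeviCivita

variable {d : ℕ}

theorem pd_eq_sum_christoffelOf {m : E d → Matrix (Fin d) (Fin d) ℝ} {y : E d}
    (hm : ∀ i j, DifferentiableAt ℝ (fun z => m z i j) y) (hs : ∀ᶠ z in nhds y, (m z).IsSymm)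
    (h0 : (m y).det ≠ 0) (p i l : Fin d) :
    pd p (fun z => m z i l) y
      = ∑ q, (christoffelOf m q p i y * m y q l + christoffelOf m q p l y * m y i q) := by
  have h := fderiv_bil_eq_christoffelBil hm hs h0 (EuclideanSpace.single p 1)
    (EuclideanSpace.single i 1) (EuclideanSpace.single l 1)
  rw [fderiv_bil hm, bil_single, bil_apply, bil_apply] at h
  simpa [christoffelBil, bilVec_single, pd, Finset.sum_add_distrib, mul_comm] using h

/-- The inverse metric is parallel too: differentiate m⁻¹ m = 1, which holds near y, and insert the
parallelism of m. -/
theorem pd_inv_apply {m : E d → Matrix (Fin d) (Fin d) ℝ} {y : E d}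
    (hm : ∀ i j, ContDiffAt ℝ 1 (fun z => m z i j) y) (hs : ∀ᶠ z in nhds y, (m z).IsSymm)
    (h0 : (m y).det ≠ 0) (p i k : Fin d) :
    pd p (fun z => (m z)⁻¹ i k) y
      = - ∑ q, (christoffelOf m i p q y * (m y)⁻¹ q k + christoffelOf m k p q y * (m y)⁻¹ i q) := by
  have hm1 : ∀ i j, DifferentiableAt ℝ (fun z => m z i j) y := fun i j =>
    (hm i j).differentiableAt one_ne_zero
  have hB1 : ∀ i j, DifferentiableAt ℝ (fun z => (m z)⁻¹ i j) y := fun i j =>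
    (contDiffAt_inv_apply hm h0 i j).differentiableAt one_ne_zero
  set P : Matrix (Fin d) (Fin d) ℝ := Matrix.of fun i k => pd p (fun z => (m z)⁻¹ i k) y with hP
  set A : Matrix (Fin d) (Fin d) ℝ := Matrix.of fun q i => christoffelOf m q p i y with hA
  have hne : ∀ᶠ z in nhds y, (m z).det ≠ 0 :=
    (contDiffAt_det hm).continuousAt.eventually_ne h0
  have hu : IsUnit (m y).det := isUnit_iff_ne_zero.2 h0
  have hprod : P * m y + (m y)⁻¹ * (Aᵀ * m y + m y * A) = 0 := by
    ext i l
    have h1 : (fun z => ∑ k, (m z)⁻¹ i k * m z k l) =ᶠ[nhds y]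
        fun _ => (1 : Matrix (Fin d) (Fin d) ℝ) i l := hne.mono fun z hz => by
      have := Matrix.nonsing_inv_mul (m z) (isUnit_iff_ne_zero.2 hz)
      rw [← this, Matrix.mul_apply]
    have h2 : pd p (fun z => ∑ k, (m z)⁻¹ i k * m z k l) y = 0 := by
      rw [pd, h1.fderiv_eq]; simp
    have h3 : pd p (fun z => ∑ k, (m z)⁻¹ i k * m z k l) y
        = ∑ k, (P i k * m y k l + (m y)⁻¹ i k * pd p (fun z => m z k l) y) := by
      rw [pd, fderiv_fun_sum fun k _ => (hB1 i k).fun_mul (hm1 k l), sum_apply]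
      refine Finset.sum_congr rfl fun k _ => ?_
      rw [fderiv_fun_mul (hB1 i k) (hm1 k l)]
      simp [hP, pd]; ring
    rw [h3] at h2
    simp only [pd_eq_sum_christoffelOf hm1 hs h0] at h2
    simp only [Matrix.add_apply, Matrix.mul_apply, Matrix.zero_apply, Matrix.transpose_apply]
    rw [← h2, Finset.sum_add_distrib]
    simp only [hA, Matrix.of_apply, Finset.sum_add_distrib, mul_comm (m y _ _)]
  have hP2 : P = - (A * (m y)⁻¹ + (m y)⁻¹ * Aᵀ) := by
    have h4 : P * m y = - ((m y)⁻¹ * (Aᵀ * m y + m y * A)) := eq_neg_of_add_eq_zero_left hprod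
    have h5 : P = P * m y * (m y)⁻¹ := (Matrix.mul_nonsing_inv_cancel_right _ _ hu).symm
    rw [h5, h4, Matrix.mul_add, Matrix.nonsing_inv_mul_cancel_left _ _ hu, neg_mul, Matrix.add_mul,
      ← Matrix.mul_assoc (m y)⁻¹, Matrix.mul_nonsing_inv_cancel_right _ _ hu, add_comm]
  have h6 := congrFun (congrFun hP2 i) k
  simp only [Matrix.neg_apply, Matrix.add_apply, Matrix.mul_apply, Matrix.transpose_apply, hP, hA,
    Matrix.of_apply] at h6
  rw [h6, Finset.sum_add_distrib]
  simp only [mul_comm ((m y)⁻¹ i _)]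

/-- The Leibniz expansion differentiates one column at a time. By Cramer's rule, the determinant
with column i replaced is the i-th entry of the adjugate applied to the new column. -/
theorem fderiv_det {ι V : Type*} [Fintype ι] [DecidableEq ι] [NormedAddCommGroup V]
    [NormedSpace ℝ V] {m : V → Matrix ι ι ℝ} {y : V}
    (hm : ∀ i j, DifferentiableAt ℝ (fun z => m z i j) y) (u : V) :
    fderiv ℝ (fun z => (m z).det) y u
      = ∑ i, ∑ p, (m y).adjugate i p * fderiv ℝ (fun z => m z p i) y u := by
  have h1 : ∀ i, ∑ p, (m y).adjugate i p * fderiv ℝ (fun z => m z p i) y u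
      = ((m y).updateCol i fun p => fderiv ℝ (fun z => m z p i) y u).det := by
    intro i
    rw [← Matrix.cramer_apply, Matrix.cramer_eq_adjugate_mulVec]
    rfl
  have h2 : HasFDerivAt (fun z => (m z).det) (∑ σ : Equiv.Perm ι,
      ((Equiv.Perm.sign σ : ℤ) : ℝ) • ∑ i, (∏ j ∈ Finset.univ.erase i, m y (σ j) j) •
        fderiv ℝ (fun z => m z (σ i) i) y) y := by
    simp only [Matrix.det_apply']
    refine HasFDerivAt.fun_sum fun σ _ => HasFDerivAt.const_mul ?_ _
    exact HasFDerivAt.finsetProd (u := Finset.univ) fun i _ => (hm (σ i) i).hasFDerivAt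
  rw [h2.fderiv]
  simp only [h1, Matrix.det_apply', sum_apply, smul_apply, smul_eq_mul, Finset.mul_sum]
  rw [Finset.sum_comm]
  refine Finset.sum_congr rfl fun i _ => Finset.sum_congr rfl fun σ _ => ?_
  rw [← Finset.mul_prod_erase _ _ (Finset.mem_univ i), Matrix.updateCol_self, mul_comm
    (fderiv ℝ _ y u)]
  congr 2
  exact Finset.prod_congr rfl fun j hj => by
    rw [Matrix.updateCol_ne (Finset.ne_of_mem_erase hj)]

/-- Jacobi's formula. -/
theorem pd_det {m : E d → Matrix (Fin d) (Fin d) ℝ} {y : E d}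
    (hm : ∀ i j, DifferentiableAt ℝ (fun z => m z i j) y) (h0 : (m y).det ≠ 0) (k : Fin d) :
    pd k (fun z => (m z).det) y
      = (m y).det * ∑ i, ∑ p, (m y)⁻¹ i p * pd k (fun z => m z p i) y := by
  rw [pd, fderiv_det hm, Finset.mul_sum]
  refine Finset.sum_congr rfl fun i _ => ?_
  rw [Finset.mul_sum]
  refine Finset.sum_congr rfl fun p _ => ?_
  rw [Matrix.inv_def, Ring.inverse_eq_inv', Matrix.smul_apply, smul_eq_mul, ← mul_assoc,
    mul_inv_cancel_left₀ h0]
  rfl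

/-- In the contraction two of the three derivative terms cancel because m⁻¹ is symmetric. What is
left is half the logarithmic derivative of det m. -/
theorem sum_christoffelOf_self {m : E d → Matrix (Fin d) (Fin d) ℝ} {y : E d}
    (hs : ∀ᶠ z in nhds y, (m z).IsSymm) (k : Fin d) :
    ∑ j, christoffelOf m j j k y
      = (1 / 2) * ∑ i, ∑ p, (m y)⁻¹ i p * pd k (fun z => m z p i) y := by
  have hi : ∀ i j, (m y)⁻¹ i j = (m y)⁻¹ j i := fun i j =>
    (hs.self_of_nhds.inv).apply j i
  have hpd : ∀ p i j, pd p (fun z => m z i j) y = pd p (fun z => m z j i) y := by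
    intro p i j
    have : (fun z => m z i j) =ᶠ[nhds y] fun z => m z j i := hs.mono fun z hz => hz.apply _ _
    simp only [pd, this.fderiv_eq]
  simp only [christoffelOf, ← Finset.mul_sum, mul_sub, mul_add, Finset.sum_add_distrib,
    Finset.sum_sub_distrib]
  have : ∑ j, ∑ p, (m y)⁻¹ j p * pd j (fun z => m z p k) y
      = ∑ j, ∑ p, (m y)⁻¹ j p * pd p (fun z => m z j k) y := by
    rw [Finset.sum_comm]
    exact Finset.sum_congr rfl fun i _ => Finset.sum_congr rfl fun p _ => by rw [hi]
  rw [this]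
  ring

/-- Each contracted Christoffel symbol is ½ ∂_k log |det|, so the difference sees only the ratio e^h
of the determinants. This is the entry point of the curvature equation det A = e^h. -/
theorem sum_christoffelOf_sub {m b : E d → Matrix (Fin d) (Fin d) ℝ} {h : E d → ℝ} {y : E d}
    (hm : ∀ i j, DifferentiableAt ℝ (fun z => m z i j) y) (hms : ∀ᶠ z in nhds y, (m z).IsSymm)
    (hm0 : (m y).det ≠ 0) (hb : ∀ i j, DifferentiableAt ℝ (fun z => b z i j) y)
    (hbs : ∀ᶠ z in nhds y, (b z).IsSymm) (hh : DifferentiableAt ℝ h y)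
    (hdet : ∀ᶠ z in nhds y, (b z).det = Real.exp (h z) * (m z).det) (k : Fin d) :
    ∑ j, (christoffelOf b j j k y - christoffelOf m j j k y) = pd k h y / 2 := by
  have hy := hdet.self_of_nhds
  have hb0 : (b y).det ≠ 0 := by rw [hy]; exact mul_ne_zero (Real.exp_ne_zero _) hm0
  have hmd : DifferentiableAt ℝ (fun z => (m z).det) y := by
    simp only [Matrix.det_apply']
    refine DifferentiableAt.fun_sum fun σ _ => DifferentiableAt.const_mul ?_ _
    exact (HasFDerivAt.finsetProd (u := Finset.univ) fun i _ =>
      (hm (σ i) i).hasFDerivAt).differentiableAt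
  have h1 : pd k (fun z => (b z).det) y
      = (b y).det * pd k h y + Real.exp (h y) * pd k (fun z => (m z).det) y := by
    have e : (fun z => (b z).det) =ᶠ[nhds y] fun z => Real.exp (h z) * (m z).det := hdet
    rw [pd, e.fderiv_eq, fderiv_fun_mul hh.exp hmd, fderiv_exp hh, hy]
    simp [pd]; ring
  rw [pd_det hb hb0, pd_det hm hm0, ← mul_assoc (Real.exp _), ← hy, ← mul_add] at h1
  have h2 := mul_left_cancel₀ hb0 h1
  rw [Finset.sum_sub_distrib, sum_christoffelOf_self hms, sum_christoffelOf_self hbs, h2]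
  ring

/-- The difference of the Christoffel symbols of `b` and `m`. -/
def christoffelDiff (b m : E d → Matrix (Fin d) (Fin d) ℝ) (l i k : Fin d) (y : E d) : ℝ :=
  christoffelOf b l i k y - christoffelOf m l i k y

/-- The `b`-trace of the difference of the Christoffel symbols of `b` and `m`. -/
def christoffelDiffTrace (b m : E d → Matrix (Fin d) (Fin d) ℝ) (l : Fin d) (y : E d) : ℝ :=
  ∑ i, ∑ k, (b y)⁻¹ i k * christoffelDiff b m l i k y

/-- The components of the `1`-form `b(V, ·) - dh / 2`, where `V` is the `b`-trace of the
difference of the Levi-Civita connections of `b` and `m`. -/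
def traceForm (b m : E d → Matrix (Fin d) (Fin d) ℝ) (h : E d → ℝ) (p : Fin d) (y : E d) : ℝ :=
  ∑ l, b y p l * christoffelDiffTrace b m l y - pd p h y / 2

/-- The contraction `R_{ijk}^j` of the curvature of `m`. -/
def ricciOf (m : E d → Matrix (Fin d) (Fin d) ℝ) (y : E d) : Fin d → Fin d → ℝ :=
  contractedCurvature (fun l i k => christoffelOf m l i k y)
    (fun p l i k => pd p (christoffelOf m l i k) y)

theorem pd_sub {f g : E d → ℝ} {y : E d} (hf : DifferentiableAt ℝ f y)
    (hg : DifferentiableAt ℝ g y) (p : Fin d) :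
    pd p (fun z => f z - g z) y = pd p f y - pd p g y := by
  rw [pd, fderiv_fun_sub hf hg]; rfl

theorem pd_mul {f g : E d → ℝ} {y : E d} (hf : DifferentiableAt ℝ f y)
    (hg : DifferentiableAt ℝ g y) (p : Fin d) :
    pd p (fun z => f z * g z) y = pd p f y * g y + f y * pd p g y := by
  rw [pd, fderiv_fun_mul hf hg]
  simp [pd]; ring

theorem pd_sum {ι : Type*} {s : Finset ι} {f : ι → E d → ℝ} {y : E d}
    (hf : ∀ i ∈ s, DifferentiableAt ℝ (f i) y) (p : Fin d) :
    pd p (fun z => ∑ i ∈ s, f i z) y = ∑ i ∈ s, pd p (f i) y := by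
  rw [pd, fderiv_fun_sum hf, sum_apply]; rfl

theorem pd_div_const {f : E d → ℝ} {y : E d} (hf : DifferentiableAt ℝ f y) (c : ℝ) (p : Fin d) :
    pd p (fun z => f z / c) y = pd p f y / c := by
  simp only [div_eq_mul_inv]
  rw [pd, fderiv_mul_const hf]
  simp [pd, mul_comm]

/-- The central identity. B is parallel for b, so the B-trace of ∇_j D^j_{ik} is the divergence of
V, and that of ∇_i(½ h_k) is the divergence of ½ dh; their difference is the divergence of
`traceForm`. -/
theorem sum_inv_mul_ricciOf {m b : E d → Matrix (Fin d) (Fin d) ℝ} {h : E d → ℝ} {y : E d}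
    (hm : ∀ i j, ContDiffAt ℝ 2 (fun z => m z i j) y) (hm0 : (m y).det ≠ 0)
    (hb : ∀ i j, ContDiffAt ℝ 2 (fun z => b z i j) y) (hbs : ∀ᶠ z in nhds y, (b z).IsSymm)
    (hb0 : (b y).det ≠ 0) (hh : ContDiffAt ℝ 2 h y)
    (htr : ∀ᶠ z in nhds y, ∀ k, ∑ j, christoffelDiff b m j j k z = pd k h z / 2) :
    ∑ i, ∑ k, (b y)⁻¹ i k * ricciOf m y i k
      = ∑ i, ∑ k, (b y)⁻¹ i k * ricciOf b y i k
        + ∑ i, ∑ j, (b y)⁻¹ i j * (pd j (traceForm b m h i) y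
          - ∑ k, christoffelOf b k i j y * traceForm b m h k y)
        + ∑ i, ∑ k, (b y)⁻¹ i k *
          ∑ j, ∑ l, christoffelDiff b m j i l y * christoffelDiff b m l j k y
        - (1 / 2) * ∑ l, christoffelDiffTrace b m l y * pd l h y := by
  have h12 : (1 : WithTop ℕ∞) + 1 ≤ 2 := by norm_num
  have hb1 : ∀ i j, ContDiffAt ℝ 1 (fun z => b z i j) y := fun i j => (hb i j).of_le (by norm_num)
  have db : ∀ i j, DifferentiableAt ℝ (fun z => b z i j) y := fun i j =>
    (hb1 i j).differentiableAt one_ne_zero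
  have da : ∀ l i k, DifferentiableAt ℝ (christoffelOf b l i k) y := fun l i k =>
    (contDiffAt_christoffelOf hb hb0 h12 l i k).differentiableAt one_ne_zero
  have dc : ∀ l i k, DifferentiableAt ℝ (christoffelOf m l i k) y := fun l i k =>
    (contDiffAt_christoffelOf hm hm0 h12 l i k).differentiableAt one_ne_zero
  have dD : ∀ l i k, DifferentiableAt ℝ (christoffelDiff b m l i k) y := fun l i k =>
    (da l i k).sub (dc l i k)
  have dB : ∀ i k, DifferentiableAt ℝ (fun z => (b z)⁻¹ i k) y := fun i k =>
    (contDiffAt_inv_apply hb1 hb0 i k).differentiableAt one_ne_zero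
  have dV : ∀ l, DifferentiableAt ℝ (christoffelDiffTrace b m l) y := fun l =>
    DifferentiableAt.fun_sum fun i _ => DifferentiableAt.fun_sum fun k _ =>
      (dB i k).fun_mul (dD l i k)
  have dh : ∀ k, DifferentiableAt ℝ (pd k h) y := fun k =>
    (contDiffAt_pd hh h12 k).differentiableAt one_ne_zero
  have dh2 : ∀ k, DifferentiableAt ℝ (fun z => pd k h z / 2) y := fun k => by
    simpa only [div_eq_mul_inv] using (dh k).mul_const (2⁻¹ : ℝ)
  have pdD : ∀ p l i k, pd p (christoffelDiff b m l i k) y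
      = pd p (christoffelOf b l i k) y - pd p (christoffelOf m l i k) y := fun p l i k =>
    pd_sub (da l i k) (dc l i k) p
  have pdV : ∀ p l, pd p (christoffelDiffTrace b m l) y = ∑ i, ∑ k,
      (pd p (fun z => (b z)⁻¹ i k) y * christoffelDiff b m l i k y
        + (b y)⁻¹ i k * pd p (christoffelDiff b m l i k) y) := by
    intro p l
    have e : christoffelDiffTrace b m l
        = fun z => ∑ i, ∑ k, (b z)⁻¹ i k * christoffelDiff b m l i k z := rfl
    rw [e, pd_sum fun i _ => DifferentiableAt.fun_sum fun k _ => (dB i k).fun_mul (dD l i k)]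
    refine Finset.sum_congr rfl fun i _ => ?_
    rw [pd_sum fun k _ => (dB i k).fun_mul (dD l i k)]
    exact Finset.sum_congr rfl fun k _ => pd_mul (dB i k) (dD l i k) p
  have hpdα : ∀ i j, pd j (traceForm b m h i) y = ∑ l,
      ((∑ q, (christoffelOf b q j i y * b y q l + christoffelOf b q j l y * b y i q))
        * christoffelDiffTrace b m l y + b y i l * pd j (christoffelDiffTrace b m l) y)
        - pd j (pd i h) y / 2 := by
    intro i j
    have e : traceForm b m h i
      = fun z => ∑ l, b z i l * christoffelDiffTrace b m l z - pd i h z / 2 := rfl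
    rw [e, pd_sub (DifferentiableAt.fun_sum fun l _ => (db i l).fun_mul (dV l))
      (dh2 i), pd_sum fun l _ => (db i l).fun_mul (dV l), pd_div_const (dh i)]
    congr 1
    refine Finset.sum_congr rfl fun l _ => ?_
    rw [pd_mul (db i l) (dV l), pd_eq_sum_christoffelOf db hbs hb0]
  have htr0 := htr.self_of_nhds
  have htr1 : ∀ i k, ∑ j, pd i (christoffelDiff b m j j k) y = pd i (pd k h) y / 2 := by
    intro i k
    rw [← pd_sum fun j _ => dD j j k, ← pd_div_const (dh k)]
    have e : (fun z => ∑ j, christoffelDiff b m j j k z) =ᶠ[nhds y] fun z => pd k h z / 2 :=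
      htr.mono fun z hz => hz k
    rw [pd, e.fderiv_eq]; rfl
  -- The expansion is made around the connection of b, since the divergence wanted is the one for b.
  have hric : ∀ i k, ricciOf m y i k = contractedCurvature
      (fun l i k => christoffelOf b l i k y - christoffelDiff b m l i k y)
      (fun p l i k => pd p (christoffelOf b l i k) y - pd p (christoffelDiff b m l i k) y) i k := by
    intro i k
    simp only [ricciOf, pdD, christoffelDiff, sub_sub_cancel]
  have ha : ∀ l i k, christoffelOf b l i k y = christoffelOf b l k i y :=
    christoffelOf_comm hbs
  have hBb : (b y)⁻¹ * b y = 1 := Matrix.nonsing_inv_mul _ (isUnit_iff_ne_zero.2 hb0)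
  have hBs : (b y)⁻¹.IsSymm := hbs.self_of_nhds.inv
  have hdiv := contraction_divergence (fun l i k => christoffelOf b l i k y)
    (fun l i k => christoffelDiff b m l i k y) (fun p l i k => pd p (christoffelDiff b m l i k) y)
    (fun i k => (b y)⁻¹ i k) (fun j i k => pd j (fun z => (b z)⁻¹ i k) y) ha
    (fun j i k => pd_inv_apply hb1 hbs hb0 j i k)
  have hcov := contracted_covariant_derivative (b y)⁻¹ (b y) hBb hBs
    (fun l i k => christoffelOf b l i k y) ha (fun l => christoffelDiffTrace b m l y)
    (fun j l => pd j (christoffelDiffTrace b m l) y)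
  have hα : ∀ i j, pd j (traceForm b m h i) y - ∑ k, christoffelOf b k i j y * traceForm b m h k y
      = (∑ l, ((∑ q, (christoffelOf b q j i y * b y q l + christoffelOf b q j l y * b y i q))
        * christoffelDiffTrace b m l y + b y i l * pd j (christoffelDiffTrace b m l) y)
        - ∑ k, christoffelOf b k i j y * ∑ l, b y k l * christoffelDiffTrace b m l y)
        - (pd j (pd i h) y / 2 - ∑ k, pd k h y / 2 * christoffelOf b k i j y) := by
    intro i j
    rw [hpdα]
    simp only [traceForm, mul_sub, Finset.sum_sub_distrib]
    simp only [mul_comm (christoffelOf b _ i j y) (pd _ h y / 2)]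
    ring
  -- The curvature produces ∂_i h_k and the divergence produces ∂_k h_i.
  have hsymm : ∀ i j, pd j (pd i h) y = pd i (pd j h) y := by
    intro i j
    have hs := hh.isSymmSndFDerivAt (by simp)
    have hd : DifferentiableAt ℝ (fderiv ℝ h) y :=
      (hh.fderiv_right (m := 1) (by norm_num)).differentiableAt one_ne_zero
    have e : ∀ i j, pd j (pd i h) y = fderiv ℝ (fderiv ℝ h) y (EuclideanSpace.single j 1)
        (EuclideanSpace.single i 1) := by
      intro i j
      have : pd i h = fun z => fderiv ℝ h z (EuclideanSpace.single i 1) := rfl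
      rw [pd, this, fderiv_clm_apply hd (differentiableAt_const _)]
      simp
    rw [e, e, hs.eq]
  have dist₁ : ∀ f₁ f₂ f₃ f₄ f₅ f₆ : Fin d → Fin d → ℝ, ∑ i, ∑ k, (b y)⁻¹ i k *
      (f₁ i k - f₂ i k + f₃ i k + f₄ i k + f₅ i k - f₆ i k) = ∑ i, ∑ k, (b y)⁻¹ i k * f₁ i k
      - ∑ i, ∑ k, (b y)⁻¹ i k * f₂ i k + ∑ i, ∑ k, (b y)⁻¹ i k * f₃ i k
      + ∑ i, ∑ k, (b y)⁻¹ i k * f₄ i k + ∑ i, ∑ k, (b y)⁻¹ i k * f₅ i k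
      - ∑ i, ∑ k, (b y)⁻¹ i k * f₆ i k := by
    intros
    simp only [mul_add, mul_sub, Finset.sum_add_distrib, Finset.sum_sub_distrib]
  have dist₂ : ∀ f₁ f₂ f₃ : Fin d → Fin d → ℝ, ∑ i, ∑ k, (b y)⁻¹ i k *
      (f₁ i k - (f₂ i k - f₃ i k)) = ∑ i, ∑ k, (b y)⁻¹ i k * f₁ i k
      - (∑ i, ∑ k, (b y)⁻¹ i k * f₂ i k - ∑ i, ∑ k, (b y)⁻¹ i k * f₃ i k) := by
    intros
    simp only [mul_sub, Finset.sum_sub_distrib]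
  have hL : ∑ i, ∑ k, (b y)⁻¹ i k * ricciOf m y i k = _ :=
    (Finset.sum_congr rfl fun i _ => Finset.sum_congr rfl fun k _ => by
      rw [hric, contractedCurvature_sub]).trans (dist₁ _ _ _ _ _ _)
  have hR : ∑ i, ∑ j, (b y)⁻¹ i j * (pd j (traceForm b m h i) y
      - ∑ k, christoffelOf b k i j y * traceForm b m h k y) = _ :=
    (Finset.sum_congr rfl fun i _ => Finset.sum_congr rfl fun k _ => by
      rw [hα]).trans (dist₂ (fun i j => ∑ l,
        ((∑ q, (christoffelOf b q j i y * b y q l + christoffelOf b q j l y * b y i q))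
        * christoffelDiffTrace b m l y + b y i l * pd j (christoffelDiffTrace b m l) y)
        - ∑ k, christoffelOf b k i j y * ∑ l, b y k l * christoffelDiffTrace b m l y)
        (fun i j => pd j (pd i h) y / 2)
        fun i j => ∑ k, pd k h y / 2 * christoffelOf b k i j y)
  -- The second quadratic term contains the trace D^j_{jl} = ½ h_l, so it becomes ½ V^l h_l.
  have hW : ∑ i, ∑ k, (b y)⁻¹ i k *
      ∑ l, (∑ j, christoffelDiff b m j j l y) * christoffelDiff b m l i k y
      = (1 / 2) * ∑ l, christoffelDiffTrace b m l y * pd l h y := by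
    simp only [htr0, christoffelDiffTrace, Finset.mul_sum, Finset.sum_mul]
    rw [Finset.sum_comm_cycle]
    exact Finset.sum_congr rfl fun l _ => Finset.sum_congr rfl fun i _ =>
      Finset.sum_congr rfl fun k _ => by ring
  have hH : ∑ i, ∑ k, (b y)⁻¹ i k * ∑ j, pd i (christoffelDiff b m j j k) y
      = ∑ i, ∑ k, (b y)⁻¹ i k * (pd k (pd i h) y / 2) := by
    simp only [htr1, hsymm]
  rw [hL, hR, hcov, hdiv, hW, hH]
  simp only [pdV, htr0, ricciOf, christoffelDiffTrace]
  ring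

end LeviCivita

/-! ### The pointwise quadratic inequality. -/

section PointwiseInequality

variable {ι : Type*} [Fintype ι]

theorem sum_connection_orthonormal_ge (T D : ι → ι → ι → ℝ) (h : ι → ℝ)
    (hT : ∀ i j k, T i j k = T i k j)
    (hD : ∀ p i k, D p i k = (1 / 2) * (T i k p + T k i p - T p i k))
    (htr : ∀ k, ∑ j, D j j k = h k / 2) {lam : ℝ} (hlam : 0 < lam) :
    -((1 + lam) / 4) * ∑ i, h i ^ 2
      - (1 + (Fintype.card ι : ℝ) * lam⁻¹) / 4 * ∑ i, ∑ j, ∑ k, (T i j k - T j i k) ^ 2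
    ≤ ∑ i, ∑ j, ∑ l, D j i l * D l j i - (1 / 2) * ∑ l, (∑ i, D l i i) * h l := by
  set q : ι → ℝ := fun l => ∑ i, (T i l i - T l i i) with hq
  -- With x = T_{ilj}, y = T_{lji}, z = T_{jil}, the product of the two entries of D is ¼(x + (y −
  -- z))(x − (y − z)), a difference of squares; y − z is a Codazzi difference.
  have h1 : ∑ i, ∑ j, ∑ l, D j i l * D l j i
      = (1 / 4) * ∑ i, ∑ j, ∑ l, (T i l j) ^ 2
        - (1 / 4) * ∑ i, ∑ j, ∑ k, (T i j k - T j i k) ^ 2 := by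
    have e : ∑ i, ∑ j, ∑ k, (T i j k - T j i k) ^ 2 = ∑ i, ∑ j, ∑ l, (T l j i - T j l i) ^ 2 := by
      rw [sum_swap₂₃, Finset.sum_comm, sum_swap₂₃]
    rw [e]
    simp only [Finset.mul_sum, ← Finset.sum_sub_distrib]
    refine Finset.sum_congr rfl fun i _ => Finset.sum_congr rfl fun j _ =>
      Finset.sum_congr rfl fun l _ => ?_
    rw [hD, hD, hT l i j, hT j i l, hT i j l]
    ring
  have hh : ∀ l, h l = ∑ j, T l j j := by
    intro l
    have h2 : h l = 2 * ∑ j, D j j l := by rw [htr]; ring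
    rw [h2, Finset.mul_sum]
    refine Finset.sum_congr rfl fun j _ => ?_
    rw [hD, hT j l j]; ring
  have hV : ∀ l, ∑ i, D l i i = h l / 2 + q l := by
    intro l
    rw [hh, hq, Finset.sum_div, ← Finset.sum_add_distrib]
    refine Finset.sum_congr rfl fun i _ => ?_
    rw [hD, hT i l i]; ring
  -- Young's inequality for the product of h and q; the square in `h3` is chosen to give exactly the
  -- weights λ and λ⁻¹.
  have h2 : ∑ l, (∑ i, D l i i) * h l
      ≤ (1 + lam) / 2 * ∑ i, h i ^ 2 + lam⁻¹ / 2 * ∑ l, q l ^ 2 := by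
    rw [Finset.mul_sum, Finset.mul_sum, ← Finset.sum_add_distrib]
    refine Finset.sum_le_sum fun l _ => ?_
    rw [hV]
    have h3 : 0 ≤ lam⁻¹ * (lam * h l - q l) ^ 2 := by positivity
    have h4 : lam⁻¹ * (lam * h l - q l) ^ 2
        = lam * h l ^ 2 - 2 * (h l * q l) + lam⁻¹ * q l ^ 2 := by
      field_simp
      ring
    linarith
  -- Cauchy–Schwarz over the n summands of q_l. Only the components with third index equal to the
  -- first occur, so the full sum of squares is an upper bound.
  have h5 : ∑ l, q l ^ 2
      ≤ (Fintype.card ι : ℝ) * ∑ i, ∑ j, ∑ k, (T i j k - T j i k) ^ 2 := by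
    calc ∑ l, q l ^ 2 ≤ ∑ l, (Fintype.card ι : ℝ) * ∑ i, (T i l i - T l i i) ^ 2 :=
          Finset.sum_le_sum fun l _ => sq_sum_le_card_mul_sum_sq
      _ = (Fintype.card ι : ℝ) * ∑ i, ∑ l, (T i l i - T l i i) ^ 2 := by
          rw [← Finset.mul_sum, Finset.sum_comm]
      _ ≤ _ := by
          refine mul_le_mul_of_nonneg_left ?_ (Nat.cast_nonneg _)
          exact Finset.sum_le_sum fun i _ => Finset.sum_le_sum fun l _ =>
            Finset.single_le_sum (f := fun k => (T i l k - T l i k) ^ 2)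
              (fun k _ => sq_nonneg _) (Finset.mem_univ i)
  -- The only term that is simply thrown away, apart from the losses in Young and Cauchy–Schwarz.
  have h6 : 0 ≤ ∑ i, ∑ j, ∑ l, (T i l j) ^ 2 := by positivity
  have h7 := mul_le_mul_of_nonneg_left h5 (inv_nonneg.2 hlam.le)
  rw [h1]
  nlinarith

/-- The columns of P form a frame in which B is the identity, so contraction with B becomes a plain
sum over frame components. -/
theorem sum_mul_sum_eq_of_factor {B P : Matrix ι ι ℝ} (hP : B = P * Pᵀ) (x y : ι → ℝ) :
    ∑ a, (∑ i, P i a * x i) * (∑ p, P p a * y p) = ∑ i, ∑ p, B i p * x i * y p := by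
  simp only [Finset.sum_mul_sum]
  rw [← Finset.sum_comm_cycle]
  refine Finset.sum_congr rfl fun i _ => Finset.sum_congr rfl fun p _ => ?_
  simp only [hP, Matrix.mul_apply, Matrix.transpose_apply, Finset.sum_mul]
  exact Finset.sum_congr rfl fun a _ => by ring

/-- The components of a trilinear form in the frame with matrix `P`. -/
def frameComp (P : Matrix ι ι ℝ) (T : ι → ι → ι → ℝ) (a b c : ι) : ℝ :=
  ∑ i, P i a * ∑ j, P j b * ∑ k, P k c * T i j k

theorem frameComp_swap₁₂ (P : Matrix ι ι ℝ) (T : ι → ι → ι → ℝ) (a b c : ι) :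
    frameComp P (fun i j k => T j i k) a b c = frameComp P T b a c := by
  simp only [frameComp, Finset.mul_sum]
  rw [Finset.sum_comm]
  exact Finset.sum_congr rfl fun i _ => Finset.sum_congr rfl fun p _ =>
    Finset.sum_congr rfl fun a _ => by ring

theorem frameComp_swap₂₃ (P : Matrix ι ι ℝ) (T : ι → ι → ι → ℝ) (a b c : ι) :
    frameComp P (fun i j k => T i k j) a b c = frameComp P T a c b := by
  simp only [frameComp, Finset.mul_sum]
  rw [sum_swap₂₃]
  exact Finset.sum_congr rfl fun i _ => Finset.sum_congr rfl fun p _ =>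
    Finset.sum_congr rfl fun a _ => by ring

theorem sum_frameComp_sq {B P : Matrix ι ι ℝ} (hP : B = P * Pᵀ) (T : ι → ι → ι → ℝ) :
    ∑ a, ∑ b, ∑ c, frameComp P T a b c ^ 2
      = ∑ i, ∑ j, ∑ k, ∑ p, ∑ q, ∑ r, B i p * B j q * B k r * T i j k * T p q r := by
  have h1 : ∀ b c, ∑ a, frameComp P T a b c ^ 2 = ∑ i, ∑ p, B i p *
      (∑ j, P j b * ∑ k, P k c * T i j k) * (∑ j, P j b * ∑ k, P k c * T p j k) := by
    intro b c
    rw [← sum_mul_sum_eq_of_factor hP]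
    simp only [frameComp, sq]
  have h2 : ∀ i p c, ∑ b, (∑ j, P j b * ∑ k, P k c * T i j k) * (∑ j, P j b * ∑ k, P k c * T p j k)
      = ∑ j, ∑ q, B j q * (∑ k, P k c * T i j k) * (∑ k, P k c * T p q k) := fun i p c =>
    sum_mul_sum_eq_of_factor hP _ _
  have h3 : ∀ i p j q, ∑ c, (∑ k, P k c * T i j k) * (∑ k, P k c * T p q k)
      = ∑ k, ∑ r, B k r * T i j k * T p q r := fun i p j q =>
    sum_mul_sum_eq_of_factor hP _ _
  calc ∑ a, ∑ b, ∑ c, frameComp P T a b c ^ 2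
      = ∑ b, ∑ c, ∑ a, frameComp P T a b c ^ 2 := Finset.sum_comm_cycle.symm
    _ = ∑ i, ∑ p, ∑ c, ∑ b, B i p * ((∑ j, P j b * ∑ k, P k c * T i j k)
          * (∑ j, P j b * ∑ k, P k c * T p j k)) := by
        simp only [h1, mul_assoc]
        rw [Finset.sum_comm_cycle]
        refine Finset.sum_congr rfl fun i _ => ?_
        rw [Finset.sum_comm_cycle]
        exact Finset.sum_congr rfl fun p _ => Finset.sum_comm
    _ = ∑ i, ∑ p, ∑ j, ∑ q, ∑ k, ∑ r, B i p * B j q * B k r * T i j k * T p q r := by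
        refine Finset.sum_congr rfl fun i _ => Finset.sum_congr rfl fun p _ => ?_
        simp only [← Finset.mul_sum, h2]
        rw [← Finset.sum_comm_cycle]
        have h4 : ∀ j q, ∑ c, B j q * (∑ k, P k c * T i j k) * (∑ k, P k c * T p q k)
            = B j q * ∑ k, ∑ r, B k r * T i j k * T p q r := by
          intro j q
          rw [← h3, Finset.mul_sum]
          exact Finset.sum_congr rfl fun c _ => mul_assoc _ _ _
        simp only [h4]
        simp only [Finset.mul_sum]
        exact Finset.sum_congr rfl fun j _ => Finset.sum_congr rfl fun q _ =>
          Finset.sum_congr rfl fun k _ => Finset.sum_congr rfl fun r _ => by ring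
    _ = ∑ i, ∑ j, ∑ k, ∑ p, ∑ q, ∑ r, B i p * B j q * B k r * T i j k * T p q r := by
        refine Finset.sum_congr rfl fun i _ => ?_
        rw [Finset.sum_comm]
        refine Finset.sum_congr rfl fun j _ => ?_
        exact (Finset.sum_congr rfl fun p _ => Finset.sum_comm).trans Finset.sum_comm

/-- All quantities are tensorial, so the orthonormal case applies to the components in the frame P.
The upper index of D is lowered with b first, so that all three slots transform alike. -/
theorem sum_connection_ge [DecidableEq ι] {B b P : Matrix ι ι ℝ} (hP : B = P * Pᵀ)
    (hBb : B * b = 1) (T D : ι → ι → ι → ℝ) (h : ι → ℝ) (hT : ∀ i j k, T i j k = T i k j)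
    (hDs : ∀ l i k, D l i k = D l k i)
    (hD : ∀ p i k, ∑ l, b p l * D l i k = (1 / 2) * (T i k p + T k i p - T p i k))
    (htr : ∀ k, ∑ j, D j j k = h k / 2) {lam : ℝ} (hlam : 0 < lam) :
    -((1 + lam) / 4) * ∑ i, ∑ j, B i j * h i * h j
      - (1 + (Fintype.card ι : ℝ) * lam⁻¹) / 4 * ∑ i, ∑ j, ∑ k, ∑ p, ∑ q, ∑ r,
        B i p * B j q * B k r * (T i j k - T j i k) * (T p q r - T q p r)
    ≤ ∑ i, ∑ k, B i k * (∑ j, ∑ l, D j i l * D l j k)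
      - (1 / 2) * ∑ l, (∑ i, ∑ k, B i k * D l i k) * h l := by
  have hBs : ∀ i j, B i j = B j i := fun i j => by
    rw [hP, Matrix.mul_apply, Matrix.mul_apply]
    exact Finset.sum_congr rfl fun a _ => mul_comm _ _
  set L : ι → ι → ι → ℝ := fun p i k => ∑ l, b p l * D l i k with hL
  set T' := frameComp P T with hT'
  set D' := frameComp P L with hD'
  set h' : ι → ℝ := fun a => ∑ i, P i a * h i with hh'
  -- `Δ a` is the endomorphism obtained by inserting the a-th frame vector in D. As P (Pᵀ b) = 1,
  -- the matrix Pᵀ b Δ P is a conjugate of Δ, which makes traces and products independent of the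
  -- frame.
  set Δ : ι → Matrix ι ι ℝ := fun a => Matrix.of fun l k => ∑ i, P i a * D l i k with hΔ
  have hM : ∀ a b' c, D' b' a c = (Pᵀ * (b * Δ a * P)) b' c := by
    intro a b' c
    have e1 : ∀ l, ∑ i, P i a * ∑ k, P k c * L l i k = (b * Δ a * P) l c := by
      intro l
      simp only [hL, hΔ, Matrix.mul_apply, Matrix.of_apply, Finset.mul_sum, Finset.sum_mul]
      rw [Finset.sum_comm]
      refine Finset.sum_congr rfl fun k _ => ?_
      rw [Finset.sum_comm]
      exact Finset.sum_congr rfl fun k _ => Finset.sum_congr rfl fun r _ => by ring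
    rw [Matrix.mul_apply]
    simp only [← e1, hD', frameComp, Matrix.transpose_apply]
  have hcyc : ∀ X : Matrix ι ι ℝ, (Pᵀ * (b * X * P)).trace = X.trace := by
    intro X
    rw [Matrix.trace_mul_comm, Matrix.mul_assoc, ← hP, Matrix.trace_mul_comm, ← Matrix.mul_assoc,
      hBb, Matrix.one_mul]
  have hDs' : ∀ p a c, D' p a c = D' p c a := by
    intro p a c
    rw [hD', ← frameComp_swap₂₃]
    simp only [hL, hDs _ _ _]
  have hD1 : ∀ p a c, D' p a c = (1 / 2) * (T' a c p + T' c a p - T' p a c) := by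
    intro p a c
    have e1 : T' a c p = frameComp P (fun p i k => T i k p) p a c := by
      rw [frameComp_swap₁₂ P (fun i p k => T i k p), frameComp_swap₂₃]
    have e2 : T' c a p = frameComp P (fun p i k => T k i p) p a c := by
      rw [frameComp_swap₁₂ P (fun i p k => T k i p), frameComp_swap₂₃ P (fun i k p => T k i p),
        frameComp_swap₁₂]
    rw [e1, e2, hT', hD', hL]
    simp only [hD, frameComp, Finset.mul_sum, ← Finset.sum_add_distrib, ← Finset.sum_sub_distrib]
    exact Finset.sum_congr rfl fun i _ => Finset.sum_congr rfl fun j _ =>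
      Finset.sum_congr rfl fun k _ => by ring
  have hT1 : ∀ a c e, T' a c e = T' a e c := by
    intro a c e
    rw [hT', ← frameComp_swap₂₃]
    simp only [← hT]
  have htr1 : ∀ k, ∑ j, D' j j k = h' k / 2 := by
    intro k
    have e : ∑ j, D' j j k = (Pᵀ * (b * Δ k * P)).trace := by
      rw [Matrix.trace]
      exact Finset.sum_congr rfl fun j _ => by rw [hDs', hM]; rfl
    rw [e, hcyc, Matrix.trace, hh']
    simp only [Matrix.diag_apply, hΔ, Matrix.of_apply, Finset.sum_div]
    rw [Finset.sum_comm]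
    refine Finset.sum_congr rfl fun i _ => ?_
    rw [← Finset.mul_sum, mul_div_assoc, ← htr]
    simp only [hDs _ i]
  have key := sum_connection_orthonormal_ge T' D' h' hT1 hD1 htr1 hlam
  have k1 : ∑ i, h' i ^ 2 = ∑ i, ∑ j, B i j * h i * h j := by
    rw [← sum_mul_sum_eq_of_factor hP]
    simp only [hh', sq]
  have k2 : ∑ i, ∑ j, ∑ k, (T' i j k - T' j i k) ^ 2 = ∑ i, ∑ j, ∑ k, ∑ p, ∑ q, ∑ r,
      B i p * B j q * B k r * (T i j k - T j i k) * (T p q r - T q p r) := by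
    rw [← sum_frameComp_sq hP fun i j k => T i j k - T j i k]
    refine Finset.sum_congr rfl fun i _ => Finset.sum_congr rfl fun j _ =>
      Finset.sum_congr rfl fun k _ => ?_
    rw [hT', ← frameComp_swap₁₂ P T i j k]
    simp only [frameComp, mul_sub, Finset.sum_sub_distrib]
  have k3 : ∑ i, ∑ j, ∑ l, D' j i l * D' l j i
      = ∑ i, ∑ k, B i k * (∑ j, ∑ l, D j i l * D l j k) := by
    have e1 : ∀ a, ∑ j, ∑ l, D' j a l * D' l j a = ∑ j, ∑ l, Δ a j l * Δ a l j := by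
      intro a
      have e2 : ∑ j, ∑ l, D' j a l * D' l j a
          = ((Pᵀ * (b * Δ a * P)) * (Pᵀ * (b * Δ a * P))).trace := by
        rw [Matrix.trace]
        refine Finset.sum_congr rfl fun j _ => ?_
        rw [Matrix.diag_apply, Matrix.mul_apply]
        exact Finset.sum_congr rfl fun l _ => by rw [hM, hDs', hM]
      have e3 : (Pᵀ * (b * Δ a * P)) * (Pᵀ * (b * Δ a * P)) = Pᵀ * (b * (Δ a * Δ a) * P) := by
        calc _ = Pᵀ * (b * Δ a * ((P * Pᵀ) * b) * Δ a * P) := by simp only [Matrix.mul_assoc]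
          _ = _ := by rw [← hP, hBb]; simp only [Matrix.mul_assoc, Matrix.one_mul]
      rw [e2, e3, hcyc, Matrix.trace]
      exact Finset.sum_congr rfl fun j _ => by rw [Matrix.diag_apply, Matrix.mul_apply]
    simp only [e1, hΔ, Matrix.of_apply]
    rw [← Finset.sum_comm_cycle]
    simp only [sum_mul_sum_eq_of_factor hP]
    simp only [Finset.mul_sum]
    rw [Finset.sum_comm_cycle]
    refine Finset.sum_congr rfl fun i _ => ?_
    rw [Finset.sum_comm_cycle]
    exact Finset.sum_congr rfl fun k _ => Finset.sum_congr rfl fun j _ =>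
      Finset.sum_congr rfl fun l _ => by rw [hDs l k j]; ring
  have k4 : ∑ l, (∑ i, D' l i i) * h' l = ∑ l, (∑ i, ∑ k, B i k * D l i k) * h l := by
    set V : ι → ℝ := fun l => ∑ i, ∑ k, B i k * D l i k with hV
    have e1 : ∀ p, ∑ i, D' p i i = ∑ l, P l p * (b *ᵥ V) l := by
      intro p
      have e2 : ∀ l, ∑ a, ∑ i, P i a * ∑ k, P k a * L l i k = (b *ᵥ V) l := by
        intro l
        have e4 : ∀ a, ∑ i, P i a * ∑ k, P k a * L l i k
            = ∑ i, ∑ k, (P i a * P k a) * L l i k := fun a => by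
          simp only [Finset.mul_sum, mul_assoc]
        simp only [e4]
        rw [← Finset.sum_comm_cycle]
        simp only [← Finset.sum_mul, Matrix.mulVec, dotProduct, hV]
        simp only [hL, Finset.mul_sum, hP, Matrix.mul_apply, Matrix.transpose_apply]
        rw [Finset.sum_comm_cycle]
        exact Finset.sum_congr rfl fun i _ => Finset.sum_congr rfl fun k _ =>
          Finset.sum_congr rfl fun j _ => by ring
      simp only [hD', frameComp]
      rw [Finset.sum_comm]
      simp only [← Finset.mul_sum, e2]
    simp only [e1, hh', sum_mul_sum_eq_of_factor hP]
    rw [Finset.sum_comm]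
    refine Finset.sum_congr rfl fun l _ => ?_
    have e3 : ∑ p, B l p * (b *ᵥ V) p = V l := by
      have : (B *ᵥ (b *ᵥ V)) l = V l := by rw [Matrix.mulVec_mulVec, hBb, Matrix.one_mulVec]
      rw [← this]; rfl
    rw [show (∑ i, ∑ k, B i k * D l i k) = V l from rfl, ← e3, Finset.sum_mul]
    refine Finset.sum_congr rfl fun p _ => ?_
    rw [hBs l p]
  rw [k1, k2, k3, k4] at key
  exact key

end PointwiseInequality

/-! ### Chart coordinates of tangent vectors and Gram matrices. -/

section Charts

variable {d : ℕ} {X : Type*} [TopologicalSpace X] [ChartedSpace (E d) X] [IsManifold (𝓡 d) ∞ X]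

/-- The link between differentials of charts and the trivialisation of the tangent bundle, through
which smooth sections become smooth components. -/
theorem coords_eq_continuousLinearMapAt {c q : X} (hq : q ∈ (extChartAt (𝓡 d) c).source)
    (v : TangentSpace (𝓡 d) q) : coords c q v =
      (trivializationAt (E d) (TangentSpace (𝓡 d)) c).continuousLinearMapAt ℝ q v := by
  rw [extChartAt_source] at hq
  rw [TangentBundle.continuousLinearMapAt_trivializationAt hq]
  rfl

theorem mem_baseSet_of_mem_source {c q : X} (hq : q ∈ (extChartAt (𝓡 d) c).source) :
    q ∈ (trivializationAt (E d) (TangentSpace (𝓡 d) : X → Type _) c).baseSet := by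
  simpa [extChartAt_source] using hq

theorem coords_isInvertible {c q : X} (hq : q ∈ (extChartAt (𝓡 d) c).source) :
    (coords (d := d) c q).IsInvertible := by
  have h := isInvertible_mfderiv_extChartAt (I := 𝓡 d) (x := c) hq
  exact h

theorem coords_inverse {c q : X} (hq : q ∈ (extChartAt (𝓡 d) c).source) (u : E d) :
    coords c q ((coords c q).inverse u) = u :=
  (coords_isInvertible hq).self_apply_inverse u

theorem inverse_coords {c q : X} (hq : q ∈ (extChartAt (𝓡 d) c).source)
    (v : TangentSpace (𝓡 d) q) : (coords c q).inverse (coords c q v) = v :=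
  (coords_isInvertible hq).inverse_apply_self v

theorem coords_inverse_eq_symmL {c q : X} (hq : q ∈ (extChartAt (𝓡 d) c).source) (u : E d) :
    (coords c q).inverse u = (trivializationAt (E d) (TangentSpace (𝓡 d)) c).symmL ℝ q u := by
  refine (coords_isInvertible hq).injective ?_
  rw [coords_inverse hq, coords_eq_continuousLinearMapAt hq,
    Trivialization.continuousLinearMapAt_symmL _ (mem_baseSet_of_mem_source hq)]

theorem sum_coords_smul_coordVec {c q : X} (hq : q ∈ (extChartAt (𝓡 d) c).source)
    (v : TangentSpace (𝓡 d) q) : ∑ i, coords c q v i • coordVec c q i = v := by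
  simp only [coordVec, ← map_smul, ← map_sum, sum_smul_single]
  exact inverse_coords hq v

theorem inverse_eq_sum_smul_coordVec (c q : X) (u : E d) :
    (coords c q).inverse u = ∑ i, u i • coordVec c q i := by
  simp only [coordVec, ← map_smul, ← map_sum, sum_smul_single]

theorem bil_gram (g : FormField d X) (c q : X) (u v : E d) :
    bil (gram g c q) u v = g q ((coords c q).inverse u) ((coords c q).inverse v) := by
  rw [inverse_eq_sum_smul_coordVec, inverse_eq_sum_smul_coordVec, bil_apply]
  simp only [map_sum, map_smul, LinearMap.sum_apply, LinearMap.smul_apply, smul_eq_mul,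
    Finset.mul_sum]
  rw [Finset.sum_comm]
  refine Finset.sum_congr rfl fun i _ => Finset.sum_congr rfl fun j _ => ?_
  simp only [gram, Matrix.of_apply]; ring

theorem bil_gram_coords (g : FormField d X) {c q : X} (hq : q ∈ (extChartAt (𝓡 d) c).source)
    (v w : TangentSpace (𝓡 d) q) : bil (gram g c q) (coords c q v) (coords c q w) = g q v w := by
  rw [bil_gram, inverse_coords hq, inverse_coords hq]

theorem isSymm_gram {g : FormField d X} (hg : ∀ x v w, g x v w = g x w v) (c q : X) :
    (gram g c q).IsSymm :=
  Matrix.IsSymm.ext fun _ _ => hg _ _ _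

theorem posDef_gram {g : FormField d X} (hg : ∀ x v w, g x v w = g x w v)
    {c q : X} (hpos : ∀ v, v ≠ 0 → 0 < g q v v) (hq : q ∈ (extChartAt (𝓡 d) c).source) :
    (gram g c q).PosDef := by
  refine Matrix.PosDef.of_dotProduct_mulVec_pos ?_ fun x hx => ?_
  · rw [Matrix.IsHermitian, Matrix.conjTranspose_eq_transpose_of_trivial]
    exact isSymm_gram hg c q
  · have h1 : star x ⬝ᵥ gram g c q *ᵥ x
        = bil (gram g c q) (WithLp.toLp 2 x) (WithLp.toLp 2 x) := by
      simp only [bil_apply, dotProduct, Matrix.mulVec, Finset.mul_sum, star_trivial]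
      exact Finset.sum_congr rfl fun i _ => Finset.sum_congr rfl fun j _ => by ring
    rw [h1, bil_gram]
    refine hpos _ fun h0 => hx ?_
    have h2 := coords_inverse hq (WithLp.toLp 2 x)
    rw [h0, map_zero] at h2
    ext i
    have := congrFun (congrArg WithLp.ofLp h2) i
    simpa using this.symm

theorem det_gram_ne_zero {g : FormField d X} (hg : ∀ x v w, g x v w = g x w v)
    {c q : X} (hpos : ∀ v, v ≠ 0 → 0 < g q v v) (hq : q ∈ (extChartAt (𝓡 d) c).source) :
    (gram g c q).det ≠ 0 :=
  (posDef_gram hg hpos hq).det_pos.ne'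

theorem hasMFDerivAt_extChartAt_symm {c : X} {y : E d} (hy : y ∈ (extChartAt (𝓡 d) c).target) :
    HasMFDerivAt 𝓘(ℝ, E d) (𝓡 d) (extChartAt (𝓡 d) c).symm y
      (coords c ((extChartAt (𝓡 d) c).symm y)).inverse := by
  have h1 := mdifferentiableWithinAt_extChartAt_symm (I := 𝓡 d) hy
  have h2 := mfderiv_extChartAt_comp_mfderivWithin_extChartAt_symm (I := 𝓡 d) hy
  have hq := (extChartAt (𝓡 d) c).map_target hy
  rw [ModelWithCorners.range_eq_univ, mdifferentiableWithinAt_univ] at h1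
  rw [ModelWithCorners.range_eq_univ, mfderivWithin_univ] at h2
  have h3 := h1.hasMFDerivAt
  have e : (coords c ((extChartAt (𝓡 d) c).symm y)).inverse
      = mfderiv 𝓘(ℝ, E d) (𝓡 d) (extChartAt (𝓡 d) c).symm y := by
    ext1 u
    refine (coords_isInvertible hq).injective ?_
    rw [coords_inverse hq]
    exact (DFunLike.congr_fun h2 u).symm
  rw [e]
  exact h3

theorem hasMFDerivAt_extChartAt_coords {c q : X} (hq : q ∈ (extChartAt (𝓡 d) c).source) :
    HasMFDerivAt (𝓡 d) 𝓘(ℝ, E d) (extChartAt (𝓡 d) c) q (coords c q) := by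
  have h := mdifferentiableAt_extChartAt (I := 𝓡 d) (x := c) (y := q)
    (by rwa [extChartAt_source] at hq)
  exact h.hasMFDerivAt

end Charts

/-! ### Smoothness of the metric components. -/

section Smoothness

variable {d : ℕ} {X : Type*} [TopologicalSpace X] [ChartedSpace (E d) X] [IsManifold (𝓡 d) ∞ X]

theorem contMDiffAt_extChartAt_symm {c : X} {y : E d} (hy : y ∈ (extChartAt (𝓡 d) c).target) :
    ContMDiffAt 𝓘(ℝ, E d) (𝓡 d) ∞ (extChartAt (𝓡 d) c).symm y :=
  (contMDiffOn_extChartAt_symm c).contMDiffAt (extChartAt_target_mem_nhds' hy)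

theorem contMDiffAt_coordVec {c q : X} (hq : q ∈ (extChartAt (𝓡 d) c).source) (i : Fin d) :
    ContMDiffAt (𝓡 d) (𝓡 d).tangent ∞
      (fun p => (⟨p, coordVec c p i⟩ : TangentBundle (𝓡 d) X)) q := by
  have h := contMDiffAt_localFrame_of_mem (I := 𝓡 d) (V := (TangentSpace (𝓡 d) : X → Type _)) ∞
    (trivializationAt (E d) (TangentSpace (𝓡 d)) c)
    (EuclideanSpace.basisFun (Fin d) ℝ).toBasis i (mem_baseSet_of_mem_source hq)
  refine h.congr_of_eventuallyEq ?_
  filter_upwards [extChartAt_source_mem_nhds' hq] with p hp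
  have := mem_baseSet_of_mem_source hp
  rw [coordVec, coords_inverse_eq_symmL hp]
  simp only [Trivialization.localFrame, this, dif_pos, Trivialization.basisAt, Module.Basis.map_apply,
    OrthonormalBasis.coe_toBasis, EuclideanSpace.basisFun_apply, Trivialization.linearEquivAt_symm_apply,
    ← Trivialization.symmₗ_apply (R := ℝ) _ this]
  rfl

theorem contDiffAt_metricComp_formOf
    (g : ContMDiffRiemannianMetric (𝓡 d) ∞ (E d) (fun x : X => TangentSpace (𝓡 d) x))
    {c : X} {y : E d} (hy : y ∈ (extChartAt (𝓡 d) c).target) (i j : Fin d) :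
    ContDiffAt ℝ ∞ (fun z => metricComp (formOf g) c z i j) y := by
  have hq := (extChartAt (𝓡 d) c).map_target hy
  have h1 : ContMDiffAt (𝓡 d) ((𝓡 d).prod 𝓘(ℝ)) ∞
      (fun m ↦ TotalSpace.mk' ℝ (E := Bundle.Trivial X ℝ) m
        (g.inner m (coordVec c m i) (coordVec c m j))) ((extChartAt (𝓡 d) c).symm y) := by
    apply ContMDiffAt.clm_bundle_apply₂ (F₁ := E d) (F₂ := E d)
    · exact g.contMDiff.contMDiffAt
    · exact contMDiffAt_coordVec hq i
    · exact contMDiffAt_coordVec hq j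
  simp only [contMDiffAt_totalSpace] at h1
  exact (h1.2.comp y (contMDiffAt_extChartAt_symm hy)).contDiffAt

end Smoothness

/-! ### Maps and fields along maps in charts. -/

section LocalRepresentation

variable {d e : ℕ} {X Y : Type*} [TopologicalSpace X] [ChartedSpace (E d) X]
  [IsManifold (𝓡 d) ∞ X] [TopologicalSpace Y] [ChartedSpace (E e) Y] [IsManifold (𝓡 e) ∞ Y]

/-- The representation of a map in the charts centred at `c` and `c'`. -/
def locMap (f : X → Y) (c : X) (c' : Y) (y : E d) : E e :=
  extChartAt (𝓡 e) c' (f ((extChartAt (𝓡 d) c).symm y))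

/-- The representation of a vector field along a map in the charts centred at `c` and `c'`. -/
def locField (f : X → Y) (N : ∀ x, TangentSpace (𝓡 e) (f x)) (c : X) (c' : Y) (y : E d) : E e :=
  coords c' (f ((extChartAt (𝓡 d) c).symm y)) (N ((extChartAt (𝓡 d) c).symm y))

theorem contDiffAt_locMap {f : X → Y} (hf : ContMDiff (𝓡 d) (𝓡 e) ∞ f) {c : X} {c' : Y} {y : E d}
    (hy : y ∈ (extChartAt (𝓡 d) c).target)
    (hq : f ((extChartAt (𝓡 d) c).symm y) ∈ (extChartAt (𝓡 e) c').source) :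
    ContDiffAt ℝ ∞ (locMap (e := e) f c c') y := by
  have h1 : ContMDiffAt (𝓡 e) 𝓘(ℝ, E e) ∞ (extChartAt (𝓡 e) c')
      (f ((extChartAt (𝓡 d) c).symm y)) :=
    contMDiffAt_extChartAt' (by rwa [extChartAt_source] at hq)
  exact (h1.comp y (hf.contMDiffAt.comp y (contMDiffAt_extChartAt_symm hy))).contDiffAt

theorem hasFDerivAt_locMap {f : X → Y} (hf : ContMDiff (𝓡 d) (𝓡 e) ∞ f) {c : X} {c' : Y} {y : E d}
    (hy : y ∈ (extChartAt (𝓡 d) c).target)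
    (hq : f ((extChartAt (𝓡 d) c).symm y) ∈ (extChartAt (𝓡 e) c').source) :
    HasFDerivAt (locMap (e := e) f c c') (coords (d := e) c' (f ((extChartAt (𝓡 d) c).symm y)) ∘L
      mfderiv (𝓡 d) (𝓡 e) f ((extChartAt (𝓡 d) c).symm y) ∘L
      (coords c ((extChartAt (𝓡 d) c).symm y)).inverse : E d →L[ℝ] E e) y := by
  have h1 := hasMFDerivAt_extChartAt_coords hq
  have h2 := (hf.mdifferentiable (by simp) ((extChartAt (𝓡 d) c).symm y)).hasMFDerivAt
  exact (h1.comp y (h2.comp y (hasMFDerivAt_extChartAt_symm hy))).hasFDerivAt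

theorem fderiv_locMap {f : X → Y} (hf : ContMDiff (𝓡 d) (𝓡 e) ∞ f) {c : X} {c' : Y} {y : E d}
    (hy : y ∈ (extChartAt (𝓡 d) c).target)
    (hq : f ((extChartAt (𝓡 d) c).symm y) ∈ (extChartAt (𝓡 e) c').source) (u : E d) :
    fderiv ℝ (locMap (e := e) f c c') y u = coords (d := e) c' (f ((extChartAt (𝓡 d) c).symm y))
      (diff f ((extChartAt (𝓡 d) c).symm y) ((coords c ((extChartAt (𝓡 d) c).symm y)).inverse u)) := by
  rw [(hasFDerivAt_locMap hf hy hq).fderiv]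
  rfl

theorem eventually_mem_source {f : X → Y} (hf : ContMDiff (𝓡 d) (𝓡 e) ∞ f) {c : X} {c' : Y}
    {y : E d} (hy : y ∈ (extChartAt (𝓡 d) c).target)
    (hq : f ((extChartAt (𝓡 d) c).symm y) ∈ (extChartAt (𝓡 e) c').source) :
    ∀ᶠ z in nhds y, z ∈ (extChartAt (𝓡 d) c).target ∧
      f ((extChartAt (𝓡 d) c).symm z) ∈ (extChartAt (𝓡 e) c').source := by
  have h1 : ContinuousAt (fun z => f ((extChartAt (𝓡 d) c).symm z)) y :=
    hf.continuous.continuousAt.comp (contMDiffAt_extChartAt_symm hy).continuousAt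
  exact Filter.Eventually.and (extChartAt_target_mem_nhds' hy)
    (h1.eventually (extChartAt_source_mem_nhds' hq))

theorem contMDiffAt_coords_apply {f : X → Y} {N : ∀ x, TangentSpace (𝓡 e) (f x)}
    (hN : ContMDiff (𝓡 d) (𝓡 e).tangent ∞ (fun x => (⟨f x, N x⟩ : TangentBundle (𝓡 e) Y)))
    {c' : Y} {q : X} (hq : f q ∈ (extChartAt (𝓡 e) c').source) :
    ContMDiffAt (𝓡 d) 𝓘(ℝ, E e) ∞ (fun x => coords c' (f x) (N x)) q := by
  have hb := mem_baseSet_of_mem_source hq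
  have h0 := ((trivializationAt (E e) (TangentSpace (𝓡 e)) c').contMDiffAt_iff
    (f := fun x => (⟨f x, N x⟩ : TangentBundle (𝓡 e) Y)) (x₀ := q)
    ((Trivialization.mem_source _).2 hb)).1 hN.contMDiffAt
  refine h0.2.congr_of_eventuallyEq ?_
  have hc : ContinuousAt f q := h0.1.continuousAt
  filter_upwards [hc.eventually (extChartAt_source_mem_nhds' hq)] with p hp
  rw [coords_eq_continuousLinearMapAt hp,
    Trivialization.continuousLinearMapAt_apply,
    Trivialization.coe_linearMapAt_of_mem _ (mem_baseSet_of_mem_source hp)]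

theorem contDiffAt_locField {f : X → Y} {N : ∀ x, TangentSpace (𝓡 e) (f x)}
    (hN : ContMDiff (𝓡 d) (𝓡 e).tangent ∞ (fun x => (⟨f x, N x⟩ : TangentBundle (𝓡 e) Y)))
    {c : X} {c' : Y} {y : E d} (hy : y ∈ (extChartAt (𝓡 d) c).target)
    (hq : f ((extChartAt (𝓡 d) c).symm y) ∈ (extChartAt (𝓡 e) c').source) :
    ContDiffAt ℝ ∞ (locField f N c c') y :=
  ((contMDiffAt_coords_apply hN hq).comp y (contMDiffAt_extChartAt_symm hy)).contDiffAt

/-- The pull-back of a metric in coordinates. -/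
theorem bil_metricComp_pullback {f : X → Y} (hf : ContMDiff (𝓡 d) (𝓡 e) ∞ f)
    (g : FormField e Y) {c : X} {c' : Y} {y : E d} (hy : y ∈ (extChartAt (𝓡 d) c).target)
    (hq : f ((extChartAt (𝓡 d) c).symm y) ∈ (extChartAt (𝓡 e) c').source) (u v : E d) :
    bil (metricComp (pullback (n := d) g f) c y) u v
      = bil (metricComp g c' (locMap (e := e) f c c' y)) (fderiv ℝ (locMap (e := e) f c c') y u)
          (fderiv ℝ (locMap (e := e) f c c') y v) := by
  rw [metricComp, bil_gram, fderiv_locMap hf hy hq, fderiv_locMap hf hy hq, metricComp, locMap,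
    (extChartAt (𝓡 e) c').left_inv hq, bil_gram_coords _ hq]
  rfl

end LocalRepresentation

/-! ### Naturality of covariant derivatives under affine maps. -/

section Composition

variable {U V W : Type*} [NormedAddCommGroup U] [NormedSpace ℝ U] [NormedAddCommGroup V]
  [NormedSpace ℝ V] [NormedAddCommGroup W] [NormedSpace ℝ W]

/-- Naturality of the covariant derivative along a map under an affine map `φ`. -/
theorem covAlong_comp {Γ : V → V →L[ℝ] V →L[ℝ] V} {Γ' : W → W →L[ℝ] W →L[ℝ] W} {φ : V → W}
    {F X : U → V} {y : U} (hφ : ContDiffAt ℝ 2 φ (F y)) (hF : DifferentiableAt ℝ F y)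
    (hX : DifferentiableAt ℝ X y)
    (haff : ∀ u v, covAlong Γ' φ (fun z => fderiv ℝ φ z v) (F y) u = fderiv ℝ φ (F y) (Γ (F y) u v))
    (u : U) :
    covAlong Γ' (fun z => φ (F z)) (fun z => fderiv ℝ φ (F z) (X z)) y u
      = fderiv ℝ φ (F y) (covAlong Γ F X y u) := by
  have hdφ : DifferentiableAt ℝ (fderiv ℝ φ) (F y) :=
    (hφ.fderiv_right (m := 1) (by norm_num)).differentiableAt (by norm_num)
  have h1 : fderiv ℝ (fun z => φ (F z)) y u = fderiv ℝ φ (F y) (fderiv ℝ F y u) := by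
    have := ((hφ.differentiableAt (by norm_num)).hasFDerivAt.comp y hF.hasFDerivAt).fderiv
    exact DFunLike.congr_fun this u
  have h2 : fderiv ℝ (fun z => fderiv ℝ φ (F z) (X z)) y u
      = fderiv ℝ (fderiv ℝ φ) (F y) (fderiv ℝ F y u) (X y) + fderiv ℝ φ (F y) (fderiv ℝ X y u) := by
    have h3 : HasFDerivAt (fun z => fderiv ℝ φ (F z)) _ y :=
      HasFDerivAt.comp (g := fderiv ℝ φ) (g' := fderiv ℝ (fderiv ℝ φ) (F y)) y hdφ.hasFDerivAt
        hF.hasFDerivAt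
    rw [(h3.clm_apply hX.hasFDerivAt).fderiv]
    simp [add_comm]
  -- Affinity is used with the vector X(y) frozen. It accounts for the second derivative of φ that
  -- the product rule creates, so the derivative of X plays no part in it.
  have h4 := haff (fderiv ℝ F y u) (X y)
  have h5 : fderiv ℝ (fun z => fderiv ℝ φ z (X y)) (F y) (fderiv ℝ F y u)
      = fderiv ℝ (fderiv ℝ φ) (F y) (fderiv ℝ F y u) (X y) := by
    rw [(hdφ.hasFDerivAt.clm_apply (hasFDerivAt_const (X y) (F y))).fderiv]
    simp
  rw [covAlong, h5] at h4
  rw [covAlong, covAlong, map_add, ← h4, h1, h2]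
  abel

theorem covAlong_congr {Γ : V → V →L[ℝ] V →L[ℝ] V} {F X F' X' : U → V} {y : U}
    (hF : F =ᶠ[nhds y] F') (hX : X =ᶠ[nhds y] X') (u : U) :
    covAlong Γ F X y u = covAlong Γ F' X' y u := by
  rw [covAlong, covAlong, hF.fderiv_eq, hX.fderiv_eq, hF.self_of_nhds, hX.self_of_nhds]

end Composition

/-! ### Smooth metrics and their connection forms in a chart. -/

section SmoothMetric

variable {d e : ℕ} {X Y : Type*} [TopologicalSpace X] [ChartedSpace (E d) X]
  [IsManifold (𝓡 d) ∞ X] [TopologicalSpace Y] [ChartedSpace (E e) Y] [IsManifold (𝓡 e) ∞ Y]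

/-- A field of symmetric positive definite bilinear forms which is smooth in charts. -/
structure IsSmoothMetric (g : FormField d X) : Prop where
  symm (x : X) (v w : TangentSpace (𝓡 d) x) : g x v w = g x w v
  pos (x : X) (v : TangentSpace (𝓡 d) x) : v ≠ 0 → 0 < g x v v
  contDiffAt (c : X) {y : E d} (hy : y ∈ (extChartAt (𝓡 d) c).target) (i j : Fin d) :
    ContDiffAt ℝ ∞ (fun z => metricComp g c z i j) y

theorem isSmoothMetric_formOf
    (g : ContMDiffRiemannianMetric (𝓡 d) ∞ (E d) (fun x : X => TangentSpace (𝓡 d) x)) :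
    IsSmoothMetric (formOf g) where
  symm x v w := g.symm x v w
  pos x v hv := g.pos x v hv
  contDiffAt _ _ hy i j := contDiffAt_metricComp_formOf g hy i j

namespace IsSmoothMetric

variable {g : FormField d X} (hg : IsSmoothMetric g) {c : X} {y : E d}
  (hy : y ∈ (extChartAt (𝓡 d) c).target)

include hg

theorem isSymm_metricComp (c : X) (y : E d) : (metricComp g c y).IsSymm :=
  isSymm_gram hg.symm _ _

theorem bil_metricComp_comm (c : X) (y u v : E d) :
    bil (metricComp g c y) u v = bil (metricComp g c y) v u :=
  bil_comm (hg.isSymm_metricComp c y) u v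

theorem christoffel_comm (c : X) (y u v : E d) :
    christoffelBil (metricComp g c) y u v = christoffelBil (metricComp g c) y v u :=
  christoffelBil_comm (Filter.Eventually.of_forall fun z => hg.isSymm_metricComp c z) u v

include hy

theorem det_metricComp_ne_zero : (metricComp g c y).det ≠ 0 :=
  det_gram_ne_zero hg.symm (hg.pos _) ((extChartAt (𝓡 d) c).map_target hy)

theorem contDiffAt_bil_metricComp : ContDiffAt ℝ ∞ (fun z => bil (metricComp g c z)) y :=
  contDiffAt_bil fun i j => hg.contDiffAt c hy i j

theorem differentiableAt_bil_metricComp : DifferentiableAt ℝ (fun z => bil (metricComp g c z)) y :=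
  (hg.contDiffAt_bil_metricComp hy).differentiableAt (by simp)

theorem contDiffAt_christoffel : ContDiffAt ℝ ∞ (christoffelBil (metricComp g c)) y :=
  contDiffAt_christoffelBil (fun i j => hg.contDiffAt c hy i j) (hg.det_metricComp_ne_zero hy)
    (by simp)

theorem isCompatibleAt :
    IsCompatibleAt (fun z => bil (metricComp g c z)) (christoffelBil (metricComp g c)) y :=
  fun u v w => fderiv_bil_eq_christoffelBil
    (fun i j => (hg.contDiffAt c hy i j).differentiableAt (by simp))
    (Filter.Eventually.of_forall fun z => hg.isSymm_metricComp c z)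
    (hg.det_metricComp_ne_zero hy) u v w

end IsSmoothMetric

end SmoothMetric

/-! ### Independence of the chart. -/

section ChartChange

variable {d e : ℕ} {X Y : Type*} [TopologicalSpace X] [ChartedSpace (E d) X]
  [IsManifold (𝓡 d) ∞ X] [TopologicalSpace Y] [ChartedSpace (E e) Y] [IsManifold (𝓡 e) ∞ Y]

theorem mvfderiv_inverse_coords {F : Type*} [NormedAddCommGroup F] [NormedSpace ℝ F] {φ : X → F}
    {c : X} {y : E d} (hy : y ∈ (extChartAt (𝓡 d) c).target)
    (hφ : MDifferentiableAt (𝓡 d) 𝓘(ℝ, F) φ ((extChartAt (𝓡 d) c).symm y)) (u : E d) :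
    mvfderiv (𝓡 d) φ ((extChartAt (𝓡 d) c).symm y)
        ((coords c ((extChartAt (𝓡 d) c).symm y)).inverse u)
      = fderiv ℝ (fun z => φ ((extChartAt (𝓡 d) c).symm z)) y u := by
  have h : HasFDerivAt (fun z => φ ((extChartAt (𝓡 d) c).symm z))
      (mvfderiv (𝓡 d) φ ((extChartAt (𝓡 d) c).symm y) ∘L
        (coords c ((extChartAt (𝓡 d) c).symm y)).inverse : E d →L[ℝ] F) y :=
    (hφ.hasMFDerivAt.comp y (hasMFDerivAt_extChartAt_symm hy)).hasFDerivAt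
  rw [h.fderiv]
  rfl

theorem diff_id (x : X) (v : TangentSpace (𝓡 d) x) :
    diff (n := d) (m := d) (id : X → X) x v = v := by
  have h : mfderiv (𝓡 d) (𝓡 d) (id : X → X) x = ContinuousLinearMap.id ℝ _ := mfderiv_id
  exact DFunLike.congr_fun h v

theorem pullback_id (g : FormField d X) : pullback (n := d) g (id : X → X) = g := by
  funext x
  ext v w
  exact congrArg₂ (fun a b => g x a b) (diff_id x v) (diff_id x w)

theorem fderiv_locMap_id {c c' : X} {y : E d} (hy : y ∈ (extChartAt (𝓡 d) c).target)
    (hq : (extChartAt (𝓡 d) c).symm y ∈ (extChartAt (𝓡 d) c').source)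
    (v : TangentSpace (𝓡 d) ((extChartAt (𝓡 d) c).symm y)) :
    fderiv ℝ (locMap (e := d) (id : X → X) c c') y (coords c ((extChartAt (𝓡 d) c).symm y) v)
      = coords c' ((extChartAt (𝓡 d) c).symm y) v := by
  rw [fderiv_locMap contMDiff_id hy hq, inverse_coords ((extChartAt (𝓡 d) c).map_target hy)]
  exact congrArg (coords c' ((extChartAt (𝓡 d) c).symm y)) (diff_id _ v)

theorem fderiv_locMap_id_extChartAt {c c' p : X} (hp : p ∈ (extChartAt (𝓡 d) c).source)
    (hp' : p ∈ (extChartAt (𝓡 d) c').source) (v : TangentSpace (𝓡 d) p) :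
    fderiv ℝ (locMap (e := d) (id : X → X) c c') (extChartAt (𝓡 d) c p) (coords c p v)
      = coords c' p v := by
  obtain ⟨y, hy, rfl⟩ : ∃ y ∈ (extChartAt (𝓡 d) c).target, (extChartAt (𝓡 d) c).symm y = p :=
    ⟨_, (extChartAt (𝓡 d) c).map_source hp, (extChartAt (𝓡 d) c).left_inv hp⟩
  rw [(extChartAt (𝓡 d) c).right_inv hy]
  exact fderiv_locMap_id hy hp' v

/-- Changes of charts are affine for the Levi-Civita connection forms. -/
theorem IsSmoothMetric.covAlong_locMap_id {g : FormField d X} (hg : IsSmoothMetric g) {c c' : X}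
    {y : E d} (hy : y ∈ (extChartAt (𝓡 d) c).target)
    (hq : (extChartAt (𝓡 d) c).symm y ∈ (extChartAt (𝓡 d) c').source) (u v : E d) :
    covAlong (christoffelBil (metricComp g c')) (locMap (e := d) (id : X → X) c c')
        (fun z => fderiv ℝ (locMap (e := d) (id : X → X) c c') z v) y u
      = fderiv ℝ (locMap (e := d) (id : X → X) c c') y
          (christoffelBil (metricComp g c) y u v) := by
  have hy' : locMap (e := d) (id : X → X) c c' y ∈ (extChartAt (𝓡 d) c').target :=
    (extChartAt (𝓡 d) c').map_source hq
  have hφ : ContDiffAt ℝ ∞ (locMap (e := d) (id : X → X) c c') y :=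
    contDiffAt_locMap contMDiff_id hy hq
  have hpull : ∀ᶠ z in nhds y, ∀ u v, bil (metricComp g c z) u v
      = bil (metricComp g c' (locMap (e := d) (id : X → X) c c' z))
          (fderiv ℝ (locMap (e := d) (id : X → X) c c') z u)
          (fderiv ℝ (locMap (e := d) (id : X → X) c c') z v) := by
    filter_upwards [eventually_mem_source (f := (id : X → X)) contMDiff_id hy hq] with z hz u v
    have h := bil_metricComp_pullback (f := (id : X → X)) contMDiff_id g hz.1 hz.2 u v
    rwa [pullback_id] at h
  -- The Gauss formula for the identity map read in two charts, where the metric is its own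
  -- pull-back.
  have key := inner_covAlong_fderiv (G := fun z => bil (metricComp g c' z))
    (Γ := christoffelBil (metricComp g c')) (G' := fun z => bil (metricComp g c z))
    (Γ' := christoffelBil (metricComp g c)) (hg.differentiableAt_bil_metricComp hy')
    (hg.differentiableAt_bil_metricComp hy) (hφ.of_le ENat.LEInfty.out)
    (hg.isCompatibleAt hy')
    (hg.isCompatibleAt hy) (hg.bil_metricComp_comm _ _) (hg.bil_metricComp_comm _ _)
    (hg.christoffel_comm _ _) (hg.christoffel_comm _ _) hpull u v
  rw [← sub_eq_zero]
  refine bil_left_eq_zero (hg.det_metricComp_ne_zero hy') fun w => ?_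
  -- The differential of a change of charts is onto, so the tangential part is everything.
  obtain ⟨w', rfl⟩ : ∃ w', fderiv ℝ (locMap (e := d) (id : X → X) c c') y w' = w :=
    ⟨_, (fderiv_locMap_id hy hq ((coords c' ((extChartAt (𝓡 d) c).symm y)).inverse w)).trans
      (coords_inverse hq w)⟩
  rw [map_sub, sub_apply, key w', hpull.self_of_nhds, sub_self]

/-- The definition uses the target chart centred at the image point; here only the source chart is
arbitrary. -/
theorem coords_covDerivAlong_self (g : FormField e Y) {f : X → Y}
    {N : ∀ x, TangentSpace (𝓡 e) (f x)} (hf : ContMDiff (𝓡 d) (𝓡 e) ∞ f)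
    (hN : ContMDiff (𝓡 d) (𝓡 e).tangent ∞ (fun x => (⟨f x, N x⟩ : TangentBundle (𝓡 e) Y)))
    {c : X} {y : E d} (hy : y ∈ (extChartAt (𝓡 d) c).target) (u : E d) :
    coords (f ((extChartAt (𝓡 d) c).symm y)) (f ((extChartAt (𝓡 d) c).symm y))
        (covDerivAlong (n := d) g f N ((extChartAt (𝓡 d) c).symm y)
          ((coords c ((extChartAt (𝓡 d) c).symm y)).inverse u))
      = covAlong (christoffelBil (metricComp g (f ((extChartAt (𝓡 d) c).symm y))))
          (locMap f c (f ((extChartAt (𝓡 d) c).symm y)))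
          (locField f N c (f ((extChartAt (𝓡 d) c).symm y))) y u := by
  set q := (extChartAt (𝓡 d) c).symm y with hqdef
  have hq : f q ∈ (extChartAt (𝓡 e) (f q)).source := mem_extChartAt_source (f q)
  have hN' := contMDiffAt_coords_apply hN hq
  have h1 : ∀ k, mvfderiv (𝓡 d) (fun z => coords (f q) (f z) (N z) k) q
      ((coords c q).inverse u) = fderiv ℝ (locField f N c (f q)) y u k := by
    intro k
    have hk : ContMDiffAt (𝓡 d) 𝓘(ℝ, ℝ) ∞ (fun z => coords (f q) (f z) (N z) k) q :=
      (((EuclideanSpace.proj (𝕜 := ℝ) k).contDiff (n := ∞)).contMDiff).contMDiffAt.comp q hN'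
    rw [hqdef, mvfderiv_inverse_coords hy (hk.mdifferentiableAt (by simp))]
    have h2 := ((EuclideanSpace.proj (𝕜 := ℝ) k).hasFDerivAt.comp y
      ((contDiffAt_locField hN hy hq).differentiableAt (by simp)).hasFDerivAt).fderiv
    exact DFunLike.congr_fun h2 u
  have h3 : coords (f q) (f q) (diff (n := d) (m := e) f q ((coords c q).inverse u))
      = fderiv ℝ (locMap (e := e) f c (f q)) y u := (fderiv_locMap hf hy hq u).symm
  have h4 : locMap (e := e) f c (f q) y = extChartAt (𝓡 e) (f q) (f q) := rfl
  have h5 : locField f N c (f q) y = coords (f q) (f q) (N q) := rfl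
  simp only [covDerivAlong, LinearMap.coe_mk, AddHom.coe_mk]
  rw [coords_inverse hq, covAlong, h4, h5]
  ext k
  rw [PiLp.add_apply, christoffelBil, bilVec_apply, ← h1, ← h3]
  rfl

/-- The covariant derivative along a map in arbitrary charts. -/
theorem IsSmoothMetric.coords_covDerivAlong {g : FormField e Y} (hg : IsSmoothMetric g) {f : X → Y}
    {N : ∀ x, TangentSpace (𝓡 e) (f x)} (hf : ContMDiff (𝓡 d) (𝓡 e) ∞ f)
    (hN : ContMDiff (𝓡 d) (𝓡 e).tangent ∞ (fun x => (⟨f x, N x⟩ : TangentBundle (𝓡 e) Y)))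
    {c : X} {c' : Y} {y : E d} (hy : y ∈ (extChartAt (𝓡 d) c).target)
    (hq' : f ((extChartAt (𝓡 d) c).symm y) ∈ (extChartAt (𝓡 e) c').source) (u : E d) :
    coords c' (f ((extChartAt (𝓡 d) c).symm y))
        (covDerivAlong (n := d) g f N ((extChartAt (𝓡 d) c).symm y)
          ((coords c ((extChartAt (𝓡 d) c).symm y)).inverse u))
      = covAlong (christoffelBil (metricComp g c')) (locMap f c c') (locField f N c c') y u := by
  have h0 := coords_covDerivAlong_self g hf hN hy u
  set p := f ((extChartAt (𝓡 d) c).symm y) with hp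
  have hq : p ∈ (extChartAt (𝓡 e) p).source := mem_extChartAt_source p
  have hF0 : locMap (e := e) f c p y = extChartAt (𝓡 e) p p := rfl
  have hy0 : extChartAt (𝓡 e) p p ∈ (extChartAt (𝓡 e) p).target := mem_extChartAt_target p
  have hq0 : (extChartAt (𝓡 e) p).symm (extChartAt (𝓡 e) p p)
      ∈ (extChartAt (𝓡 e) c').source := by
    rwa [(extChartAt (𝓡 e) p).left_inv hq]
  -- The representation in the chart at c' is the one in the chart centred at p followed by the
  -- transition map, which is affine for the two connection forms.
  rw [← fderiv_locMap_id_extChartAt hq hq', h0, ← hF0, ← covAlong_comp]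
  · refine covAlong_congr ?_ ?_ u
    · filter_upwards [eventually_mem_source hf hy hq] with z hz
      rw [locMap, locMap, locMap, (extChartAt (𝓡 e) p).left_inv hz.2]
      rfl
    · filter_upwards [eventually_mem_source hf hy hq, eventually_mem_source hf hy hq']
        with z hz hz'
      exact fderiv_locMap_id_extChartAt hz.2 hz'.2 _
  · exact (contDiffAt_locMap contMDiff_id hy0 hq0).of_le ENat.LEInfty.out
  · exact (contDiffAt_locMap hf hy hq).differentiableAt (by simp)
  · exact (contDiffAt_locField hN hy hq).differentiableAt (by simp)
  · exact hg.covAlong_locMap_id hy0 hq0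

end ChartChange

/-! ### The induced metric of an immersion. -/

section Pullback

variable {d e : ℕ} {X Y : Type*} [TopologicalSpace X] [ChartedSpace (E d) X]
  [IsManifold (𝓡 d) ∞ X] [TopologicalSpace Y] [ChartedSpace (E e) Y] [IsManifold (𝓡 e) ∞ Y]

theorem contDiffAt_bil_metricComp_apply {g : FormField e Y} (hg : IsSmoothMetric g) {F A B : E d → E e}
    {c' : Y} {y : E d} (hy : F y ∈ (extChartAt (𝓡 e) c').target) (hF : ContDiffAt ℝ ∞ F y)
    (hA : ContDiffAt ℝ ∞ A y) (hB : ContDiffAt ℝ ∞ B y) :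
    ContDiffAt ℝ ∞ (fun z => bil (metricComp g c' (F z)) (A z) (B z)) y :=
  ContDiffAt.clm_apply (ContDiffAt.clm_apply
    (ContDiffAt.comp (g := fun z => bil (metricComp g c' z)) y
      (hg.contDiffAt_bil_metricComp hy) hF) hA) hB

theorem contDiffAt_fderiv_apply {V W : Type*} [NormedAddCommGroup V] [NormedSpace ℝ V]
    [NormedAddCommGroup W] [NormedSpace ℝ W] {F : V → W} {y : V} (hF : ContDiffAt ℝ ∞ F y) (v : V) :
    ContDiffAt ℝ ∞ (fun z => fderiv ℝ F z v) y :=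
  (hF.fderiv_right (m := ∞) (by simp)).clm_apply contDiffAt_const

theorem locMap_mem_target {f : X → Y} {c : X} {c' : Y} {y : E d}
    (hq : f ((extChartAt (𝓡 d) c).symm y) ∈ (extChartAt (𝓡 e) c').source) :
    locMap (e := e) f c c' y ∈ (extChartAt (𝓡 e) c').target :=
  (extChartAt (𝓡 e) c').map_source hq

theorem symm_locMap {f : X → Y} {c : X} {c' : Y} {y : E d}
    (hq : f ((extChartAt (𝓡 d) c).symm y) ∈ (extChartAt (𝓡 e) c').source) :
    (extChartAt (𝓡 e) c').symm (locMap (e := e) f c c' y) = f ((extChartAt (𝓡 d) c).symm y) :=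
  (extChartAt (𝓡 e) c').left_inv hq

theorem bil_metricComp_locMap (g : FormField e Y) {f : X → Y} {c : X} {c' : Y} {y : E d}
    (hq : f ((extChartAt (𝓡 d) c).symm y) ∈ (extChartAt (𝓡 e) c').source)
    (v w : TangentSpace (𝓡 e) (f ((extChartAt (𝓡 d) c).symm y))) :
    bil (metricComp g c' (locMap (e := e) f c c' y))
      (coords c' (f ((extChartAt (𝓡 d) c).symm y)) v)
      (coords c' (f ((extChartAt (𝓡 d) c).symm y)) w) = g (f ((extChartAt (𝓡 d) c).symm y)) v w := by
  rw [metricComp, symm_locMap hq, bil_gram_coords _ hq]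

theorem isSmoothMetric_pullback {g : FormField e Y} (hg : IsSmoothMetric g) {f : X → Y}
    (hf : IsSmoothImmersion d e f) : IsSmoothMetric (pullback (n := d) g f) where
  symm x v w := hg.symm _ _ _
  pos x v hv := hg.pos _ _ fun h => hv (hf.injective_diff x (by rw [h, map_zero]))
  contDiffAt c y hy i j := by
    have hq := mem_extChartAt_source (I := 𝓡 e) (f ((extChartAt (𝓡 d) c).symm y))
    have hF := contDiffAt_locMap hf.contMDiff hy hq
    refine (contDiffAt_bil_metricComp_apply hg (locMap_mem_target hq) hF
      (contDiffAt_fderiv_apply hF (EuclideanSpace.single i 1))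
      (contDiffAt_fderiv_apply hF (EuclideanSpace.single j 1))).congr_of_eventuallyEq ?_
    filter_upwards [eventually_mem_source hf.contMDiff hy hq] with z hz
    rw [← bil_metricComp_pullback hf.contMDiff g hz.1 hz.2, bil_single]

end Pullback

/-! ### The shape operator and the metric g^A. -/

section Hypersurface

variable {n : ℕ} {S M : Type*} [TopologicalSpace S] [ChartedSpace (E n) S]
  [IsManifold (𝓡 n) ∞ S] [TopologicalSpace M] [ChartedSpace (E (n + 1)) M]
  [IsManifold (𝓡 (n + 1)) ∞ M] {g : FormField (n + 1) M} {f : S → M}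
  {N : ∀ x, TangentSpace (𝓡 (n + 1)) (f x)}

theorem bil_locField_self (hN : IsUnitNormal (n := n) g f N) {c : S} {c' : M} {y : E n}
    (hq : f ((extChartAt (𝓡 n) c).symm y) ∈ (extChartAt (𝓡 (n + 1)) c').source) :
    bil (metricComp g c' (locMap f c c' y)) (locField f N c c' y) (locField f N c c' y) = 1 := by
  rw [locField, bil_metricComp_locMap g hq]
  exact hN.norm_eq_one _

theorem bil_locField_fderiv (hf : IsSmoothImmersion n (n + 1) f)
    (hN : IsUnitNormal (n := n) g f N) {c : S} {c' : M} {y : E n}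
    (hy : y ∈ (extChartAt (𝓡 n) c).target)
    (hq : f ((extChartAt (𝓡 n) c).symm y) ∈ (extChartAt (𝓡 (n + 1)) c').source) (u : E n) :
    bil (metricComp g c' (locMap f c c' y)) (locField f N c c' y)
      (fderiv ℝ (locMap f c c') y u) = 0 := by
  rw [locField, fderiv_locMap hf.contMDiff hy hq, bil_metricComp_locMap g hq]
  exact hN.orthogonal _ _

/-- The covariant derivative of a unit normal field is tangential. -/
theorem inner_covDerivAlong_normal (hg : IsSmoothMetric g) (hf : IsSmoothImmersion n (n + 1) f)
    (hN : IsUnitNormal (n := n) g f N) (x : S) (v : TangentSpace (𝓡 n) x) :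
    g (f x) (N x) (covDerivAlong g f N x v) = 0 := by
  obtain ⟨c, y, hy, rfl⟩ : ∃ c : S, ∃ y ∈ (extChartAt (𝓡 n) c).target,
      (extChartAt (𝓡 n) c).symm y = x := ⟨x, _, mem_extChartAt_target x, extChartAt_to_inv x⟩
  have hq := mem_extChartAt_source (I := 𝓡 (n + 1)) (f ((extChartAt (𝓡 n) c).symm y))
  have hev := eventually_mem_source hf.contMDiff hy hq
  obtain ⟨u, rfl⟩ : ∃ u, (coords c ((extChartAt (𝓡 n) c).symm y)).inverse u = v :=
    ⟨_, inverse_coords ((extChartAt (𝓡 n) c).map_target hy) v⟩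
  have hy' := locMap_mem_target hq
  rw [← bil_metricComp_locMap g hq, hg.coords_covDerivAlong hf.contMDiff hN.contMDiff hy hq]
  exact inner_covAlong_unit (G := fun z => bil (metricComp g _ z))
    (hg.differentiableAt_bil_metricComp hy')
    ((contDiffAt_locMap hf.contMDiff hy hq).differentiableAt (by simp))
    ((contDiffAt_locField hN.contMDiff hy hq).differentiableAt (by simp))
    (hg.isCompatibleAt hy') (hg.bil_metricComp_comm _ _)
    (hev.mono fun z hz => bil_locField_self hN hz.2) u

/-- Orthogonality gives one inclusion. Both spaces have dimension n, because the functional ⟨N, ·⟩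
is nonzero on a space of dimension n + 1. -/
theorem range_diff (hf : IsSmoothImmersion n (n + 1) f)
    (hN : IsUnitNormal (n := n) g f N) (x : S) :
    LinearMap.range (diff (n := n) (m := n + 1) f x) = LinearMap.ker (g (f x) (N x)) := by
  have hfd : FiniteDimensional ℝ (TangentSpace (𝓡 (n + 1)) (f x)) :=
    inferInstanceAs (FiniteDimensional ℝ (E (n + 1)))
  have h1 : Module.finrank ℝ (TangentSpace (𝓡 n) x) = n :=
    (finrank_euclideanSpace_fin : Module.finrank ℝ (E n) = n)
  have h2 : Module.finrank ℝ (TangentSpace (𝓡 (n + 1)) (f x)) = n + 1 :=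
    (finrank_euclideanSpace_fin : Module.finrank ℝ (E (n + 1)) = n + 1)
  refine Submodule.eq_of_le_of_finrank_eq ?_ ?_
  · rintro _ ⟨v, rfl⟩
    exact hN.orthogonal x v
  · rw [LinearMap.finrank_range_of_inj (hf.injective_diff x), h1]
    have h3 : g (f x) (N x) ≠ 0 := fun h => by
      have := hN.norm_eq_one x
      rw [h] at this
      simp at this
    have h4 := Module.Dual.finrank_ker_add_one_of_ne_zero h3
    omega

/-- The defining property of the shape operator. -/
theorem diff_shapeOperator (hg : IsSmoothMetric g) (hf : IsSmoothImmersion n (n + 1) f)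
    (hN : IsUnitNormal (n := n) g f N) (x : S) (v : TangentSpace (𝓡 n) x) :
    diff f x (shapeOperator g f N x v) = covDerivAlong g f N x v := by
  have h : covDerivAlong g f N x v ∈ LinearMap.range (diff (n := n) (m := n + 1) f x) := by
    rw [range_diff hf hN]
    exact inner_covDerivAlong_normal hg hf hN x v
  obtain ⟨w, hw⟩ := h
  rw [shapeOperator, LinearMap.comp_apply, ← hw,
    LinearMap.leftInverse_apply_of_inj (LinearMap.ker_eq_bot.2 (hf.injective_diff x))]

theorem shapeMetric_apply (hg : IsSmoothMetric g) (hf : IsSmoothImmersion n (n + 1) f)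
    (hN : IsUnitNormal (n := n) g f N) (x : S) (v w : TangentSpace (𝓡 n) x) :
    shapeMetric g f N x v w = g (f x) (covDerivAlong g f N x v) (diff f x w) := by
  rw [← diff_shapeOperator hg hf hN]
  rfl

/-- The metric `g^A` in coordinates. -/
theorem bil_metricComp_shapeMetric (hg : IsSmoothMetric g) (hf : IsSmoothImmersion n (n + 1) f)
    (hN : IsUnitNormal (n := n) g f N) {c : S} {c' : M} {y : E n}
    (hy : y ∈ (extChartAt (𝓡 n) c).target)
    (hq : f ((extChartAt (𝓡 n) c).symm y) ∈ (extChartAt (𝓡 (n + 1)) c').source) (u v : E n) :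
    bil (metricComp (shapeMetric (n := n) g f N) c y) u v
      = bil (metricComp g c' (locMap f c c' y))
          (covAlong (christoffelBil (metricComp g c')) (locMap f c c') (locField f N c c') y u)
          (fderiv ℝ (locMap f c c') y v) := by
  rw [metricComp, bil_gram, shapeMetric_apply hg hf hN, fderiv_locMap hf.contMDiff hy hq,
    ← hg.coords_covDerivAlong hf.contMDiff hN.contMDiff hy hq, bil_metricComp_locMap g hq]

theorem shapeMetric_comm (hg : IsSmoothMetric g) (hf : IsSmoothImmersion n (n + 1) f)
    (hN : IsUnitNormal (n := n) g f N) (x : S) (v w : TangentSpace (𝓡 n) x) :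
    shapeMetric g f N x v w = shapeMetric g f N x w v := by
  have hx := mem_extChartAt_source (I := 𝓡 n) x
  have hy := mem_extChartAt_target (I := 𝓡 n) x
  have hq : f ((extChartAt (𝓡 n) x).symm (extChartAt (𝓡 n) x x))
      ∈ (extChartAt (𝓡 (n + 1)) (f x)).source := by
    rw [extChartAt_to_inv]; exact mem_extChartAt_source _
  have hy' := locMap_mem_target hq
  have h := bil_metricComp_shapeMetric hg hf hN hy hq
  have hev := eventually_mem_source hf.contMDiff hy hq
  have key := inner_covAlong_normal_comm (G := fun z => bil (metricComp g (f x) z))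
    (hg.differentiableAt_bil_metricComp hy')
    ((contDiffAt_locMap hf.contMDiff hy hq).of_le ENat.LEInfty.out)
    ((contDiffAt_locField hN.contMDiff hy hq).differentiableAt (by simp))
    (hg.isCompatibleAt hy') (hg.christoffel_comm _ _)
    (hev.mono fun z hz => bil_locField_fderiv hf hN hz.1 hz.2) (coords x x v) (coords x x w)
  rw [← h, ← h, metricComp, extChartAt_to_inv, bil_gram_coords _ hx, bil_gram_coords _ hx] at key
  exact key

theorem isSmoothMetric_shapeMetric (hg : IsSmoothMetric g) (hf : IsSmoothImmersion n (n + 1) f)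
    (hN : IsUnitNormal (n := n) g f N) (hconv : IsLocallyStrictlyConvex (n := n) g f N) :
    IsSmoothMetric (shapeMetric (n := n) g f N) where
  symm := shapeMetric_comm hg hf hN
  pos := hconv
  contDiffAt c y hy i j := by
    -- One target chart is kept fixed while z varies, so that g^A is given near y by a single smooth
    -- formula although its definition uses a moving chart.
    obtain ⟨p, hq⟩ : ∃ p, f ((extChartAt (𝓡 n) c).symm y) ∈ (extChartAt (𝓡 (n + 1)) p).source :=
      ⟨_, mem_extChartAt_source _⟩
    have hF := contDiffAt_locMap hf.contMDiff hy hq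
    have hX := contDiffAt_locField hN.contMDiff hy hq
    have hΓ := hg.contDiffAt_christoffel (locMap_mem_target hq)
    refine (contDiffAt_bil_metricComp_apply hg (locMap_mem_target hq) hF (A := fun z =>
      covAlong (christoffelBil (metricComp g p)) (locMap f c p) (locField f N c p) z
        (EuclideanSpace.single i 1)) ?_
      (contDiffAt_fderiv_apply hF (EuclideanSpace.single j 1))).congr_of_eventuallyEq ?_
    · exact (contDiffAt_fderiv_apply hX _).add (((ContDiffAt.comp (g := christoffelBil _) y hΓ hF).clm_apply
        (contDiffAt_fderiv_apply hF _)).clm_apply hX)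
    · filter_upwards [eventually_mem_source hf.contMDiff hy hq] with z hz
      rw [← bil_metricComp_shapeMetric hg hf hN hz.1 hz.2, bil_single]

end Hypersurface

/-! ### Curvature in components. -/

section Curvature

variable {d : ℕ}

/-- The components of the curvature of the connection form with the given Christoffel symbols. -/
theorem curvatureOf_christoffelBil {m : E d → Matrix (Fin d) (Fin d) ℝ} {y : E d}
    (hΓ : ∀ k i j, DifferentiableAt ℝ (christoffelOf m k i j) y) (a b c : E d) (l : Fin d) :
    curvatureOf (christoffelBil m) y a b c l = ∑ i, ∑ j, ∑ k, a i * b j * c k *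
      (pd i (christoffelOf m l j k) y - pd j (christoffelOf m l i k) y
        + ∑ p, (christoffelOf m l i p y * christoffelOf m p j k y
          - christoffelOf m l j p y * christoffelOf m p i k y)) := by
  have hD (a b c : E d) : fderiv ℝ (christoffelBil m) y a b c l
      = ∑ j, ∑ k, (∑ i, a i * pd i (christoffelOf m l j k) y) * b j * c k := by
    have h := fderiv_bilVec (C := fun z k i j => christoffelOf m k i j z) hΓ a
    have h' : fderiv ℝ (christoffelBil m) y a = _ := h
    rw [h', bilVec_apply]
    exact Finset.sum_congr rfl fun j _ => Finset.sum_congr rfl fun k _ => by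
      rw [← fderiv_apply_eq_sum_pd]
  have hQ (a b c : E d) : christoffelBil m y a (christoffelBil m y b c) l
      = ∑ i, ∑ p, christoffelOf m l i p y * a i
          * ∑ j, ∑ k, christoffelOf m p j k y * b j * c k := by
    simp only [christoffelBil, bilVec_apply]
  have h1 (a b c : E d) : ∑ j, ∑ k, (∑ i, a i * pd i (christoffelOf m l j k) y) * b j * c k
      = ∑ i, ∑ j, ∑ k, a i * b j * c k * pd i (christoffelOf m l j k) y := by
    simp only [Finset.sum_mul]
    rw [sum_swap₂₃, Finset.sum_comm]
    exact Finset.sum_congr rfl fun i _ => Finset.sum_congr rfl fun j _ =>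
      Finset.sum_congr rfl fun k _ => by ring
  have h2 (a b c : E d) : ∑ i, ∑ p, christoffelOf m l i p y * a i
          * ∑ j, ∑ k, christoffelOf m p j k y * b j * c k
      = ∑ i, ∑ j, ∑ k, a i * b j * c k * ∑ p, christoffelOf m l i p y * christoffelOf m p j k y := by
    refine Finset.sum_congr rfl fun i _ => ?_
    simp only [Finset.mul_sum]
    rw [Finset.sum_comm]
    refine Finset.sum_congr rfl fun j _ => ?_
    rw [Finset.sum_comm]
    exact Finset.sum_congr rfl fun k _ => Finset.sum_congr rfl fun p _ => by ring
  rw [curvatureOf, PiLp.sub_apply, PiLp.add_apply, PiLp.sub_apply, hD, hD, hQ, hQ, h1, h1, h2, h2,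
    Finset.sum_comm (f := fun i j => ∑ k, b i * a j * c k * pd i (christoffelOf m l j k) y),
    Finset.sum_comm (f := fun i j => ∑ k, b i * a j * c k
      * ∑ p, christoffelOf m l i p y * christoffelOf m p j k y)]
  simp only [← Finset.sum_sub_distrib, ← Finset.sum_add_distrib]
  refine Finset.sum_congr rfl fun i _ => Finset.sum_congr rfl fun j _ =>
    Finset.sum_congr rfl fun k _ => ?_
  rw [Finset.sum_sub_distrib]
  ring

end Curvature

section Riemann

variable {d : ℕ} {X : Type*} [TopologicalSpace X] [ChartedSpace (E d) X] [IsManifold (𝓡 d) ∞ X]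

theorem IsSmoothMetric.riemann_eq {g : FormField d X} (hg : IsSmoothMetric g) (x : X)
    (u v w z : TangentSpace (𝓡 d) x) :
    riemann g x u v w z = g x ((coords x x).inverse
      (curvatureOf (christoffelBil (metricComp g x)) (extChartAt (𝓡 d) x x)
        (coords x x u) (coords x x v) (coords x x w))) z := by
  have hΓ : ∀ k i j, DifferentiableAt ℝ (christoffelOf (metricComp g x) k i j)
      (extChartAt (𝓡 d) x x) := fun k i j =>
    (contDiffAt_christoffelOf (s := ∞)
      (fun i j => hg.contDiffAt x (mem_extChartAt_target x) i j)
      (hg.det_metricComp_ne_zero (mem_extChartAt_target x)) (by simp) k i j).differentiableAt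
        (by simp)
  rw [inverse_eq_sum_smul_coordVec]
  simp only [curvatureOf_christoffelBil hΓ, map_sum, map_smul, LinearMap.sum_apply,
    LinearMap.smul_apply, smul_eq_mul, Finset.sum_mul]
  have hswap (G : Fin d → Fin d → Fin d → Fin d → ℝ) :
      ∑ i, ∑ j, ∑ k, ∑ l, G i j k l = ∑ l, ∑ i, ∑ j, ∑ k, G i j k l := by
    rw [sum_swap₃₄, sum_swap₂₃, Finset.sum_comm]
  rw [riemann, hswap]
  rfl

end Riemann

/-! ### The determinant of A and the Codazzi equation in charts. -/

section Hypersurface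

variable {n : ℕ} {S M : Type*} [TopologicalSpace S] [ChartedSpace (E n) S]
  [IsManifold (𝓡 n) ∞ S] [TopologicalSpace M] [ChartedSpace (E (n + 1)) M]
  [IsManifold (𝓡 (n + 1)) ∞ M] {g : FormField (n + 1) M} {f : S → M}
  {N : ∀ x, TangentSpace (𝓡 (n + 1)) (f x)}

/-- From g(A e_i, e_j) = A^k_i g_{kj}, the Gram matrix of g^A is the transposed matrix of A times
that of g. This converts det A = e^h into det b = e^h det g. -/
theorem det_gram_shapeMetric (g : FormField (n + 1) M) (f : S → M)
    (N : ∀ x, TangentSpace (𝓡 (n + 1)) (f x)) {c q : S} (hq : q ∈ (extChartAt (𝓡 n) c).source) :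
    (gram (d := n) (shapeMetric (n := n) g f N) c q).det
      = LinearMap.det (shapeOperator (n := n) g f N q) * (gram (pullback (n := n) g f) c q).det := by
  let β : Module.Basis (Fin n) ℝ (TangentSpace (𝓡 n) q) :=
    (EuclideanSpace.basisFun (Fin n) ℝ).toBasis.map
      (LinearEquiv.ofLinearMap (coords c q).inverse.toLinearMap (coords c q).toLinearMap
        (LinearMap.ext fun v => inverse_coords hq v) (LinearMap.ext fun v => coords_inverse hq v))
  have hβ (i) : β i = coordVec c q i := by
    simp [β, coordVec]
  have hr (v) (i) : β.repr v i = coords c q v i := by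
    simp [β]
  rw [← LinearMap.det_toMatrix β, ← Matrix.det_transpose (LinearMap.toMatrix β β _), ← Matrix.det_mul]
  congr 1
  ext i j
  simp only [Matrix.mul_apply, Matrix.transpose_apply, LinearMap.toMatrix_apply, hr, hβ]
  have h := sum_coords_smul_coordVec hq (shapeOperator (n := n) g f N q (coordVec c q i))
  simp only [gram, Matrix.of_apply]
  rw [shapeMetric, LinearMap.BilinForm.comp_apply]
  conv_lhs => rw [← h]
  simp

/-- The Codazzi equation in coordinates. -/
theorem codazzi_metricComp (hg : IsSmoothMetric g) (hf : IsSmoothImmersion n (n + 1) f)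
    (hN : IsUnitNormal (n := n) g f N) (hconv : IsLocallyStrictlyConvex (n := n) g f N)
    {c : S} {y : E n} (hy : y ∈ (extChartAt (𝓡 n) c).target) (u v w : E n) :
    (fderiv ℝ (fun z => bil (metricComp (shapeMetric (n := n) g f N) c z)) y u v w
      - bil (metricComp (shapeMetric (n := n) g f N) c y) v
          (christoffelBil (metricComp (pullback (n := n) g f) c) y u w))
    - (fderiv ℝ (fun z => bil (metricComp (shapeMetric (n := n) g f N) c z)) y v u w
      - bil (metricComp (shapeMetric (n := n) g f N) c y) u
          (christoffelBil (metricComp (pullback (n := n) g f) c) y v w))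
    = curvNormal g f N ((extChartAt (𝓡 n) c).symm y)
        ((coords c ((extChartAt (𝓡 n) c).symm y)).inverse u)
        ((coords c ((extChartAt (𝓡 n) c).symm y)).inverse v)
        ((coords c ((extChartAt (𝓡 n) c).symm y)).inverse w) := by
  set q := (extChartAt (𝓡 n) c).symm y with hqdef
  have hq : f q ∈ (extChartAt (𝓡 (n + 1)) (f q)).source := mem_extChartAt_source (f q)
  have hev := eventually_mem_source hf.contMDiff hy hq
  have hy' : locMap (e := n + 1) f c (f q) y ∈ (extChartAt (𝓡 (n + 1)) (f q)).target :=
    locMap_mem_target hq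
  have hF : ContDiffAt ℝ ∞ (locMap (e := n + 1) f c (f q)) y := contDiffAt_locMap hf.contMDiff hy hq
  have hX : ContDiffAt ℝ ∞ (locField f N c (f q)) y := contDiffAt_locField hN.contMDiff hy hq
  have hm := isSmoothMetric_pullback hg hf
  have hb := isSmoothMetric_shapeMetric hg hf hN hconv
  have hG := hg.differentiableAt_bil_metricComp hy'
  have key := codazzi (G := fun z => bil (metricComp g (f q) z))
    (Γ := christoffelBil (metricComp g (f q))) (F := locMap f c (f q)) (N := locField f N c (f q))
    (y := y) hG ((hg.contDiffAt_christoffel hy').differentiableAt (by simp))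
    (hF.of_le ENat.LEInfty.out) (hX.of_le ENat.LEInfty.out) (hg.isCompatibleAt hy') u v w
  have hbil : ∀ v w, fderiv ℝ (fun z => bil (metricComp g (f q) (locMap f c (f q) z))
        (covAlong (christoffelBil (metricComp g (f q))) (locMap f c (f q)) (locField f N c (f q)) z v)
        (fderiv ℝ (locMap f c (f q)) z w)) y
      = fderiv ℝ (fun z => bil (metricComp (shapeMetric (n := n) g f N) c z) v w) y := by
    intro v w
    refine Filter.EventuallyEq.fderiv_eq ?_
    filter_upwards [hev] with z hz
    exact (bil_metricComp_shapeMetric hg hf hN hz.1 hz.2 v w).symm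
  have hbil' : ∀ u v w, fderiv ℝ (fun z => bil (metricComp (shapeMetric (n := n) g f N) c z) v w) y u
      = fderiv ℝ (fun z => bil (metricComp (shapeMetric (n := n) g f N) c z)) y u v w := by
    intro u v w
    have h := ((hb.differentiableAt_bil_metricComp hy).hasFDerivAt.clm_apply
      (hasFDerivAt_const v y)).clm_apply (hasFDerivAt_const w y)
    have h' := h.fderiv
    rw [h']
    simp
  -- Since ∇_v N is tangential, say dF a, pairing with it sees only the tangential part of ∇_u(dF
  -- w), which the Gauss formula identifies with the induced connection.
  have hgauss : ∀ u v w, bil (metricComp g (f q) (locMap f c (f q) y))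
        (covAlong (christoffelBil (metricComp g (f q))) (locMap f c (f q)) (locField f N c (f q)) y v)
        (covAlong (christoffelBil (metricComp g (f q))) (locMap f c (f q))
          (fun z => fderiv ℝ (locMap f c (f q)) z w) y u)
      = bil (metricComp (shapeMetric (n := n) g f N) c y) v
          (christoffelBil (metricComp (pullback (n := n) g f) c) y u w) := by
    intro u v w
    rw [bil_metricComp_shapeMetric hg hf hN hy hq]
    obtain ⟨a, ha⟩ : ∃ a, fderiv ℝ (locMap f c (f q)) y a
        = covAlong (christoffelBil (metricComp g (f q))) (locMap f c (f q)) (locField f N c (f q))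
            y v := by
      refine ⟨coords c q (shapeOperator g f N q ((coords c q).inverse v)), ?_⟩
      rw [fderiv_locMap hf.contMDiff hy hq, ← hqdef,
        inverse_coords ((extChartAt (𝓡 n) c).map_target hy), diff_shapeOperator hg hf hN]
      exact hg.coords_covDerivAlong hf.contMDiff hN.contMDiff hy hq v
    rw [← ha, ← bil_metricComp_pullback hf.contMDiff g hy hq, hg.bil_metricComp_comm,
      hm.bil_metricComp_comm]
    exact inner_covAlong_fderiv (G := fun z => bil (metricComp g (f q) z))
      (G' := fun z => bil (metricComp (pullback (n := n) g f) c z)) hG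
      (hm.differentiableAt_bil_metricComp hy) (hF.of_le ENat.LEInfty.out) (hg.isCompatibleAt hy')
      (hm.isCompatibleAt hy) (hg.bil_metricComp_comm _ _) (hm.bil_metricComp_comm _ _)
      (hg.christoffel_comm _ _) (hm.christoffel_comm _ _)
      (hev.mono fun z hz => bil_metricComp_pullback hf.contMDiff g hz.1 hz.2) u w a
  rw [hbil, hbil, hbil', hbil', hgauss, hgauss] at key
  rw [curvNormal, hg.riemann_eq, ← bil_metricComp_locMap g hq, ← hqdef, coords_inverse hq]
  have hFu (u : E n) : coords (f q) (f q) (diff (n := n) (m := n + 1) f q ((coords c q).inverse u))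
      = fderiv ℝ (locMap (e := n + 1) f c (f q)) y u := (fderiv_locMap hf.contMDiff hy hq u).symm
  rw [hFu, hFu, hFu]
  have h4 : locMap (e := n + 1) f c (f q) y = extChartAt (𝓡 (n + 1)) (f q) (f q) := rfl
  have h5 : locField f N c (f q) y = coords (f q) (f q) (N q) := rfl
  rw [← h4, ← h5]
  linear_combination key

end Hypersurface

/-! ### Traces with respect to a metric. -/

section TraceAlgebra

variable {ι : Type*} [Fintype ι] [DecidableEq ι]

/-- The trace of the difference of two connections in terms of the covariant derivative `T` of
the metric, when the volume densities differ by the factor `exp h`. -/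
theorem sum_trace_connection {B b : Matrix ι ι ℝ} (hBb : B * b = 1) (hB : B.IsSymm)
    (T D : ι → ι → ι → ℝ) (h : ι → ℝ) (hT : ∀ i j k, T i j k = T i k j)
    (hDs : ∀ l i k, D l i k = D l k i)
    (hD : ∀ p i k, ∑ l, b p l * D l i k = (1 / 2) * (T i k p + T k i p - T p i k))
    (htr : ∀ k, ∑ j, D j j k = h k / 2) (p : ι) :
    ∑ l, b p l * (∑ i, ∑ k, B i k * D l i k) - h p / 2
      = ∑ i, ∑ k, B i k * (T i p k - T p i k) := by
  have h1 : ∑ l, b p l * (∑ i, ∑ k, B i k * D l i k)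
      = ∑ i, ∑ k, B i k * ((1 / 2) * (T i k p + T k i p - T p i k)) := by
    simp only [← hD, Finset.mul_sum]
    rw [Finset.sum_comm]
    refine Finset.sum_congr rfl fun i _ => ?_
    rw [Finset.sum_comm]
    exact Finset.sum_congr rfl fun k _ => Finset.sum_congr rfl fun l _ => by ring
  have h2 : ∑ i, ∑ k, B i k * T k i p = ∑ i, ∑ k, B i k * T i k p := by
    rw [Finset.sum_comm]
    exact Finset.sum_congr rfl fun i _ => Finset.sum_congr rfl fun k _ => by rw [hB.apply]
  -- The Koszul formula inverted: D measures the failure of b to be parallel for the other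
  -- connection.
  have h3 (i k : ι) : T p i k = ∑ l, b k l * D l p i + ∑ l, b i l * D l p k := by
    rw [hD, hD, hT p k i]; ring
  have h4 : ∑ i, ∑ k, B i k * ∑ l, b k l * D l p i = h p / 2 := by
    rw [← htr]
    refine Finset.sum_congr rfl fun i _ => ?_
    simp only [Finset.mul_sum, ← mul_assoc]
    rw [Finset.sum_comm]
    simp only [← Finset.sum_mul]
    have (l : ι) : ∑ k, B i k * b k l = (1 : Matrix ι ι ℝ) i l := by
      rw [← hBb, Matrix.mul_apply]
    simp only [this, Matrix.one_apply, ite_mul, one_mul, zero_mul, Finset.sum_ite_eq,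
      Finset.mem_univ, if_true]
    exact hDs i p i
  have h5 : ∑ i, ∑ k, B i k * ∑ l, b i l * D l p k = h p / 2 := by
    rw [← h4, Finset.sum_comm]
    exact Finset.sum_congr rfl fun i _ => Finset.sum_congr rfl fun k _ => by rw [hB.apply]
  -- Each of the two terms of `h3` contributes the trace D^j_{jp} = ½ h_p.
  have h6 : ∑ i, ∑ k, B i k * T p i k = h p := by
    simp only [h3, mul_add, Finset.sum_add_distrib, h4, h5]
    ring
  rw [h1]
  have h7 : ∑ i, ∑ k, B i k * ((1 / 2) * (T i k p + T k i p - T p i k))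
      = (1 / 2) * (∑ i, ∑ k, B i k * T i k p + ∑ i, ∑ k, B i k * T k i p
        - ∑ i, ∑ k, B i k * T p i k) := by
    simp only [Finset.mul_sum, ← Finset.sum_add_distrib, ← Finset.sum_sub_distrib]
    exact Finset.sum_congr rfl fun i _ => Finset.sum_congr rfl fun k _ => by ring
  have h8 : ∑ i, ∑ k, B i k * (T i p k - T p i k)
      = ∑ i, ∑ k, B i k * T i k p - ∑ i, ∑ k, B i k * T p i k := by
    simp only [← Finset.sum_sub_distrib]
    exact Finset.sum_congr rfl fun i _ => Finset.sum_congr rfl fun k _ => by rw [hT i p k]; ring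
  rw [h7, h8, h2, h6]
  ring

/-- The trace of a bilinear form with respect to a metric does not depend on the basis. -/
theorem sum_inv_mul_congr {G H P M : Matrix ι ι ℝ} (hG : G = Pᵀ * H * P) (h0 : G.det ≠ 0) :
    ∑ i, ∑ k, G⁻¹ i k * (Pᵀ * M * P) i k = ∑ i, ∑ k, H⁻¹ i k * M i k := by
  have hP : P.det ≠ 0 := fun h => h0 (by rw [hG, Matrix.det_mul, h, mul_zero])
  have hPu : IsUnit P.det := hP.isUnit
  have hPt : IsUnit Pᵀ.det := by rwa [Matrix.det_transpose]
  have key (G M : Matrix ι ι ℝ) : ∑ i, ∑ k, G⁻¹ i k * M i k = (G⁻¹ * Mᵀ).trace := by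
    simp [Matrix.trace, Matrix.mul_apply]
  rw [key, key, hG, Matrix.mul_inv_rev, Matrix.mul_inv_rev, Matrix.transpose_mul,
    Matrix.transpose_mul, Matrix.transpose_transpose]
  have : P⁻¹ * (H⁻¹ * Pᵀ⁻¹) * (Pᵀ * (Mᵀ * P)) = P⁻¹ * (H⁻¹ * Mᵀ * P) := by
    rw [← mul_assoc (P⁻¹ * (H⁻¹ * Pᵀ⁻¹)), mul_assoc P⁻¹, mul_assoc H⁻¹, Matrix.nonsing_inv_mul _ hPt,
      mul_one, mul_assoc, mul_assoc]
  rw [this, Matrix.trace_mul_comm, mul_assoc, Matrix.mul_nonsing_inv _ hPu, mul_one]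

end TraceAlgebra

/-! ### The covariant derivative of one metric for the connection of another. -/

section Components

variable {d : ℕ} {b m : E d → Matrix (Fin d) (Fin d) ℝ} {y : E d}

/-- The components `∇_i b_{jk}` of the covariant derivative of `b` for the Levi-Civita connection
of `m`. -/
def covDerivComp (b m : E d → Matrix (Fin d) (Fin d) ℝ) (i j k : Fin d) (y : E d) : ℝ :=
  pd i (fun z => b z j k) y
    - ∑ l, (christoffelOf m l i j y * b y l k + christoffelOf m l i k y * b y j l)

theorem covDerivComp_comm (hb : ∀ᶠ z in nhds y, (b z).IsSymm) (i j k : Fin d) :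
    covDerivComp b m i j k y = covDerivComp b m i k j y := by
  have h1 : (fun z => b z j k) =ᶠ[nhds y] fun z => b z k j := hb.mono fun z hz => hz.apply k j
  have hs := hb.self_of_nhds
  rw [covDerivComp, covDerivComp, pd, pd, h1.fderiv_eq]
  congr 1
  refine Finset.sum_congr rfl fun l _ => ?_
  rw [hs.apply l k, hs.apply l j, add_comm]

/-- In the Koszul formula for b the partial derivatives are replaced by covariant ones for m. By the
symmetry of Γ^m the corrections add up to the lowered Γ^m, which is subtracted on the left. -/
theorem sum_mul_christoffelDiff (hb : ∀ᶠ z in nhds y, (b z).IsSymm) (hb0 : (b y).det ≠ 0)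
    (hm : ∀ᶠ z in nhds y, (m z).IsSymm) (p i k : Fin d) :
    ∑ l, b y p l * christoffelDiff b m l i k y = (1 / 2) *
      (covDerivComp b m i k p y + covDerivComp b m k i p y - covDerivComp b m p i k y) := by
  have hs := hb.self_of_nhds
  have e (j k : Fin d) : (fun z => b z j k) =ᶠ[nhds y] fun z => b z k j :=
    hb.mono fun z hz => hz.apply k j
  have h1 : pd i (fun z => b z k p) y = pd i (fun z => b z p k) y := by
    rw [pd, pd, (e k p).fderiv_eq]
  have h2 : pd k (fun z => b z i p) y = pd k (fun z => b z p i) y := by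
    rw [pd, pd, (e i p).fderiv_eq]
  have h3 : ∑ l, b y p l * christoffelDiff b m l i k y
      = ∑ l, b y p l * christoffelOf b l i k y - ∑ l, b y p l * christoffelOf m l i k y := by
    simp only [christoffelDiff, mul_sub, Finset.sum_sub_distrib]
  have h4 : 2 * ∑ l, b y p l * christoffelOf m l i k y
      = ∑ l, (christoffelOf m l i k y * b y l p + christoffelOf m l i p y * b y k l)
        + ∑ l, (christoffelOf m l k i y * b y l p + christoffelOf m l k p y * b y i l)
        - ∑ l, (christoffelOf m l p i y * b y l k + christoffelOf m l p k y * b y i l) := by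
    rw [Finset.mul_sum, ← Finset.sum_add_distrib, ← Finset.sum_sub_distrib]
    refine Finset.sum_congr rfl fun l _ => ?_
    rw [christoffelOf_comm hm l k i, christoffelOf_comm hm l p i, christoffelOf_comm hm l p k,
      hs.apply l p, hs.apply l k]
    ring
  rw [h3, sum_mul_christoffelOf hb0, covDerivComp, covDerivComp, covDerivComp, h1, h2]
  linarith

/-- Only the antisymmetrisation of ∇b enters, so by Codazzi the form is a trace of the ambient
curvature; this identifies α. -/
theorem traceForm_eq {h : E d → ℝ} (hb : ∀ᶠ z in nhds y, (b z).IsSymm) (hb0 : (b y).det ≠ 0)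
    (hm : ∀ᶠ z in nhds y, (m z).IsSymm)
    (htr : ∀ k, ∑ j, christoffelDiff b m j j k y = pd k h y / 2) (p : Fin d) :
    traceForm b m h p y
      = ∑ i, ∑ k, (b y)⁻¹ i k * (covDerivComp b m i p k y - covDerivComp b m p i k y) := by
  have hs := hb.self_of_nhds
  have hBs : ((b y)⁻¹).IsSymm := by
    rw [Matrix.IsSymm, Matrix.transpose_nonsing_inv, hs]
  exact sum_trace_connection (Matrix.nonsing_inv_mul _ hb0.isUnit) hBs
    (fun i j k => covDerivComp b m i j k y) (fun l i k => christoffelDiff b m l i k y)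
    (fun k => pd k h y) (fun i j k => covDerivComp_comm hb i j k)
    (fun l i k => by
      rw [christoffelDiff, christoffelDiff, christoffelOf_comm hb, christoffelOf_comm hm])
    (sum_mul_christoffelDiff hb hb0 hm) htr p

theorem contDiffAt_covDerivComp (hb : ∀ i j, ContDiffAt ℝ ∞ (fun z => b z i j) y)
    (hm : ∀ i j, ContDiffAt ℝ ∞ (fun z => m z i j) y) (hm0 : (m y).det ≠ 0) (i j k : Fin d) :
    ContDiffAt ℝ ∞ (covDerivComp b m i j k) y :=
  (contDiffAt_pd (hb j k) (by simp) i).sub (ContDiffAt.sum fun l _ =>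
    ((contDiffAt_christoffelOf hm hm0 (by simp) l i j).mul (hb l k)).add
      ((contDiffAt_christoffelOf hm hm0 (by simp) l i k).mul (hb j l)))

/-- The antisymmetrised covariant derivative as a trilinear form. -/
def codazziForm (b m : E d → Matrix (Fin d) (Fin d) ℝ) (y u v w : E d) : ℝ :=
  (fderiv ℝ (fun z => bil (b z)) y u v w - bil (b y) v (christoffelBil m y u w))
    - (fderiv ℝ (fun z => bil (b z)) y v u w - bil (b y) u (christoffelBil m y v w))

/-- The correction Γ^l_{ij} b_{lk} is absent from `codazziForm` because, being symmetric in i and j,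
it drops out of the antisymmetrised derivative. -/
theorem codazziForm_single (hb : ∀ i j, DifferentiableAt ℝ (fun z => b z i j) y)
    (hm : ∀ᶠ z in nhds y, (m z).IsSymm) (i j k : Fin d) :
    codazziForm b m y (EuclideanSpace.single i 1) (EuclideanSpace.single j 1)
      (EuclideanSpace.single k 1) = covDerivComp b m i j k y - covDerivComp b m j i k y := by
  have h1 (i j k : Fin d) : bil (b y) (EuclideanSpace.single j 1)
      (christoffelBil m y (EuclideanSpace.single i 1) (EuclideanSpace.single k 1))
      = ∑ l, christoffelOf m l i k y * b y j l := by
    rw [← sum_smul_single (christoffelBil m y _ _), map_sum]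
    simp only [map_smul, smul_eq_mul, bil_single, christoffelBil, bilVec_single]
  have h2 : ∑ l, christoffelOf m l j i y * b y l k = ∑ l, christoffelOf m l i j y * b y l k :=
    Finset.sum_congr rfl fun l _ => by rw [christoffelOf_comm hm]
  simp only [codazziForm, h1, fderiv_bil hb, bil_single, Matrix.of_apply, covDerivComp,
    Finset.sum_add_distrib, h2, pd]
  ring

/-- `codazziForm` is bilinear in its outer arguments. -/
theorem exists_codazziForm_eq_bil (b m : E d → Matrix (Fin d) (Fin d) ℝ) (y v : E d) :
    ∃ β : E d →L[ℝ] E d →L[ℝ] ℝ, ∀ u w, codazziForm b m y u v w = β u w :=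
  ⟨((fderiv ℝ (fun z => bil (b z)) y).flip v
      - ContinuousLinearMap.compL ℝ (E d) (E d) ℝ (bil (b y) v) ∘L christoffelBil m y)
    - (fderiv ℝ (fun z => bil (b z)) y v
      - (ContinuousLinearMap.compL ℝ (E d) (E d) ℝ).flip (christoffelBil m y v) ∘L bil (b y)),
    fun _ _ => rfl⟩

/-- `codazziForm` is linear in its middle argument. -/
theorem exists_codazziForm_eq_linear (b m : E d → Matrix (Fin d) (Fin d) ℝ) (y u w : E d) :
    ∃ β : E d →L[ℝ] ℝ, ∀ v, codazziForm b m y u v w = β v :=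
  ⟨((fderiv ℝ (fun z => bil (b z)) y u).flip w - (bil (b y)).flip (christoffelBil m y u w))
    - (((fderiv ℝ (fun z => bil (b z)) y).flip u).flip w
      - bil (b y) u ∘L (christoffelBil m y).flip w), fun _ => rfl⟩

end Components

theorem transpose_mul_mul_apply {d : ℕ} (β : E d →L[ℝ] E d →L[ℝ] ℝ) (U : Fin d → E d)
    (i k : Fin d) :
    ((Matrix.of fun r i => U i r)ᵀ *
        (Matrix.of fun a c => β (EuclideanSpace.single a 1) (EuclideanSpace.single c 1)) *
        (Matrix.of fun r i => U i r)) i k = β (U i) (U k) := by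
  conv_rhs => rw [← sum_smul_single (U i), ← sum_smul_single (U k)]
  simp only [Matrix.mul_apply, Matrix.transpose_apply, Matrix.of_apply, map_sum, map_smul,
    sum_apply, smul_apply, smul_eq_mul, Finset.sum_mul, Finset.mul_sum]
  exact Finset.sum_congr rfl fun a _ => Finset.sum_congr rfl fun c _ => by ring

/-! ### The 1-form α. -/

section Hypersurface

variable {n : ℕ} {S M : Type*} [TopologicalSpace S] [ChartedSpace (E n) S]
  [IsManifold (𝓡 n) ∞ S] [TopologicalSpace M] [ChartedSpace (E (n + 1)) M]
  [IsManifold (𝓡 (n + 1)) ∞ M] {g : FormField (n + 1) M} {f : S → M}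
  {N : ∀ x, TangentSpace (𝓡 (n + 1)) (f x)}

theorem curvNormal_eq_codazziForm (hg : IsSmoothMetric g) (hf : IsSmoothImmersion n (n + 1) f)
    (hN : IsUnitNormal (n := n) g f N) (hconv : IsLocallyStrictlyConvex (n := n) g f N)
    {c q : S} (hq : q ∈ (extChartAt (𝓡 n) c).source) (u v w : TangentSpace (𝓡 n) q) :
    curvNormal g f N q u v w
      = codazziForm (metricComp (shapeMetric (n := n) g f N) c)
          (metricComp (pullback (n := n) g f) c) (extChartAt (𝓡 n) c q)
          (coords c q u) (coords c q v) (coords c q w) := by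
  obtain ⟨y, hy, rfl⟩ : ∃ y ∈ (extChartAt (𝓡 n) c).target, (extChartAt (𝓡 n) c).symm y = q :=
    ⟨_, (extChartAt (𝓡 n) c).map_source hq, (extChartAt (𝓡 n) c).left_inv hq⟩
  rw [(extChartAt (𝓡 n) c).right_inv hy, codazziForm,
    codazzi_metricComp hg hf hN hconv hy, inverse_coords hq, inverse_coords hq, inverse_coords hq]

/-- The `1`-form `B^{ik} R̄_{i · ν k} / (n (n - 1))`. -/
def curvForm (g : FormField (n + 1) M) (f : S → M) (N : ∀ x, TangentSpace (𝓡 (n + 1)) (f x))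
    (x : S) : TangentSpace (𝓡 n) x →L[ℝ] ℝ :=
  ∑ p, ((1 / ((n : ℝ) * ((n : ℝ) - 1))) *
    ∑ i, ∑ k, (gram (shapeMetric (n := n) g f N) x x)⁻¹ i k *
      curvNormal g f N x (coordVec x x i) (coordVec x x p) (coordVec x x k)) •
    (EuclideanSpace.proj p ∘L coords x x)

theorem coords_coordVec {c q : S} (hq : q ∈ (extChartAt (𝓡 n) c).source) (i : Fin n) :
    coords c q (coordVec c q i) = EuclideanSpace.single i 1 :=
  coords_inverse hq _

/-- The form is defined at each point in the chart centred there. A metric trace does not depend on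
the basis, so the same formula holds in every chart around the point; without this it could not be
differentiated. -/
theorem curvForm_coordVec (hg : IsSmoothMetric g) (hf : IsSmoothImmersion n (n + 1) f)
    (hN : IsUnitNormal (n := n) g f N) (hconv : IsLocallyStrictlyConvex (n := n) g f N)
    {c q : S} (hq : q ∈ (extChartAt (𝓡 n) c).source) (p : Fin n) :
    curvForm g f N q (coordVec c q p) = (1 / ((n : ℝ) * ((n : ℝ) - 1))) *
      ∑ i, ∑ k, (gram (shapeMetric (n := n) g f N) c q)⁻¹ i k *
        curvNormal g f N q (coordVec c q i) (coordVec c q p) (coordVec c q k) := by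
  have hb := isSmoothMetric_shapeMetric hg hf hN hconv
  have hq' := mem_extChartAt_source (I := 𝓡 n) q
  set U : Fin n → E n := fun i => coords q q (coordVec c q i) with hU
  obtain ⟨β, hβ⟩ := exists_codazziForm_eq_bil (metricComp (shapeMetric (n := n) g f N) q)
    (metricComp (pullback (n := n) g f) q) (extChartAt (𝓡 n) q q) (U p)
  have hG : gram (shapeMetric (n := n) g f N) c q = (Matrix.of fun r i => U i r)ᵀ *
      gram (shapeMetric (n := n) g f N) q q * (Matrix.of fun r i => U i r) := by
    ext i k
    have h := transpose_mul_mul_apply (bil (gram (shapeMetric (n := n) g f N) q q)) U i k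
    simp only [bil_single] at h
    rw [hU] at h
    simp only [bil_gram_coords _ hq'] at h
    exact h.symm
  have key := sum_inv_mul_congr (M := Matrix.of fun a c =>
    β (EuclideanSpace.single a 1) (EuclideanSpace.single c 1)) hG
    (det_gram_ne_zero hb.symm (hb.pos q) hq)
  simp only [transpose_mul_mul_apply] at key
  simp only [← hβ, Matrix.of_apply] at key
  have hU' (i : Fin n) : coords q q (coordVec c q i) = U i := rfl
  simp only [curvNormal_eq_codazziForm hg hf hN hconv hq', hU']
  have hproj (r : Fin n) (u : E n) : (EuclideanSpace.proj r : E n →L[ℝ] ℝ) u = u r := rfl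
  rw [key, curvForm]
  simp only [sum_apply, smul_apply, ContinuousLinearMap.comp_apply, smul_eq_mul,
    hproj, curvNormal_eq_codazziForm hg hf hN hconv hq', coords_coordVec hq', hU']
  simp only [Finset.mul_sum, Finset.sum_mul]
  rw [Finset.sum_comm]
  refine Finset.sum_congr rfl fun i _ => ?_
  rw [Finset.sum_comm]
  refine Finset.sum_congr rfl fun k _ => ?_
  obtain ⟨γ, hγ⟩ := exists_codazziForm_eq_linear (metricComp (shapeMetric (n := n) g f N) q)
    (metricComp (pullback (n := n) g f) q) (extChartAt (𝓡 n) q q) (EuclideanSpace.single i 1)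
    (EuclideanSpace.single k 1)
  simp only [hγ]
  conv_rhs => rw [← sum_smul_single (U p), map_sum, Finset.mul_sum, Finset.mul_sum]
  simp only [map_smul, smul_eq_mul]
  refine Finset.sum_congr rfl fun r _ => ?_
  ring

theorem curvForm_coordVec_eq (hg : IsSmoothMetric g) (hf : IsSmoothImmersion n (n + 1) f)
    (hN : IsUnitNormal (n := n) g f N) (hconv : IsLocallyStrictlyConvex (n := n) g f N)
    {c q : S} (hq : q ∈ (extChartAt (𝓡 n) c).source) (p : Fin n) :
    curvForm g f N q (coordVec c q p) = (1 / ((n : ℝ) * ((n : ℝ) - 1))) *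
      ∑ i, ∑ k, (metricComp (shapeMetric (n := n) g f N) c (extChartAt (𝓡 n) c q))⁻¹ i k *
        (covDerivComp (metricComp (shapeMetric (n := n) g f N) c)
            (metricComp (pullback (n := n) g f) c) i p k (extChartAt (𝓡 n) c q)
          - covDerivComp (metricComp (shapeMetric (n := n) g f N) c)
            (metricComp (pullback (n := n) g f) c) p i k (extChartAt (𝓡 n) c q)) := by
  have hb := isSmoothMetric_shapeMetric hg hf hN hconv
  have hm := isSmoothMetric_pullback hg hf
  have hy := (extChartAt (𝓡 n) c).map_source hq
  rw [curvForm_coordVec hg hf hN hconv hq]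
  simp only [curvNormal_eq_codazziForm hg hf hN hconv hq, coords_coordVec hq]
  simp only [codazziForm_single
    (fun i j => (hb.contDiffAt c hy i j).differentiableAt (by simp))
    (Filter.Eventually.of_forall fun z => hm.isSymm_metricComp c z)]
  rw [metricComp, (extChartAt (𝓡 n) c).left_inv hq]

/-- In a fixed chart the components are built from the inverse of g^A and from covariant derivatives
of g^A, which are smooth functions of the coordinates. -/
theorem isSmoothOneForm_curvForm (hg : IsSmoothMetric g) (hf : IsSmoothImmersion n (n + 1) f)
    (hN : IsUnitNormal (n := n) g f N) (hconv : IsLocallyStrictlyConvex (n := n) g f N) :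
    IsSmoothOneForm (curvForm (n := n) g f N) := by
  have hb := isSmoothMetric_shapeMetric hg hf hN hconv
  have hm := isSmoothMetric_pullback hg hf
  intro x
  rw [contMDiffAt_hom_bundle]
  refine ⟨contMDiffAt_id, ?_⟩
  have hx := mem_extChartAt_source (I := 𝓡 n) x
  have hy := mem_extChartAt_target (I := 𝓡 n) x
  have hA (p : Fin n) : ContMDiffAt (𝓡 n) 𝓘(ℝ, ℝ) ∞
      (fun q => curvForm g f N q (coordVec x q p)) x := by
    have h1 : ContDiffAt ℝ ∞ (fun y => (1 / ((n : ℝ) * ((n : ℝ) - 1))) *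
        ∑ i, ∑ k, (metricComp (shapeMetric (n := n) g f N) x y)⁻¹ i k *
        (covDerivComp (metricComp (shapeMetric (n := n) g f N) x)
            (metricComp (pullback (n := n) g f) x) i p k y
          - covDerivComp (metricComp (shapeMetric (n := n) g f N) x)
            (metricComp (pullback (n := n) g f) x) p i k y)) (extChartAt (𝓡 n) x x) :=
      contDiffAt_const.mul (ContDiffAt.sum fun i _ => ContDiffAt.sum fun k _ =>
        (contDiffAt_inv_apply (hb.contDiffAt x hy) (hb.det_metricComp_ne_zero hy) i k).mul
          ((contDiffAt_covDerivComp (hb.contDiffAt x hy) (hm.contDiffAt x hy)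
            (hm.det_metricComp_ne_zero hy) i p k).sub
          (contDiffAt_covDerivComp (hb.contDiffAt x hy) (hm.contDiffAt x hy)
            (hm.det_metricComp_ne_zero hy) p i k)))
    refine (h1.contMDiffAt.comp x contMDiffAt_extChartAt).congr_of_eventuallyEq ?_
    filter_upwards [extChartAt_source_mem_nhds (I := 𝓡 n) x] with q hq
    exact curvForm_coordVec_eq hg hf hN hconv hq p
  have hsum : ContMDiffAt (𝓡 n) 𝓘(ℝ, E n →L[ℝ] ℝ) ∞ (fun q => ∑ p,
      curvForm g f N q (coordVec x q p) • (EuclideanSpace.proj p : E n →L[ℝ] ℝ)) x :=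
    ContMDiffAt.sum fun p _ => (hA p).smul contMDiffAt_const
  refine hsum.congr_of_eventuallyEq ?_
  filter_upwards [extChartAt_source_mem_nhds (I := 𝓡 n) x] with q hq
  ext v
  simp only [ContinuousLinearMap.inCoordinates, ContinuousLinearMap.comp_apply]
  rw [← coords_inverse_eq_symmL hq, inverse_eq_sum_smul_coordVec]
  simp [mul_comm]

end Hypersurface

/-! ### Assembling the inequality. -/

section Hypersurface

variable {n : ℕ} {S M : Type*} [TopologicalSpace S] [ChartedSpace (E n) S]
  [IsManifold (𝓡 n) ∞ S] [TopologicalSpace M] [ChartedSpace (E (n + 1)) M]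
  [IsManifold (𝓡 (n + 1)) ∞ M] {g : FormField (n + 1) M} {f : S → M}
  {N : ∀ x, TangentSpace (𝓡 (n + 1)) (f x)} {h : M → ℝ}

theorem metricComp_extChartAt {d : ℕ} {X : Type*} [TopologicalSpace X] [ChartedSpace (E d) X]
    (g : FormField d X) (x : X) : metricComp g x (extChartAt (𝓡 d) x x) = gram g x x := by
  rw [metricComp, extChartAt_to_inv]

theorem contMDiff_potential (hf : IsSmoothImmersion n (n + 1) f)
    (hh : ContMDiff (𝓡 (n + 1)) 𝓘(ℝ, ℝ) ∞ h) :
    ContMDiff (𝓡 n) 𝓘(ℝ, ℝ) ∞ (fun z => h (f z)) :=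
  hh.comp hf.contMDiff

theorem contDiffAt_potential (hf : IsSmoothImmersion n (n + 1) f)
    (hh : ContMDiff (𝓡 (n + 1)) 𝓘(ℝ, ℝ) ∞ h) {c : S} {y : E n}
    (hy : y ∈ (extChartAt (𝓡 n) c).target) :
    ContDiffAt ℝ ∞ (fun z => h (f ((extChartAt (𝓡 n) c).symm z))) y :=
  ((contMDiff_potential hf hh).contMDiffAt.comp y (contMDiffAt_extChartAt_symm hy)).contDiffAt

/-- The trace of the difference of the Levi-Civita connections of `g^A` and `g`. -/
theorem sum_christoffelDiff_eq (hg : IsSmoothMetric g) (hf : IsSmoothImmersion n (n + 1) f)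
    (hN : IsUnitNormal (n := n) g f N) (hconv : IsLocallyStrictlyConvex (n := n) g f N)
    (hh : ContMDiff (𝓡 (n + 1)) 𝓘(ℝ, ℝ) ∞ h)
    (hdet : ∀ x : S, LinearMap.det (shapeOperator (n := n) g f N x) = Real.exp (h (f x)))
    {c : S} {y : E n} (hy : y ∈ (extChartAt (𝓡 n) c).target) (k : Fin n) :
    ∑ j, christoffelDiff (metricComp (shapeMetric (n := n) g f N) c)
        (metricComp (pullback (n := n) g f) c) j j k y
      = pd k (fun z => h (f ((extChartAt (𝓡 n) c).symm z))) y / 2 := by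
  have hb := isSmoothMetric_shapeMetric hg hf hN hconv
  have hm := isSmoothMetric_pullback hg hf
  refine sum_christoffelOf_sub (fun i j => (hm.contDiffAt c hy i j).differentiableAt (by simp))
    (Filter.Eventually.of_forall fun z => hm.isSymm_metricComp c z) (hm.det_metricComp_ne_zero hy)
    (fun i j => (hb.contDiffAt c hy i j).differentiableAt (by simp))
    (Filter.Eventually.of_forall fun z => hb.isSymm_metricComp c z)
    ((contDiffAt_potential hf hh hy).differentiableAt (by simp)) ?_ k
  filter_upwards [extChartAt_target_mem_nhds' hy] with z hz
  rw [metricComp, det_gram_shapeMetric g f N ((extChartAt (𝓡 n) c).map_target hz), hdet]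
  rfl

theorem curvForm_coordVec_eq_traceForm (hg : IsSmoothMetric g)
    (hf : IsSmoothImmersion n (n + 1) f)
    (hN : IsUnitNormal (n := n) g f N) (hconv : IsLocallyStrictlyConvex (n := n) g f N)
    (hh : ContMDiff (𝓡 (n + 1)) 𝓘(ℝ, ℝ) ∞ h)
    (hdet : ∀ x : S, LinearMap.det (shapeOperator (n := n) g f N x) = Real.exp (h (f x)))
    {c q : S} (hq : q ∈ (extChartAt (𝓡 n) c).source) (p : Fin n) :
    curvForm g f N q (coordVec c q p) = (1 / ((n : ℝ) * ((n : ℝ) - 1))) *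
      traceForm (metricComp (shapeMetric (n := n) g f N) c) (metricComp (pullback (n := n) g f) c)
        (fun z => h (f ((extChartAt (𝓡 n) c).symm z))) p (extChartAt (𝓡 n) c q) := by
  have hb := isSmoothMetric_shapeMetric hg hf hN hconv
  have hm := isSmoothMetric_pullback hg hf
  have hy := (extChartAt (𝓡 n) c).map_source hq
  rw [curvForm_coordVec_eq hg hf hN hconv hq, traceForm_eq
    (Filter.Eventually.of_forall fun z => hb.isSymm_metricComp c z) (hb.det_metricComp_ne_zero hy)
    (Filter.Eventually.of_forall fun z => hm.isSymm_metricComp c z)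
    (sum_christoffelDiff_eq hg hf hN hconv hh hdet hy)]

theorem divergence_curvForm (hg : IsSmoothMetric g)
    (hf : IsSmoothImmersion n (n + 1) f)
    (hN : IsUnitNormal (n := n) g f N) (hconv : IsLocallyStrictlyConvex (n := n) g f N)
    (hh : ContMDiff (𝓡 (n + 1)) 𝓘(ℝ, ℝ) ∞ h)
    (hdet : ∀ x : S, LinearMap.det (shapeOperator (n := n) g f N x) = Real.exp (h (f x)))
    (x : S) {b m : E n → Matrix (Fin n) (Fin n) ℝ} {y : E n} {ψ : E n → ℝ}
    (hbx : b = metricComp (shapeMetric (n := n) g f N) x)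
    (hmx : m = metricComp (pullback (n := n) g f) x) (hyx : y = extChartAt (𝓡 n) x x)
    (hψ : ψ = fun z => h (f ((extChartAt (𝓡 n) x).symm z))) :
    divergence (shapeMetric (n := n) g f N) (curvForm g f N) x
      = (1 / ((n : ℝ) * ((n : ℝ) - 1))) * ∑ i, ∑ j, (b y)⁻¹ i j * (pd j (traceForm b m ψ i) y
          - ∑ k, christoffelOf b k i j y * traceForm b m ψ k y) := by
  have hx := mem_extChartAt_source (I := 𝓡 n) x
  have hpd (i j : Fin n) : pd j (fun z => curvForm g f N ((extChartAt (𝓡 n) x).symm z)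
      (coordVec x ((extChartAt (𝓡 n) x).symm z) i)) y
      = (1 / ((n : ℝ) * ((n : ℝ) - 1))) * pd j (traceForm b m ψ i) y := by
    -- The identification with `traceForm` holds on a whole neighbourhood in the chart at x, so it
    -- survives differentiation.
    have hev : (fun z => curvForm g f N ((extChartAt (𝓡 n) x).symm z)
        (coordVec x ((extChartAt (𝓡 n) x).symm z) i)) =ᶠ[nhds y]
        fun z => (1 / ((n : ℝ) * ((n : ℝ) - 1))) • traceForm b m ψ i z := by
      rw [hyx]
      filter_upwards [extChartAt_target_mem_nhds (I := 𝓡 n) x] with z hz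
      rw [curvForm_coordVec_eq_traceForm hg hf hN hconv hh hdet
        ((extChartAt (𝓡 n) x).map_target hz), (extChartAt (𝓡 n) x).right_inv hz, hbx, hmx, hψ,
        smul_eq_mul]
    have hc := congrFun (fderiv_const_smul_field (𝕜 := ℝ) (f := traceForm b m ψ i)
      (1 / ((n : ℝ) * ((n : ℝ) - 1)))) y
    rw [pd, hev.fderiv_eq]
    exact DFunLike.congr_fun hc _
  rw [divergence, Finset.mul_sum]
  refine Finset.sum_congr rfl fun i _ => ?_
  rw [Finset.mul_sum]
  refine Finset.sum_congr rfl fun j _ => ?_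
  rw [← hyx, hpd]
  simp only [curvForm_coordVec_eq_traceForm hg hf hN hconv hh hdet hx]
  rw [← hbx, ← hmx, ← hyx, ← hψ, ← metricComp_extChartAt, ← hyx, ← hbx]
  have hs : ∑ k, christoffel (shapeMetric (n := n) g f N) x k i j y *
      (1 / ((n : ℝ) * ((n : ℝ) - 1)) * traceForm b m ψ k y)
      = 1 / ((n : ℝ) * ((n : ℝ) - 1)) * ∑ k, christoffelOf b k i j y * traceForm b m ψ k y := by
    rw [Finset.mul_sum, hbx]
    refine Finset.sum_congr rfl fun k _ => ?_
    rw [christoffelOf, christoffel]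
    ring
  rw [hs]
  ring

theorem traceRicci_eq {d : ℕ} {X : Type*} [TopologicalSpace X] [ChartedSpace (E d) X]
    (γ g : FormField d X) (x : X) :
    traceRicci γ g x = -(1 / ((d : ℝ) - 1)) *
      ∑ i, ∑ k, (metricComp γ x (extChartAt (𝓡 d) x x))⁻¹ i k *
        ricciOf (metricComp g x) (extChartAt (𝓡 d) x x) i k := by
  rw [traceRicci, Finset.mul_sum, metricComp_extChartAt]
  refine Finset.sum_congr rfl fun i _ => ?_
  rw [Finset.mul_sum]
  refine Finset.sum_congr rfl fun k _ => ?_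
  have h : ∑ j, riemannComp g x i j k j (extChartAt (𝓡 d) x x)
      = ricciOf (metricComp g x) (extChartAt (𝓡 d) x x) i k := by
    rfl
  rw [ricci, Matrix.of_apply, h]
  ring

-- The positive square root is symmetric, hence serves as P.
open scoped MatrixOrder in
theorem exists_eq_mul_transpose {ι : Type*} [Fintype ι] [DecidableEq ι] {B : Matrix ι ι ℝ}
    (hB : B.PosSemidef) : ∃ P : Matrix ι ι ℝ, B = P * Pᵀ := by
  refine ⟨CFC.sqrt B, ?_⟩
  have h : (CFC.sqrt B)ᵀ = CFC.sqrt B := by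
    rw [← Matrix.conjTranspose_eq_transpose_of_trivial]
    exact (Matrix.nonneg_iff_posSemidef.1 (CFC.sqrt_nonneg B)).1
  rw [h, CFC.sqrt_mul_sqrt_self B hB.nonneg]

/-- Normalisation: the factors −1/(n−1) in Ric and 1/n in Scal turn the traced identity, whose terms
are `RM`, `RB`, `DV`, `DD`, `VH`, into one with the overall factor 1/(n(n−1)). The sign in Ric makes
`DD - VH` a lower bound for Scal^A. -/
theorem scal_inequality_of_trace {n lam RM RB DV DD VH H₁ H₃ : ℝ} (hn : 2 ≤ n)
    (hid : RM = RB + DV + DD - VH)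
    (hineq : -((1 + lam) / 4) * H₁ - (1 + n * lam⁻¹) / 4 * H₃ ≤ DD - VH) :
    1 / n * (-(1 / (n - 1)) * RB) ≥ 1 / n * (-(1 / (n - 1)) * RM) + 1 / (n * (n - 1)) * DV
      - (1 + lam) / (4 * n * (n - 1)) * H₁ - (1 + n * lam⁻¹) / (4 * n * (n - 1)) * H₃ := by
  have h0 : n ≠ 0 := by linarith
  have h1 : n - 1 ≠ 0 := by linarith
  have hκ : 0 ≤ 1 / (n * (n - 1)) := by
    have : 0 < n * (n - 1) := mul_pos (by linarith) (by linarith)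
    positivity
  have hX : 0 ≤ DD - VH + (1 + lam) / 4 * H₁ + (1 + n * lam⁻¹) / 4 * H₃ := by linarith
  have e : 1 / n * (-(1 / (n - 1)) * RB) - (1 / n * (-(1 / (n - 1)) * RM) + 1 / (n * (n - 1)) * DV
      - (1 + lam) / (4 * n * (n - 1)) * H₁ - (1 + n * lam⁻¹) / (4 * n * (n - 1)) * H₃)
      = 1 / (n * (n - 1)) * (DD - VH + (1 + lam) / 4 * H₁ + (1 + n * lam⁻¹) / 4 * H₃) := by
    rw [hid]
    generalize lam⁻¹ = μ
    field_simp
    ring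
  have := mul_nonneg hκ hX
  linarith

theorem scal_shapeMetric_ge (hn : 2 ≤ n) (hg : IsSmoothMetric g)
    (hf : IsSmoothImmersion n (n + 1) f)
    (hN : IsUnitNormal (n := n) g f N) (hconv : IsLocallyStrictlyConvex (n := n) g f N)
    (hh : ContMDiff (𝓡 (n + 1)) 𝓘(ℝ, ℝ) ∞ h)
    (hdet : ∀ x : S, LinearMap.det (shapeOperator (n := n) g f N x) = Real.exp (h (f x)))
    {lam : ℝ} (hlam : 0 < lam) (x : S) :
    scal (shapeMetric (n := n) g f N) x ≥
      (1 / (n : ℝ)) * traceRicci (shapeMetric (n := n) g f N) (pullback (n := n) g f) x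
      + divergence (shapeMetric (n := n) g f N) (curvForm g f N) x
      - (1 + lam) / (4 * (n : ℝ) * ((n : ℝ) - 1)) *
          normSq₁ (shapeMetric (n := n) g f N) x
            (fun v => mvfderiv (𝓡 n) (fun z => h (f z)) x v)
      - (1 + (n : ℝ) * lam⁻¹) / (4 * (n : ℝ) * ((n : ℝ) - 1)) *
          normSq₃ (shapeMetric (n := n) g f N) x (curvNormal (n := n) g f N x) := by
  have hb := isSmoothMetric_shapeMetric hg hf hN hconv
  have hm := isSmoothMetric_pullback hg hf
  have hx := mem_extChartAt_source (I := 𝓡 n) x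
  have hy := mem_extChartAt_target (I := 𝓡 n) x
  rw [scal, traceRicci_eq, traceRicci_eq, divergence_curvForm hg hf hN hconv hh hdet x rfl rfl rfl rfl]
  set b := metricComp (shapeMetric (n := n) g f N) x with hbdef
  set m := metricComp (pullback (n := n) g f) x with hmdef
  set y := extChartAt (𝓡 n) x x with hydef
  set ψ : E n → ℝ := fun z => h (f ((extChartAt (𝓡 n) x).symm z)) with hψ
  have hbs : ∀ᶠ z in nhds y, (b z).IsSymm :=
    Filter.Eventually.of_forall fun z => hb.isSymm_metricComp x z
  have hms : ∀ᶠ z in nhds y, (m z).IsSymm :=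
    Filter.Eventually.of_forall fun z => hm.isSymm_metricComp x z
  have hb0 := hb.det_metricComp_ne_zero hy
  have hm0 := hm.det_metricComp_ne_zero hy
  have htr : ∀ᶠ z in nhds y, ∀ k, ∑ j, christoffelDiff b m j j k z = pd k ψ z / 2 := by
    filter_upwards [extChartAt_target_mem_nhds (I := 𝓡 n) x] with z hz
    exact sum_christoffelDiff_eq hg hf hN hconv hh hdet hz
  have key := sum_inv_mul_ricciOf (m := m) (b := b) (h := ψ) (y := y)
    (fun i j => (hm.contDiffAt x hy i j).of_le ENat.LEInfty.out) hm0
    (fun i j => (hb.contDiffAt x hy i j).of_le ENat.LEInfty.out) hbs hb0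
    ((contDiffAt_potential hf hh hy).of_le ENat.LEInfty.out) htr
  have hgram : gram (shapeMetric (n := n) g f N) x x = b y := (metricComp_extChartAt _ x).symm
  -- Strict convexity makes b, hence B, positive definite; a factorisation B = P Pᵀ supplies the
  -- b-orthonormal frame.
  have hpos : ((b y)⁻¹).PosDef := by
    rw [← hgram]
    exact (posDef_gram hb.symm (hb.pos x) hx).inv
  obtain ⟨P, hP⟩ := exists_eq_mul_transpose hpos.posSemidef
  have hineq := sum_connection_ge hP (Matrix.nonsing_inv_mul _ hb0.isUnit)
    (fun i j k => covDerivComp b m i j k y) (fun l i k => christoffelDiff b m l i k y)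
    (fun k => pd k ψ y) (fun i j k => covDerivComp_comm hbs i j k)
    (fun l i k => by
      rw [christoffelDiff, christoffelDiff, christoffelOf_comm hbs, christoffelOf_comm hms])
    (sum_mul_christoffelDiff hbs hb0 hms) htr.self_of_nhds hlam
  have h1 : normSq₁ (shapeMetric (n := n) g f N) x
      (fun v => mvfderiv (𝓡 n) (fun z => h (f z)) x v)
      = ∑ i, ∑ j, (b y)⁻¹ i j * pd i ψ y * pd j ψ y := by
    have hd (i : Fin n) : mvfderiv (𝓡 n) (fun z => h (f z)) x (coordVec x x i) = pd i ψ y := by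
      have := mvfderiv_inverse_coords hy (φ := fun z => h (f z))
        ((contMDiff_potential hf hh).mdifferentiable (by simp) _) (EuclideanSpace.single i 1)
      rw [extChartAt_to_inv] at this
      exact this
    simp only [normSq₁, hd, hgram]
  have h3 : normSq₃ (shapeMetric (n := n) g f N) x (curvNormal (n := n) g f N x)
      = ∑ i, ∑ j, ∑ k, ∑ p, ∑ q, ∑ r, (b y)⁻¹ i p * (b y)⁻¹ j q * (b y)⁻¹ k r *
        (covDerivComp b m i j k y - covDerivComp b m j i k y) *
        (covDerivComp b m p q r y - covDerivComp b m q p r y) := by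
    have hc (i j k : Fin n) : curvNormal (n := n) g f N x (coordVec x x i) (coordVec x x j)
        (coordVec x x k) = covDerivComp b m i j k y - covDerivComp b m j i k y := by
      rw [curvNormal_eq_codazziForm hg hf hN hconv hx, coords_coordVec hx, coords_coordVec hx,
        coords_coordVec hx]
      exact codazziForm_single
        (fun i j => (hb.contDiffAt x hy i j).differentiableAt (by simp)) hms i j k
    simp only [normSq₃, hc, hgram]
  rw [h1, h3]
  rw [Fintype.card_fin] at hineq
  exact scal_inequality_of_trace (by exact_mod_cast hn) key hineq

end Hypersurface

end RiemannianHypersurface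

end

theorem theorem5p6 (n : ℕ) (hn : 2 ≤ n)
    {M : Type*} [TopologicalSpace M] [ChartedSpace (EuclideanSpace ℝ (Fin (n + 1))) M]
    [IsManifold (𝓡 (n + 1)) ∞ M]
    (gbar : ContMDiffRiemannianMetric (𝓡 (n + 1)) ∞ (EuclideanSpace ℝ (Fin (n + 1)))
      (fun x : M => TangentSpace (𝓡 (n + 1)) x))
    {S : Type*} [TopologicalSpace S] [ChartedSpace (EuclideanSpace ℝ (Fin n)) S]
    [IsManifold (𝓡 n) ∞ S]
    (f : S → M) (hf : IsSmoothImmersion n (n + 1) f)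
    (N : ∀ x : S, TangentSpace (𝓡 (n + 1)) (f x))
    (hN : IsUnitNormal (n := n) (formOf gbar) f N)
    (hconv : IsLocallyStrictlyConvex (n := n) (formOf gbar) f N)
    (h : M → ℝ) (hh : ContMDiff (𝓡 (n + 1)) 𝓘(ℝ, ℝ) ∞ h)
    (hdet : ∀ x : S,
      LinearMap.det (shapeOperator (n := n) (formOf gbar) f N x) = Real.exp (h (f x))) :
    ∃ α : ∀ x : S, TangentSpace (𝓡 n) x →L[ℝ] ℝ, IsSmoothOneForm α ∧
      ∀ lam : ℝ, 0 < lam → ∀ x : S,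
        scal (shapeMetric (n := n) (formOf gbar) f N) x ≥
          (1 / (n : ℝ)) *
              traceRicci (shapeMetric (n := n) (formOf gbar) f N) (pullback (n := n) (formOf gbar) f) x
          + divergence (shapeMetric (n := n) (formOf gbar) f N) α x
          - (1 + lam) / (4 * (n : ℝ) * ((n : ℝ) - 1)) *
              normSq₁ (shapeMetric (n := n) (formOf gbar) f N) x
                (fun v => mvfderiv (𝓡 n) (fun z => h (f z)) x v)
          - (1 + (n : ℝ) * lam⁻¹) / (4 * (n : ℝ) * ((n : ℝ) - 1)) *
              normSq₃ (shapeMetric (n := n) (formOf gbar) f N) x (curvNormal (n := n) (formOf gbar) f N x) := by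
  exact ⟨curvForm (formOf gbar) f N,
    isSmoothOneForm_curvForm (isSmoothMetric_formOf gbar) hf hN hconv, fun lam hlam x =>
      scal_shapeMetric_ge hn (isSmoothMetric_formOf gbar) hf hN hconv hh hdet hlam x⟩
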